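/- **Spaces.** For a finite set $I$, let $\overline{\mathcal M}_{0,I}(\mathbb R)$ be the Grothendieck–Knudsen compactification of the moduli space of real genus zero curves with distinct marked points labelled by $I$ (points: real stable curves of genus zero). Let $\widetilde{\mathcal M}_{0,I\cup\{0\}}(\mathbb R)$ be the two-sheeted cover of $\overline{\mathcal M}_{0,I\cup\{0\}}(\mathbb R)$ obtained by performing on the unit sphere of $\{a\in\mathbb R^I:\sum a_i=0\}$ (instead of the projective space) the iterated blow-up along the braid arrangement, the point labelled $0$ being at infinity. The strata of $\overline{\mathcal M}_{0,I}(\mathbb R)$ are the open cells $\mathcal M(T)$ of curves whose planar tree is a given planar unrooted tree $T$ with leaves cyclically labelled by $I$ (internal vertices of valency at least $3$); those of $\widetilde{\mathcal M}_{0,I\cup\{0\}}(\mathbb R)$ are the open cells $\mathcal M(T)$, with $T$ a planar rooted tree with input edges labelled by $I$, where moreover the affine coordinates increase weakly from left to right in $T$. Different trees may label the same stratum (reflections at the vertices; for the cover, at the vertices other than the root). Replacing every marked point (every one except the point $0$, for the cover) by a new component carrying two marked points gives embeddings $\widetilde{\mathcal M}_{0,2^n+1}(\mathbb R)\hookrightarrow\widetilde{\mathcal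 M}_{0,2^{n+1}+1}(\mathbb R)$ and $\overline{\mathcal M}_{0,3\cdot2^n}(\mathbb R)\hookrightarrow\overline{\mathcal M}_{0,3\cdot 2^{n+1}}(\mathbb R)$, where the marked points (other than the point $0$) are labelled by the vertices of depth $n$ of the complete rooted dyadic tree, respectively by the vertices at distance $n+1$ from a marked central vertex of the regular trivalent tree. The towers $\widetilde{\mathcal M}_{0,2^\infty}(\mathbb R)$ and $\overline{\mathcal M}_{0,3\cdot2^\infty}(\mathbb R)$ are the inductive limits, with the inductive limit topology; their strata are the images of the strata of the finite levels. $\mathrm{Homeo}_{cell}$ denotes the group of the homeomorphisms of a tower that permute its strata of each dimension. **Groups.** A symbol $(\alpha_1,\alpha_0,q_\sigma)$ consists of two finite dyadic planar rooted trees, a bijection $\sigma$ from the leaves of $\alpha_0$ to the leaves of $\alpha_1$, and, for each leaf $e$ of $\alpha_0$, an isomorphism $q_e$ from the infinite complete dyadic tree hanging at $e$ to the one hanging at $\sigma(e)$. Neretin's group $N$ is the group of equivalence classes of symbols under expansion, that is, the group of the bijections $e^\frown x\mapsto \sigma(e)^\frown q_e(x)$ of the boundary of the complete rooted dyadic tree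 which they represent. Thompson's group $V\subset N$ consists of the elements represented by symbols all of whose $q_e$ preserve the planar structure. The cyclic models $\mathcal V\subset\mathcal N$ are defined in the same way with the regular trivalent tree with a marked central vertex, and its finite trivalent subtrees containing this vertex. **Action on strata.** Let $T_{2^n}$ be the complete dyadic tree of depth $n$. Given $g\in N$ and a stratum $s$ of $\widetilde{\mathcal M}_{0,2^\infty}(\mathbb R)$, choose $n$, a symbol $(\alpha_1,\alpha_0,q_\sigma)$ of $g$ with $\alpha_0=T_{2^n}$, and a planar tree $T$ labelled by the leaves of $T_{2^n}$ that labels $s$ at level $n$. Relabel the leaves of $T$ by the leaves of $\alpha_1$ by means of $\sigma$; choose $m$ such that $\alpha_1$ can be expanded to $T_{2^m}$, and expand the leaves of $T$ correspondingly. The resulting tree, with leaves labelled by the leaves of $T_{2^m}$, labels at level $m$ a stratum $s'$, and one sets $g\cdot s:=s'$. The action of $\mathcal N$ on the strata of $\overline{\mathcal M}_{0,3\cdot2^\infty}(\mathbb R)$ is defined in the same way, with $T_{2^n}$ replaced by the ball $T_{3\cdot 2^n}$ of radius $n+1$ about the central vertex of the trivalent tree (it has $3\cdot2^n$ leaves),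 and with unrooted planar trees. **Theorem 1.** For every $g\in N$ and every stratum $s$ of $\widetilde{\mathcal M}_{0,2^\infty}(\mathbb R)$, such choices exist, and the stratum $g\cdot s$ does not depend on them. There is an injective group homomorphism $$\tilde\gamma:N\longrightarrow \mathrm{Homeo}_{cell}\bigl(\widetilde{\mathcal M}_{0,2^\infty}(\mathbb R)\bigr)$$ such that $\tilde\gamma(g)(s)=g\cdot s$ for every $g\in N$ and every stratum $s$. In particular $\tilde\gamma$ restricts to a faithful cellular action of Thompson's group $V$. The same statements hold for the cyclic tower $\overline{\mathcal M}_{0,3\cdot2^\infty}(\mathbb R)$, with $N$, $V$ replaced by $\mathcal N$, $\mathcal V$, and an injective homomorphism $\overline\gamma:\mathcal N\to \mathrm{Homeo}_{cell}\bigl(\overline{\mathcal M}_{0,3\cdot2^\infty}(\mathbb R)\bigr)$. -/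

import Mathlib

open Set Filter Topology

namespace ModularTower

/-! ### Ends of the dyadic tree, finite dyadic trees, Neretin and Thompson groups

`R` indexes the branches at the origin: `R = Unit` gives the complete rooted dyadic tree (one
branch) and `R = Fin 3` gives the regular (trivalent) dyadic tree with a marked central vertex, seen
as three complete rooted dyadic trees attached to that vertex. -/

/-- A vertex: a branch, and a finite word (`false` = left son, `true` = right son) in it. -/
abbrev Vertex (R : Type) : Type := R × List Bool

/-- A point of the boundary of the tree: a branch, and an infinite word in it. -/
abbrev End (R : Type) : Type := R × Stream' Bool

/-- `u.IsAbove z`: the end `z` passes through the vertex `u`. -/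
def Vertex.IsAbove {R : Type} (u : Vertex R) (z : End R) : Prop :=
  u.1 = z.1 ∧ z.2.take u.2.length = u.2

/-- `u.Le v`: the vertex `v` is `u` or a descendant of `u`. -/
def Vertex.Le {R : Type} (u v : Vertex R) : Prop := u.1 = v.1 ∧ u.2 <+: v.2

/-- A finite dyadic tree containing the origin, given by its set of leaves (which is a finite
complete prefix code): every end passes through exactly one leaf. The planar structure is the
left-to-right order of words. -/
structure DyadicTree (R : Type) where
  leaves : Set (Vertex R)
  finite : leaves.Finite
  existsUnique : ∀ z : End R, ∃! u, u ∈ leaves ∧ u.IsAbove z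

/-- An automorphism of the infinite complete rooted dyadic tree, as a bijection of its vertices
(finite words) preserving the level and the relation of descent. -/
structure TreeAut where
  toEquiv : List Bool ≃ List Bool
  length_eq : ∀ u, (toEquiv u).length = u.length
  prefix_iff : ∀ u v, toEquiv u <+: toEquiv v ↔ u <+: v

/-- The identity automorphism. -/
def TreeAut.id : TreeAut := ⟨Equiv.refl _, fun _ => rfl, fun _ _ => Iff.rfl⟩

/-- Symbols `(α₁, α₀, q_σ)`: two finite dyadic trees, a bijection `σ` from the leaves of `α₀` to
those of `α₁`, and for each leaf `e` of `α₀` an isomorphism `q e` from the infinite tree hanging at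
`e` to the infinite tree hanging at `σ e` (both are identified with the complete rooted dyadic
tree). The values of `σ` and `q` outside the leaves of `α₀` are irrelevant. -/
structure TreeSymbol (R : Type) where
  target : DyadicTree R
  source : DyadicTree R
  σ : Vertex R → Vertex R
  bijOn : Set.BijOn σ source.leaves target.leaves
  q : Vertex R → TreeAut

/-- The symbol `s` represents the bijection `g` of the boundary: for each leaf `e` of the source
tree, `g` sends the end `e⌢x` to the end `σ(e)⌢q_e(x)`. Expanding a symbol does not change `g`, and
two symbols have a common expansion if and only if they represent the same `g`. -/
def TreeSymbol.Represents {R : Type} (s : TreeSymbol R) (g : Equiv.Perm (End R)) : Prop :=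
  ∀ e ∈ s.source.leaves, ∀ x : Stream' Bool,
    (g (e.1, e.2 ++ₛ x)).1 = (s.σ e).1 ∧
    ∀ n : ℕ, (g (e.1, e.2 ++ₛ x)).2.take ((s.σ e).2.length + n) = (s.σ e).2 ++ (s.q e).toEquiv (x.take n)

/-- A symbol of Thompson type: the isomorphisms between the infinite trees hanging at the leaves
preserve the planar structure. -/
def TreeSymbol.IsPlanar {R : Type} (s : TreeSymbol R) : Prop :=
  ∀ e ∈ s.source.leaves, s.q e = TreeAut.id

namespace TreeAut

theorem ext' {a b : TreeAut} (h : ∀ u, a.toEquiv u = b.toEquiv u) : a = b := by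
  cases a; cases b
  simp only [mk.injEq]
  exact Equiv.ext h

def comp (a b : TreeAut) : TreeAut :=
  ⟨b.toEquiv.trans a.toEquiv, fun u => by simp [a.length_eq, b.length_eq],
    fun u v => by simp [a.prefix_iff, b.prefix_iff]⟩

def inv (a : TreeAut) : TreeAut :=
  ⟨a.toEquiv.symm, fun u => by rw [← a.length_eq, Equiv.apply_symm_apply],
    fun u v => by rw [← a.prefix_iff, Equiv.apply_symm_apply, Equiv.apply_symm_apply]⟩

theorem apply_append (a : TreeAut) (w u : List Bool) :
    a.toEquiv (w ++ u) = a.toEquiv w ++ (a.toEquiv (w ++ u)).drop w.length := by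
  obtain ⟨t, ht⟩ := (a.prefix_iff w (w ++ u)).2 (List.prefix_append w u)
  rw [← ht, ← a.length_eq w, List.drop_left]

theorem inv_append (a : TreeAut) (w u : List Bool) :
    a.toEquiv.symm (a.toEquiv w ++ u) = w ++ (a.toEquiv.symm (a.toEquiv w ++ u)).drop w.length := by
  have := a.inv.apply_append (a.toEquiv w) u
  simpa [inv, a.length_eq] using this

/-- The automorphism induced by `a` between the trees hanging at `w` and at `a w`. -/
def restrict (a : TreeAut) (w : List Bool) : TreeAut where
  toEquiv :=
    { toFun := fun u => (a.toEquiv (w ++ u)).drop w.length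
      invFun := fun u => (a.toEquiv.symm (a.toEquiv w ++ u)).drop w.length
      left_inv := fun u => by
        change List.drop _ (a.toEquiv.symm (a.toEquiv w ++ (a.toEquiv (w ++ u)).drop w.length)) = u
        rw [← a.apply_append, Equiv.symm_apply_apply, List.drop_left]
      right_inv := fun u => by
        change List.drop _ (a.toEquiv (w ++ (a.toEquiv.symm (a.toEquiv w ++ u)).drop w.length)) = u
        rw [← a.inv_append, Equiv.apply_symm_apply, ← a.length_eq w, List.drop_left] }
  length_eq := fun u => by
    simp [a.length_eq]
  prefix_iff := fun u v => by
    change (a.toEquiv (w ++ u)).drop w.length <+: (a.toEquiv (w ++ v)).drop w.length ↔ u <+: v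
    rw [← List.prefix_append_right_inj (a.toEquiv w), ← a.apply_append, ← a.apply_append,
      a.prefix_iff, List.prefix_append_right_inj]

theorem apply_append' (a : TreeAut) (w u : List Bool) :
    a.toEquiv (w ++ u) = a.toEquiv w ++ (a.restrict w).toEquiv u := a.apply_append w u

end TreeAut

/-- Local form of being represented by a symbol whose automorphisms belong to `Q`. -/
def LocallySphero {R : Type} (Q : Set TreeAut) (n : ℕ) (g : Equiv.Perm (End R)) : Prop :=
  ∀ u : Vertex R, n ≤ u.2.length → ∃ v : Vertex R, ∃ a ∈ Q, n + v.2.length ≥ u.2.length ∧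
    ∀ x : Stream' Bool, (g (u.1, u.2 ++ₛ x)).1 = v.1 ∧
      ∀ k : ℕ, (g (u.1, u.2 ++ₛ x)).2.take (v.2.length + k) = v.2 ++ a.toEquiv (x.take k)

theorem take_append_stream (u : List Bool) (x : Stream' Bool) (k : ℕ) :
    (u ++ₛ x).take (u.length + k) = u ++ x.take k := by
  induction u with
  | nil => simp
  | cons b u ih =>
    rw [Stream'.cons_append_stream, List.length_cons, Nat.add_right_comm, Stream'.take_succ_cons, ih,
      List.cons_append]

theorem take_append_stream_self (u : List Bool) (x : Stream' Bool) :
    (u ++ₛ x).take u.length = u := by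
  simpa using take_append_stream u x 0

theorem eq_append_of_take {u : List Bool} {z : Stream' Bool} (h : z.take u.length = u) :
    u ++ₛ z.drop u.length = z := by
  have := Stream'.append_take_drop u.length z
  rwa [h] at this

theorem take_isPrefix (z : Stream' Bool) {m n : ℕ} (h : m ≤ n) : z.take m <+: z.take n := by
  have := @Stream'.take_take _ z m n
  rw [min_eq_right h] at this
  rw [← this]
  exact List.take_prefix _ _

theorem locallySphero_of_symbol {R : Type} {Q : Set TreeAut} (hQ : ∀ a ∈ Q, ∀ w, a.restrict w ∈ Q)
    {s : TreeSymbol R} (hs : ∀ e ∈ s.source.leaves, s.q e ∈ Q) {g : Equiv.Perm (End R)}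
    (h : s.Represents g) : ∃ n, LocallySphero Q n g := by
  obtain ⟨n, hn⟩ := (s.source.finite.image fun e => e.2.length).bddAbove
  refine ⟨n, fun u hu => ?_⟩
  obtain ⟨e, ⟨he, he1, he2⟩, -⟩ := s.source.existsUnique (u.1, u.2 ++ₛ Stream'.const false)
  have hen : e.2.length ≤ n := hn ⟨e, he, rfl⟩
  have hpre : e.2 <+: u.2 := by
    have h1 := take_isPrefix (u.2 ++ₛ Stream'.const false) (hen.trans hu)
    rwa [take_append_stream_self, show (u.2 ++ₛ Stream'.const false).take e.2.length = e.2 from he2] at h1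
  obtain ⟨w, hw⟩ := hpre
  have hw' : u.2.length = e.2.length + w.length := by rw [← hw, List.length_append]
  refine ⟨((s.σ e).1, (s.σ e).2 ++ (s.q e).toEquiv w), (s.q e).restrict w, hQ _ (hs e he) w, ?_, ?_⟩
  · simp only [List.length_append, (s.q e).length_eq]; omega
  · intro x
    have h1 := h e he (w ++ₛ x)
    have h2 : ((e.1, e.2 ++ₛ (w ++ₛ x)) : End R) = (u.1, u.2 ++ₛ x) := by
      rw [← Stream'.append_append_stream, hw, show e.1 = u.1 from he1]
    rw [h2] at h1
    refine ⟨h1.1, fun k => ?_⟩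
    have h3 := h1.2 (w.length + k)
    rw [take_append_stream, TreeAut.apply_append'] at h3
    simp only [List.length_append, (s.q e).length_eq, List.append_assoc]
    rw [Nat.add_assoc, h3]

theorem exists_symbol_of_locallySphero {R : Type} [Finite R] {Q : Set TreeAut} {n : ℕ}
    {g : Equiv.Perm (End R)} (h : LocallySphero Q n g) :
    ∃ s : TreeSymbol R, (∀ e ∈ s.source.leaves, s.q e ∈ Q) ∧ s.Represents g ∧
      s.source.leaves = {u | u.2.length = n} := by
  classical
  have hfin : {u : Vertex R | u.2.length = n}.Finite := by
    have h1 : ((Set.univ : Set R) ×ˢ {l : List Bool | l.length = n}).Finite :=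
      Set.finite_univ.prod (List.finite_length_eq Bool n)
    refine h1.subset fun u hu => ⟨trivial, hu⟩
  have h' : ∀ u : Vertex R, ∃ v : Vertex R, ∃ a : TreeAut, u.2.length = n → a ∈ Q ∧
      ∀ x : Stream' Bool, (g (u.1, u.2 ++ₛ x)).1 = v.1 ∧
      ∀ k : ℕ, (g (u.1, u.2 ++ₛ x)).2.take (v.2.length + k) = v.2 ++ a.toEquiv (x.take k) := by
    intro u
    by_cases hu : u.2.length = n
    · obtain ⟨v, a, ha, -, hva⟩ := h u hu.ge
      exact ⟨v, a, fun _ => ⟨ha, hva⟩⟩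
    · exact ⟨u, TreeAut.id, fun h => absurd h hu⟩
  choose σ q hσ using h'
  have hab : ∀ u : Vertex R, u.2.length = n → ∀ z : End R, u.IsAbove z → (σ u).IsAbove (g z) := by
    intro u hu z hz
    have h1 := (hσ u hu).2 (z.2.drop u.2.length)
    rw [eq_append_of_take hz.2, show ((u.1, z.2) : End R) = z from Prod.ext hz.1 rfl] at h1
    refine ⟨h1.1.symm, ?_⟩
    have h2 := h1.2 0
    have h3 : (q u).toEquiv [] = [] := List.length_eq_zero_iff.1 (by rw [(q u).length_eq]; rfl)
    simpa [Stream'.take_zero, h3] using h2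
  have hba : ∀ u : Vertex R, u.2.length = n → ∀ z : End R, (σ u).IsAbove (g z) → u.IsAbove z := by
    intro u hu z hz
    -- the end below `u` that is sent to `g z`
    let y : Stream' Bool := (g z).2.drop (σ u).2.length
    let x : Stream' Bool := fun i => ((q u).toEquiv.symm (y.take (i + 1))).getD i false
    have hx : ∀ k, x.take k = (q u).toEquiv.symm (y.take k) := by
      intro k
      induction k with
      | zero =>
        symm
        exact List.length_eq_zero_iff.1 (by
          have := (q u).inv.length_eq (y.take 0)
          simpa [TreeAut.inv] using this)
      | succ k ih =>
        have hl : ((q u).toEquiv.symm (y.take (k + 1))).length = k + 1 := by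
          have := (q u).inv.length_eq (y.take (k + 1))
          simpa [TreeAut.inv] using this
        have hp : (q u).toEquiv.symm (y.take k) <+: (q u).toEquiv.symm (y.take (k + 1)) :=
          ((q u).inv.prefix_iff _ _).2 (take_isPrefix y (Nat.le_succ k))
        rw [Stream'.take_succ', ih]
        obtain ⟨t, ht⟩ := hp
        have hl' : ((q u).toEquiv.symm (y.take k)).length = k := by
          have := (q u).inv.length_eq (y.take k)
          simpa [TreeAut.inv] using this
        have ht1 : t.length = 1 := by
          have := congrArg List.length ht
          rw [List.length_append, hl, hl'] at this; omega
        obtain ⟨b, rfl⟩ := List.length_eq_one_iff.1 ht1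
        rw [← ht]
        congr 2
        change List.getD _ k false = b
        rw [← ht, List.getD_append_right _ _ _ _ hl'.le, hl']
        simp
    have h1 := (hσ u hu).2 x
    have h2 : g (u.1, u.2 ++ₛ x) = g z := by
      refine Prod.ext (h1.1.trans hz.1) ?_
      refine Stream'.take_theorem _ _ fun k => ?_
      have h3 : (g (u.1, u.2 ++ₛ x)).2.take ((σ u).2.length + k)
          = (g z).2.take ((σ u).2.length + k) := by
        rw [h1.2 k, hx, Equiv.apply_symm_apply]
        conv_rhs => rw [← eq_append_of_take hz.2]
        rw [take_append_stream]
      have h4 := congrArg (List.take k) h3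
      rwa [Stream'.take_take, Stream'.take_take, min_eq_right (Nat.le_add_left _ _)] at h4
    have h3 := g.injective h2
    rw [← h3]
    exact ⟨rfl, take_append_stream_self _ _⟩
  have hlen : ∀ z : End R, ∃! u : Vertex R, u.2.length = n ∧ u.IsAbove z := by
    intro z
    refine ⟨(z.1, z.2.take n), ⟨by simp [Stream'.length_take], rfl, by simp [Stream'.length_take]⟩, ?_⟩
    rintro u ⟨hu, h1, h2⟩
    rw [hu] at h2
    exact Prod.ext h1 h2.symm
  have hinj : Set.InjOn σ {u | u.2.length = n} := by
    intro u hu u' hu' huu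
    have h1 : u.IsAbove (u.1, u.2 ++ₛ Stream'.const false) := ⟨rfl, take_append_stream_self _ _⟩
    have h2 := hab u hu _ h1
    rw [huu] at h2
    have h3 := hba u' hu' _ h2
    exact (hlen _).unique ⟨hu, h1⟩ ⟨hu', h3⟩
  refine ⟨⟨⟨σ '' {u | u.2.length = n}, hfin.image _, ?_⟩, ⟨{u | u.2.length = n}, hfin, hlen⟩, σ,
    hinj.bijOn_image, q⟩, fun e he => (hσ e he).1, fun e he x => (hσ e he).2 x, rfl⟩
  intro z
  obtain ⟨u, ⟨hu, huz⟩, huu⟩ := hlen (g.symm z)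
  refine ⟨σ u, ⟨⟨u, hu, rfl⟩, by simpa using hab u hu _ huz⟩, ?_⟩
  rintro _ ⟨⟨u', hu', rfl⟩, h1⟩
  rw [huu u' ⟨hu', hba u' hu' _ (by simpa using h1)⟩]

theorem LocallySphero.mul {R : Type} {Q : Set TreeAut} (hQ : ∀ a ∈ Q, ∀ b ∈ Q, a.comp b ∈ Q)
    {m n : ℕ} {g h : Equiv.Perm (End R)} (hg : LocallySphero Q m g) (hh : LocallySphero Q n h) :
    LocallySphero Q (m + n) (g * h) := by
  intro u hu
  obtain ⟨v, b, hb, hv, hvx⟩ := hh u (by omega)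
  obtain ⟨w, a, ha, hw, hwx⟩ := hg v (by omega)
  refine ⟨w, a.comp b, hQ a ha b hb, by omega, fun x => ?_⟩
  have h1 := hvx x
  have h2 : (h (u.1, u.2 ++ₛ x)).2.take v.2.length = v.2 := by
    have h3 : b.toEquiv [] = [] := List.length_eq_zero_iff.1 (by rw [b.length_eq]; rfl)
    simpa [Stream'.take_zero, h3] using h1.2 0
  have h4 := hwx ((h (u.1, u.2 ++ₛ x)).2.drop v.2.length)
  rw [eq_append_of_take h2, show ((v.1, (h (u.1, u.2 ++ₛ x)).2) : End R) = h (u.1, u.2 ++ₛ x) from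
    Prod.ext h1.1.symm rfl] at h4
  refine ⟨h4.1, fun k => ?_⟩
  rw [Equiv.Perm.mul_apply, h4.2 k]
  have h5 := h1.2 k
  conv at h5 => lhs; rw [← eq_append_of_take h2]
  rw [take_append_stream] at h5
  rw [List.append_cancel_left h5]
  rfl

theorem exists_inv_symbol {R : Type} {Q : Set TreeAut} (hQ : ∀ a ∈ Q, a.inv ∈ Q)
    {s : TreeSymbol R} (hs : ∀ e ∈ s.source.leaves, s.q e ∈ Q) {g : Equiv.Perm (End R)}
    (h : s.Represents g) :
    ∃ t : TreeSymbol R, (∀ e ∈ t.source.leaves, t.q e ∈ Q) ∧ t.Represents g⁻¹ := by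
  classical
  let i : Vertex R → Vertex R := fun f =>
    if hf : f ∈ s.target.leaves then (s.bijOn.surjOn hf).choose else f
  have hi : ∀ f ∈ s.target.leaves, i f ∈ s.source.leaves ∧ s.σ (i f) = f := by
    intro f hf
    have := (s.bijOn.surjOn hf).choose_spec
    simpa only [i, dif_pos hf] using this
  have hbij : Set.BijOn i s.target.leaves s.source.leaves := by
    refine ⟨fun f hf => (hi f hf).1, fun f hf f' hf' hff => ?_, fun e he => ?_⟩
    · rw [← (hi f hf).2, hff, (hi f' hf').2]
    · exact ⟨s.σ e, s.bijOn.mapsTo he,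
        s.bijOn.injOn (hi _ (s.bijOn.mapsTo he)).1 he (hi _ (s.bijOn.mapsTo he)).2⟩
  refine ⟨⟨s.source, s.target, i, hbij, fun f => (s.q (i f)).inv⟩,
    fun f hf => hQ _ (hs _ (hi f hf).1), fun f hf y => ?_⟩
  obtain ⟨z, hz⟩ := g.surjective ((f.1, f.2 ++ₛ y) : End R)
  have hz' : g⁻¹ (f.1, f.2 ++ₛ y) = z := by rw [← hz]; simp
  rw [hz']
  obtain ⟨e, ⟨he, hez⟩, -⟩ := s.source.existsUnique z
  have h1 := h e he (z.2.drop e.2.length)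
  rw [eq_append_of_take hez.2, show ((e.1, z.2) : End R) = z from Prod.ext hez.1 rfl, hz] at h1
  have hef : s.σ e = f := by
    refine (s.target.existsUnique (f.1, f.2 ++ₛ y)).unique ⟨s.bijOn.mapsTo he, h1.1.symm, ?_⟩
      ⟨hf, rfl, take_append_stream_self _ _⟩
    have h2 := h1.2 0
    have h3 : (s.q e).toEquiv [] = [] := List.length_eq_zero_iff.1 (by rw [(s.q e).length_eq]; rfl)
    simpa [Stream'.take_zero, h3] using h2
  have hie : i f = e := by
    refine s.bijOn.injOn (hi f hf).1 he ?_
    rw [(hi f hf).2, hef]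
  change z.1 = (i f).1 ∧ ∀ n, z.2.take ((i f).2.length + n) = (i f).2 ++ (s.q (i f)).toEquiv.symm (y.take n)
  rw [hie]
  refine ⟨hez.1.symm, fun n => ?_⟩
  have h2 := h1.2 n
  rw [hef] at h2
  change (f.2 ++ₛ y).take _ = _ at h2
  rw [take_append_stream] at h2
  rw [List.append_cancel_left h2, Equiv.symm_apply_apply]
  conv_lhs => rw [← eq_append_of_take hez.2]
  rw [take_append_stream]

theorem id_locallySphero {R : Type} {Q : Set TreeAut} (hQ : TreeAut.id ∈ Q) :
    LocallySphero Q 0 (1 : Equiv.Perm (End R)) := fun u _ =>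
  ⟨u, TreeAut.id, hQ, by omega, fun x => ⟨rfl, fun k => take_append_stream _ _ _⟩⟩

/-- The group of spheromorphisms: the bijections of the boundary represented by symbols. The group
law corresponds to the composition of symbols with matching middle tree. -/
def spheromorphismGroup (R : Type) [Finite R] : Subgroup (Equiv.Perm (End R)) where
  carrier := {g | ∃ s : TreeSymbol R, s.Represents g}
  mul_mem' := by
    rintro g h ⟨s, hs⟩ ⟨t, ht⟩
    obtain ⟨m, hm⟩ := locallySphero_of_symbol (Q := Set.univ) (fun _ _ _ => trivial)
      (fun _ _ => trivial) hs
    obtain ⟨n, hn⟩ := locallySphero_of_symbol (Q := Set.univ) (fun _ _ _ => trivial)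
      (fun _ _ => trivial) ht
    obtain ⟨r, -, hr, -⟩ := exists_symbol_of_locallySphero
      (LocallySphero.mul (Q := Set.univ) (fun _ _ _ _ => trivial) hm hn)
    exact ⟨r, hr⟩
  one_mem' := by
    obtain ⟨r, -, hr, -⟩ := exists_symbol_of_locallySphero
      (id_locallySphero (R := R) (Q := Set.univ) trivial)
    exact ⟨r, hr⟩
  inv_mem' := by
    rintro g ⟨s, hs⟩
    obtain ⟨t, -, ht⟩ := exists_inv_symbol (Q := Set.univ) (fun _ _ => trivial)
      (fun _ _ => trivial) hs
    exact ⟨t, ht⟩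

/-- The group of the bijections of the boundary represented by symbols of Thompson type. -/
def thompsonGroup (R : Type) [Finite R] : Subgroup (Equiv.Perm (End R)) where
  carrier := {g | ∃ s : TreeSymbol R, s.IsPlanar ∧ s.Represents g}
  mul_mem' := by
    rintro g h ⟨s, hs', hs⟩ ⟨t, ht', ht⟩
    have hsec : ∀ a ∈ ({TreeAut.id} : Set TreeAut), ∀ w, a.restrict w ∈ ({TreeAut.id} : Set TreeAut) := by
      rintro a rfl w
      refine TreeAut.ext' fun u => ?_
      change (w ++ u).drop w.length = u
      simp
    obtain ⟨m, hm⟩ := locallySphero_of_symbol hsec hs' hs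
    obtain ⟨n, hn⟩ := locallySphero_of_symbol hsec ht' ht
    obtain ⟨r, hr', hr, -⟩ := exists_symbol_of_locallySphero (hm.mul (by
      rintro a rfl b rfl
      exact TreeAut.ext' fun u => rfl) hn)
    exact ⟨r, hr', hr⟩
  one_mem' := by
    obtain ⟨r, hr', hr, -⟩ := exists_symbol_of_locallySphero
      (id_locallySphero (R := R) (Q := {TreeAut.id}) rfl)
    exact ⟨r, hr', hr⟩
  inv_mem' := by
    rintro g ⟨s, hs', hs⟩
    obtain ⟨t, ht', ht⟩ := exists_inv_symbol (Q := {TreeAut.id}) (by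
      rintro a rfl
      exact TreeAut.ext' fun u => rfl) hs' hs
    exact ⟨t, ht', ht⟩

theorem thompsonGroup_le (R : Type) [Finite R] : thompsonGroup R ≤ spheromorphismGroup R := by
  rintro g ⟨s, -, hs⟩
  exact ⟨s, hs⟩

end ModularTower

namespace ModularTower

/-! ### Real stable curves of genus zero -/

/-- Determinant of two vectors of `ℝ²`. -/
def det2 (u v : ℝ × ℝ) : ℝ := u.1 * v.2 - u.2 * v.1

/-- `X` gives homogeneous coordinates of pairwise distinct points of the real projective line. -/
def IsConfig {I : Type} (X : I → ℝ × ℝ) : Prop := ∀ i j, i ≠ j → det2 (X i) (X j) ≠ 0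

/-- The points of `∏ ℝP¹`, the product being over the quadruples of distinct labels;
`OnePoint ℝ` is the real projective line. -/
abbrev QuadSpace (I : Type) : Type := (Fin 4 ↪ I) → OnePoint ℝ

/-- All the cross-ratios of a configuration, normalized so that the cross-ratio of the points
labelled `(a, b, c, d)` is positive when they occur in this cyclic order, tends to `0` when `a, b`
collide or `c, d` collide, and tends to `∞` when `b, c` collide or `a, d` collide. -/
noncomputable def crossRatio {I : Type} (X : I → ℝ × ℝ) : QuadSpace I := fun q =>
  ((det2 (X (q 0)) (X (q 1)) * det2 (X (q 2)) (X (q 3)) /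
    (det2 (X (q 1)) (X (q 2)) * det2 (X (q 0)) (X (q 3))) : ℝ) : OnePoint ℝ)

/-- The Grothendieck-Knudsen compactification of the space of configurations of distinct points of
the real projective line labelled by `I`, modulo `PGL(2, ℝ)`: the space of real stable curves of
genus zero with points labelled by `I`, realized as the closure of the space of configurations in
its embedding by the cross-ratios. -/
def Mbar (I : Type) : Set (QuadSpace I) := closure {p | ∃ X, IsConfig X ∧ p = crossRatio X}

/-- The configuration of real points `a i`, together with the point at infinity (labelled `none`). -/
def affineConfig {I : Type} (a : I → ℝ) : Option I → ℝ × ℝ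
  | none => (1, 0)
  | some i => (a i, 1)

/-- The two-sheeted cover of `Mbar (Option I)`, where `none` is the label of the point `x₀ = ∞`:
the closure of the set of `(a, p)` with `a` in the complement of the braid arrangement in the unit
sphere of `{a ∈ ℝ^I | ∑ a_i = 0}`, and `p` the point of `Mbar (Option I)` given by `∞` and the
`a_i`. It is the iterated blow-up of the sphere along the braid arrangement; the blow-down map is
`(a, p) ↦ a` and the covering map is `(a, p) ↦ p`. -/
def Mtilde (I : Type) [Fintype I] : Set ((I → ℝ) × QuadSpace (Option I)) :=
  closure {y | ∑ i, y.1 i = 0 ∧ ∑ i, y.1 i ^ 2 = 1 ∧ Function.Injective y.1 ∧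
    y.2 = crossRatio (affineConfig y.1)}

open Classical in
/-- Stabilization along `f : J → I`, whose fibres have at most two elements: each marked point `x_i`
for which the fibre is a pair is replaced by a new component with two marked points, labelled by the
fibre. A cross-ratio of four labels is unchanged if their images in `I` are distinct, and has the
degenerate value prescribed by the coincidences between the images otherwise. -/
noncomputable def stabilize {I J : Type} (f : J → I) (p : QuadSpace I) : QuadSpace J := fun q =>
  if h : Function.Injective (fun k => f (q k)) then p ⟨fun k => f (q k), h⟩
  else if f (q 0) = f (q 1) ∨ f (q 2) = f (q 3) then ((0 : ℝ) : OnePoint ℝ)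
  else if f (q 1) = f (q 2) ∨ f (q 0) = f (q 3) then OnePoint.infty
  else ((-1 : ℝ) : OnePoint ℝ)

theorem continuous_stabilize {I J : Type} (f : J → I) : Continuous (stabilize f) := by
  refine continuous_pi fun q => ?_
  unfold stabilize
  split_ifs
  · exact continuous_apply _
  all_goals exact continuous_const

theorem continuous_det2 : Continuous fun z : (ℝ × ℝ) × (ℝ × ℝ) => det2 z.1 z.2 := by
  unfold det2
  fun_prop

theorem det2_swap (u v : ℝ × ℝ) : det2 v u = - det2 u v := by unfold det2; ring

theorem det2_self (u : ℝ × ℝ) : det2 u u = 0 := by unfold det2; ring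

theorem tendsto_coe_div_infty {E : Type} {l : Filter E} {u v : E → ℝ} {c : ℝ} (hc : c ≠ 0)
    (hu : Tendsto u l (𝓝 c)) (hv : Tendsto v l (𝓝 0)) (hv0 : ∀ᶠ t in l, v t ≠ 0) :
    Tendsto (fun t => ((u t / v t : ℝ) : OnePoint ℝ)) l (𝓝 OnePoint.infty) := by
  have h1 : Tendsto (fun t => u t / v t) l (cocompact ℝ) := by
    rw [← Metric.cobounded_eq_cocompact, ← tendsto_norm_atTop_iff_cobounded]
    have h2 : Tendsto (fun t => ‖v t‖) l (𝓝[>] 0) := by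
      refine tendsto_nhdsWithin_iff.2 ⟨by simpa using hv.norm, ?_⟩
      filter_upwards [hv0] with t ht using by simpa using ht
    have h3 := hu.norm.pos_mul_atTop (norm_pos_iff.2 hc) h2.inv_tendsto_nhdsGT_zero
    refine h3.congr fun t => ?_
    simp [div_eq_mul_inv]
  rw [← coclosedCompact_eq_cocompact] at h1
  exact OnePoint.tendsto_coe_infty.comp h1

/-- Configurations in which the points with the same image under `f` collide converge to the
stabilization. -/
theorem tendsto_crossRatio {I J E : Type} {f : J → I}
    (hf : ∀ i j k, f i = f j → f j = f k → i = j ∨ j = k ∨ i = k) {l : Filter E}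
    {X : I → ℝ × ℝ} (hX : IsConfig X) {Y : E → J → ℝ × ℝ}
    (hY : ∀ j, Tendsto (fun t => Y t j) l (𝓝 (X (f j)))) (hYc : ∀ᶠ t in l, IsConfig (Y t)) :
    Tendsto (fun t => crossRatio (Y t)) l (𝓝 (stabilize f (crossRatio X))) := by
  rw [tendsto_pi_nhds]
  intro q
  have hd : ∀ a b, Tendsto (fun t => det2 (Y t a) (Y t b)) l (𝓝 (det2 (X (f a)) (X (f b)))) :=
    fun a b => (continuous_det2.tendsto (X (f a), X (f b))).comp ((hY a).prodMk_nhds (hY b))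
  have hq : ∀ {a b}, a ≠ b → q a ≠ q b := fun h h' => h (q.injective h')
  have h3 : ∀ a b c, a ≠ b → b ≠ c → a ≠ c → f (q a) = f (q b) → f (q b) = f (q c) → False := by
    intro a b c hab hbc hac h1 h2
    rcases hf _ _ _ h1 h2 with h | h | h
    exacts [hq hab h, hq hbc h, hq hac h]
  have hne : ∀ a b, f (q a) ≠ f (q b) → det2 (X (f (q a))) (X (f (q b))) ≠ 0 :=
    fun a b h => hX _ _ h
  have hnum := (hd (q 0) (q 1)).mul (hd (q 2) (q 3))
  have hden := (hd (q 1) (q 2)).mul (hd (q 0) (q 3))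
  have hcoe : ∀ {u : E → ℝ} {c : ℝ}, Tendsto u l (𝓝 c) →
      Tendsto (fun t => (u t : OnePoint ℝ)) l (𝓝 (c : OnePoint ℝ)) :=
    fun h => (OnePoint.continuous_coe.tendsto _).comp h
  unfold stabilize
  split_ifs with h h01 h12
  · have hne' : ∀ a b, a ≠ b → det2 (X (f (q a))) (X (f (q b))) ≠ 0 :=
      fun a b hab => hne a b fun h' => hab (h h')
    exact hcoe (hnum.div hden (mul_ne_zero (hne' 1 2 (by decide)) (hne' 0 3 (by decide))))
  · have h1 : f (q 1) ≠ f (q 2) := by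
      intro h'
      rcases h01 with h0 | h0
      · exact h3 0 1 2 (by decide) (by decide) (by decide) h0 h'
      · exact h3 1 2 3 (by decide) (by decide) (by decide) h' h0
    have h2 : f (q 0) ≠ f (q 3) := by
      intro h'
      rcases h01 with h0 | h0
      · exact h3 1 0 3 (by decide) (by decide) (by decide) h0.symm h'
      · exact h3 0 3 2 (by decide) (by decide) (by decide) h' h0.symm
    have h0 : det2 (X (f (q 0))) (X (f (q 1))) * det2 (X (f (q 2))) (X (f (q 3))) = 0 := by
      rcases h01 with h0 | h0
      · rw [h0, det2_self, zero_mul]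
      · rw [h0, det2_self, mul_zero]
    have := hcoe (hnum.div hden (mul_ne_zero (hne 1 2 h1) (hne 0 3 h2)))
    rwa [h0, zero_div] at this
  · push Not at h01
    have h0 : det2 (X (f (q 1))) (X (f (q 2))) * det2 (X (f (q 0))) (X (f (q 3))) = 0 := by
      rcases h12 with h0 | h0
      · rw [h0, det2_self, zero_mul]
      · rw [h0, det2_self, mul_zero]
    rw [h0] at hden
    refine tendsto_coe_div_infty (mul_ne_zero (hne 0 1 h01.1) (hne 2 3 h01.2)) hnum hden ?_
    filter_upwards [hYc] with t ht
    exact mul_ne_zero (ht _ _ (hq (by decide))) (ht _ _ (hq (by decide)))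
  · push Not at h01 h12
    have h0 : f (q 0) = f (q 2) ∨ f (q 1) = f (q 3) := by
      by_contra hcon
      push Not at hcon
      refine h fun a b hab => ?_
      have hab' : f (q a) = f (q b) := hab
      fin_cases a <;> fin_cases b <;> simp_all
    have hv : det2 (X (f (q 0))) (X (f (q 1))) * det2 (X (f (q 2))) (X (f (q 3))) /
        (det2 (X (f (q 1))) (X (f (q 2))) * det2 (X (f (q 0))) (X (f (q 3)))) = -1 := by
      rw [div_eq_iff (mul_ne_zero (hne 1 2 h12.1) (hne 0 3 h12.2))]
      rcases h0 with h0 | h0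
      · rw [h0, det2_swap (X (f (q 1)))]; ring
      · rw [h0, det2_swap (X (f (q 3))) (X (f (q 2)))]; ring
    have := hcoe (hnum.div hden (mul_ne_zero (hne 1 2 h12.1) (hne 0 3 h12.2)))
    rwa [hv] at this

theorem eventually_isConfig {I J E : Type} [Finite J] {f : J → I} {l : Filter E}
    {X : I → ℝ × ℝ} (hX : IsConfig X) {Y : E → J → ℝ × ℝ}
    (hY : ∀ j, Tendsto (fun t => Y t j) l (𝓝 (X (f j))))
    (hYf : ∀ i j, i ≠ j → f i = f j → ∀ᶠ t in l, det2 (Y t i) (Y t j) ≠ 0) :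
    ∀ᶠ t in l, IsConfig (Y t) := by
  unfold IsConfig
  refine eventually_all.2 fun i => eventually_all.2 fun j => ?_
  by_cases hij : i = j
  · exact Eventually.of_forall fun t h => absurd hij h
  by_cases hf : f i = f j
  · filter_upwards [hYf i j hij hf] with t ht _ using ht
  · have h1 : Tendsto (fun t => det2 (Y t i) (Y t j)) l (𝓝 (det2 (X (f i)) (X (f j)))) :=
      (continuous_det2.tendsto (X (f i), X (f j))).comp ((hY i).prodMk_nhds (hY j))
    filter_upwards [h1.eventually_ne (hX _ _ hf)] with t ht _ using ht

theorem crossRatio_congr {I : Type} {X X' : I → ℝ × ℝ} {k : ℝ} {μ : I → ℝ} (hk : k ≠ 0)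
    (hμ : ∀ i, μ i ≠ 0) (h : ∀ i j, det2 (X' i) (X' j) = k * μ i * μ j * det2 (X i) (X j)) :
    crossRatio X' = crossRatio X := by
  funext q
  unfold crossRatio
  congr 1
  have hc : k ^ 2 * μ (q 0) * μ (q 1) * μ (q 2) * μ (q 3) ≠ 0 := by simp [hk, hμ]
  rw [← mul_div_mul_left (det2 (X (q 0)) (X (q 1)) * _) _ hc, h, h, h, h]
  congr 1 <;> ring

theorem crossRatio_smul {I : Type} (a : I → ℝ) {c : ℝ} (hc : c ≠ 0) :
    crossRatio (affineConfig fun i => a i / c) = crossRatio (affineConfig a) := by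
  refine crossRatio_congr (k := c⁻¹) (μ := fun i => i.elim c fun _ => 1) (inv_ne_zero hc) ?_ ?_
  · rintro (_ | i) <;> simp [hc]
  · rintro (_ | i) (_ | j) <;> simp [det2, affineConfig, hc]
    ring

theorem isConfig_affineConfig {I : Type} {a : I → ℝ} (ha : Function.Injective a) :
    IsConfig (affineConfig a) := by
  rintro (_ | i) (_ | j) hij
  · exact absurd rfl hij
  · simp [det2, affineConfig]
  · simp [det2, affineConfig]
  · have : a i ≠ a j := fun h => hij (congrArg some (ha h))
    simpa [det2, affineConfig, sub_eq_zero] using this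

theorem fibre_le_two {I J : Type} (e : J ≃ I × Bool) (i j k : J) (h1 : (e i).1 = (e j).1)
    (h2 : (e j).1 = (e k).1) : i = j ∨ j = k ∨ i = k := by
  have h : ∀ i j : J, (e i).1 = (e j).1 → (e i).2 = (e j).2 → i = j :=
    fun i j h h' => e.injective (Prod.ext h h')
  rcases hi : (e i).2 <;> rcases hj : (e j).2 <;> rcases hk : (e k).2
  all_goals first
    | exact Or.inl (h _ _ h1 (hi.trans hj.symm))
    | exact Or.inr (Or.inl (h _ _ h2 (hj.trans hk.symm)))
    | exact Or.inr (Or.inr (h _ _ (h1.trans h2) (hi.trans hk.symm)))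

theorem fibre_le_two_option {I J : Type} (e : J ≃ I × Bool) (i j k : Option J)
    (h1 : i.map (fun j => (e j).1) = j.map (fun j => (e j).1))
    (h2 : j.map (fun j => (e j).1) = k.map (fun j => (e j).1)) : i = j ∨ j = k ∨ i = k := by
  rcases i with _ | i <;> rcases j with _ | j <;> rcases k with _ | k <;> simp_all
  exact fibre_le_two e i j k (h1.trans h2.symm) h2

/-- The sign attached to a son. -/
def sgn (b : Bool) : ℝ := if b then 1 else -1

theorem stabilize_mem_Mbar {I J : Type} [Finite J] (e : J ≃ I × Bool) {p : QuadSpace I}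
    (hp : p ∈ Mbar I) : stabilize (fun j => (e j).1) p ∈ Mbar J := by
  revert p
  suffices h : Set.MapsTo (stabilize fun j => (e j).1)
      {p | ∃ X : I → ℝ × ℝ, IsConfig X ∧ p = crossRatio X} (Mbar J) by
    intro p hp
    have := h.closure (continuous_stabilize _) hp
    rwa [Mbar, closure_closure] at this
  rintro _ ⟨X, hX, rfl⟩
  obtain ⟨Z, hZ, hZ0, hXZ⟩ : ∃ Z : I → ℝ × ℝ, IsConfig Z ∧ (∀ i, Z i ≠ 0) ∧
      crossRatio X = crossRatio Z := by
    by_cases hI : Subsingleton I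
    · refine ⟨fun _ => (1, 0), fun i j h => absurd (Subsingleton.elim i j) h, fun _ h => ?_, ?_⟩
      · simpa using congrArg Prod.fst h
      · funext q
        exact absurd (q.injective (Subsingleton.elim (q 0) (q 1))) (by decide)
    · rw [not_subsingleton_iff_nontrivial] at hI
      refine ⟨X, hX, fun i hi => ?_, rfl⟩
      obtain ⟨j, hj⟩ := exists_ne i
      exact hX j i hj (by rw [hi]; simp [det2])
  rw [hXZ]
  let Y : ℝ → J → ℝ × ℝ := fun t j => ((Z (e j).1).1 - t * sgn (e j).2 * (Z (e j).1).2,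
    (Z (e j).1).2 + t * sgn (e j).2 * (Z (e j).1).1)
  have hY : ∀ j, Tendsto (fun t => Y t j) (𝓝[≠] 0) (𝓝 (Z (e j).1)) := by
    intro j
    have h1 : Continuous fun t => Y t j := by fun_prop
    have h2 := h1.tendsto 0
    rw [show Y 0 j = Z (e j).1 by simp [Y]] at h2
    exact h2.mono_left nhdsWithin_le_nhds
  have hYc : ∀ᶠ t in 𝓝[≠] (0 : ℝ), IsConfig (Y t) := by
    refine eventually_isConfig hZ hY fun i j hij hf => ?_
    have hs : sgn (e j).2 ≠ sgn (e i).2 := by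
      have h : (e i).2 ≠ (e j).2 := fun h => hij (e.injective (Prod.ext hf h))
      revert h
      cases (e i).2 <;> cases (e j).2 <;> simp [sgn] <;> norm_num
    filter_upwards [self_mem_nhdsWithin] with t ht
    have ht0 : t ≠ 0 := ht
    have h1 : det2 (Y t i) (Y t j) =
        t * (sgn (e j).2 - sgn (e i).2) * ((Z (e j).1).1 ^ 2 + (Z (e j).1).2 ^ 2) := by
      simp only [det2, Y, hf]
      ring
    rw [h1]
    refine mul_ne_zero (mul_ne_zero ht0 (sub_ne_zero.2 hs)) fun h0 => hZ0 (e j).1 ?_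
    have h2 : (Z (e j).1).1 = 0 := by nlinarith [sq_nonneg (Z (e j).1).1, sq_nonneg (Z (e j).1).2]
    have h3 : (Z (e j).1).2 = 0 := by nlinarith [sq_nonneg (Z (e j).1).1, sq_nonneg (Z (e j).1).2]
    exact Prod.ext h2 h3
  refine mem_closure_of_tendsto (tendsto_crossRatio (fibre_le_two e) hZ hY hYc) ?_
  filter_upwards [hYc] with t ht using ⟨Y t, ht, rfl⟩

theorem stabilize_mem_Mtilde {I J : Type} [Fintype I] [Fintype J] (e : J ≃ I × Bool)
    {y : (I → ℝ) × QuadSpace (Option I)} (hy : y ∈ Mtilde I) :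
    ((fun j => y.1 (e j).1 / √2, stabilize (Option.map fun j => (e j).1) y.2) :
      (J → ℝ) × QuadSpace (Option J)) ∈ Mtilde J := by
  revert y
  suffices h : Set.MapsTo (fun y : (I → ℝ) × QuadSpace (Option I) =>
      ((fun j => y.1 (e j).1 / √2, stabilize (Option.map fun j => (e j).1) y.2) :
        (J → ℝ) × QuadSpace (Option J)))
      {y | ∑ i, y.1 i = 0 ∧ ∑ i, y.1 i ^ 2 = 1 ∧ Function.Injective y.1 ∧
        y.2 = crossRatio (affineConfig y.1)} (Mtilde J) by
    intro y hy
    have := h.closure (Continuous.prodMk (continuous_pi fun j =>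
      ((continuous_apply _).comp continuous_fst).div_const _)
      ((continuous_stabilize _).comp continuous_snd)) hy
    rwa [Mtilde, closure_closure] at this
  rintro ⟨a, p⟩ ⟨ha0, ha1, hinj, hp⟩
  dsimp only at ha0 ha1 hinj hp ⊢
  subst hp
  let b : ℝ → J → ℝ := fun t j => a (e j).1 + t * sgn (e j).2
  let c : ℝ → ℝ := fun t => √(∑ j, b t j ^ 2)
  have hsum : ∀ F : I × Bool → ℝ, ∑ j, F (e j) = ∑ i, (F (i, true) + F (i, false)) := by
    intro F
    rw [e.sum_comp F, Fintype.sum_prod_type]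
    simp
  have hb0 : ∀ t, ∑ j, b t j = 0 := by
    intro t
    rw [hsum fun z => a z.1 + t * sgn z.2]
    simp only [sgn, if_true, Bool.false_eq_true, if_false]
    rw [show (fun i => a i + t * 1 + (a i + t * -1)) = fun i => 2 * a i by funext i; ring]
    rw [← Finset.mul_sum, ha0, mul_zero]
  have hc0 : c 0 = √2 := by
    simp only [c, b, zero_mul, add_zero]
    rw [hsum fun z => a z.1 ^ 2, Finset.sum_add_distrib, ha1]
    norm_num
  have hbc : ∀ j, Continuous fun t => b t j := fun j => by fun_prop
  have hcc : Continuous c := by fun_prop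
  have h2 : (√2 : ℝ) ≠ 0 := by positivity
  have hcne : ∀ᶠ t in 𝓝[≠] (0 : ℝ), c t ≠ 0 :=
    (hcc.continuousAt.eventually_ne (by rw [hc0]; exact h2)).filter_mono nhdsWithin_le_nhds
  have hlim : ∀ j, Tendsto (fun t => b t j / c t) (𝓝[≠] 0) (𝓝 (a (e j).1 / √2)) := by
    intro j
    have h := ((hbc j).tendsto 0).div (hcc.tendsto 0) (by rw [hc0]; exact h2)
    rw [hc0] at h
    simp only [b, zero_mul, add_zero] at h
    exact h.mono_left nhdsWithin_le_nhds
  have hX : IsConfig (affineConfig fun i => a i / √2) :=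
    isConfig_affineConfig fun i j h => hinj (by simpa [h2] using h)
  have hY : ∀ j : Option J, Tendsto (fun t => affineConfig (fun j => b t j / c t) j) (𝓝[≠] 0)
      (𝓝 (affineConfig (fun i => a i / √2) (j.map fun j => (e j).1))) := by
    rintro (_ | j)
    · exact tendsto_const_nhds
    · exact (hlim j).prodMk_nhds tendsto_const_nhds
  have hYc : ∀ᶠ t in 𝓝[≠] (0 : ℝ), IsConfig (affineConfig fun j => b t j / c t) := by
    refine eventually_isConfig hX hY ?_
    rintro (_ | i) (_ | j) hij hf
    · exact absurd rfl hij
    · simp at hf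
    · simp at hf
    · have hf' : (e i).1 = (e j).1 := by simpa using hf
      have hs : sgn (e i).2 ≠ sgn (e j).2 := by
        have h : (e i).2 ≠ (e j).2 := fun h => hij (congrArg some (e.injective (Prod.ext hf' h)))
        revert h
        cases (e i).2 <;> cases (e j).2 <;> simp [sgn] <;> norm_num
      filter_upwards [hcne, self_mem_nhdsWithin] with t ht ht0
      have ht0' : t ≠ 0 := ht0
      simp only [det2, affineConfig, b, hf', mul_one, one_mul, ← sub_div]
      refine div_ne_zero ?_ ht
      rw [add_sub_add_left_eq_sub, ← mul_sub]
      exact mul_ne_zero ht0' (sub_ne_zero.2 hs)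
  have hCR := tendsto_crossRatio (fibre_le_two_option e) hX hY hYc
  rw [crossRatio_smul a h2] at hCR
  refine mem_closure_of_tendsto ((tendsto_pi_nhds.2 hlim).prodMk_nhds hCR) ?_
  filter_upwards [hcne, hYc] with t ht htc
  refine ⟨?_, ?_, ?_, rfl⟩
  · change ∑ j, b t j / c t = 0
    rw [← Finset.sum_div, hb0, zero_div]
  · change ∑ j, (b t j / c t) ^ 2 = 1
    have h3 : c t ^ 2 = ∑ j, b t j ^ 2 := Real.sq_sqrt (Finset.sum_nonneg fun _ _ => sq_nonneg _)
    simp only [div_pow]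
    rw [← Finset.sum_div, ← h3, div_self (pow_ne_zero 2 ht)]
  · intro i j hij
    by_contra hne
    refine htc (some i) (some j) (by simpa using hne) ?_
    have hij' : b t i / c t = b t j / c t := hij
    simp [det2, affineConfig, hij']

end ModularTower

namespace ModularTower

/-! ### The towers -/

/-- The marked points at level `n` of a tower are labelled by the vertices of depth `n` (from the
origin) of the dyadic tree. -/
abbrev Label (R : Type) (n : ℕ) : Type := R × (Fin n → Bool)

/-- The vertex of the dyadic tree corresponding to a label. -/
def Label.vertex {R : Type} {n : ℕ} (w : Label R n) : Vertex R := (w.1, List.ofFn w.2)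

/-- A label of level `n + 1` is a son (left or right) of a label of level `n`. -/
def Label.split (R : Type) (n : ℕ) : Label R (n + 1) ≃ Label R n × Bool where
  toFun w := ((w.1, Fin.init w.2), w.2 (Fin.last n))
  invFun z := (z.1.1, Fin.snoc z.1.2 z.2)
  left_inv w := by simp
  right_inv z := by simp

/-- The stabilization embedding: every marked point `x_w` is replaced by a new component with two
marked points, labelled by the two sons of `w`. -/
noncomputable def expBar (R : Type) [Finite R] (n : ℕ) (p : Mbar (Label R n)) :
    Mbar (Label R (n + 1)) :=
  ⟨stabilize (fun w => (Label.split R n w).1) p.1, stabilize_mem_Mbar (Label.split R n) p.2⟩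

/-- The stabilization embedding for the two-sheeted covers: every marked point `x_w` except `x₀` is
replaced by a new component with two marked points, labelled by the two sons of `w`. The affine
coordinates are duplicated, and normalized again. -/
noncomputable def expTilde (R : Type) [Fintype R] (n : ℕ) (y : Mtilde (Label R n)) :
    Mtilde (Label R (n + 1)) :=
  ⟨(fun w => y.1.1 (Label.split R n w).1 / √2,
    stabilize (Option.map fun w => (Label.split R n w).1) y.1.2),
    stabilize_mem_Mtilde (Label.split R n) y.2⟩

/-- The inductive limit of a sequence of topological spaces and maps. -/
def SeqColimit (X : ℕ → Type) (f : ∀ n, X n → X (n + 1)) : Type :=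
  Quot fun a b : Σ n, X n => b = ⟨a.1 + 1, f a.1 a.2⟩

instance (X : ℕ → Type) [∀ n, TopologicalSpace (X n)] (f : ∀ n, X n → X (n + 1)) :
    TopologicalSpace (SeqColimit X f) :=
  inferInstanceAs (TopologicalSpace (Quot _))

/-- The canonical map from the `n`-th space to the inductive limit. -/
def SeqColimit.ι {X : ℕ → Type} {f : ∀ n, X n → X (n + 1)} (n : ℕ) (x : X n) : SeqColimit X f :=
  Quot.mk _ ⟨n, x⟩

/-- The tower of the two-sheeted covers: the inductive limit of the spaces of level `n`, with `2 ^ n`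
marked points besides `x₀`. The space of level `0` is empty. -/
abbrev TowerTilde : Type := SeqColimit (fun n => Mtilde (Label Unit n)) (expTilde Unit)

/-- The cyclic tower: the inductive limit of the spaces of real stable curves with `3 * 2 ^ n` marked
points. -/
abbrev TowerBar : Type := SeqColimit (fun n => Mbar (Label (Fin 3) n)) (expBar (Fin 3))

/-! ### Planar trees and strata -/

/-- The data of a planar tree with leaves labelled by `I`: the labels of its leaves from the left to
the right, and, for each internal vertex other than the base vertex, the set of the labels of
the leaves descending from it. -/
structure PlanarTree (I : Type) where
  labels : List I
  clusters : Set (Set I)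

namespace PlanarTree

variable {I : Type}

/-- The clusters form a nested collection of intervals with at least two elements. -/
def IsNested (T : PlanarTree I) : Prop :=
  T.labels.Nodup ∧ (∀ i, i ∈ T.labels) ∧
    (∀ A ∈ T.clusters, (∃ l, l <:+: T.labels ∧ A = {i | i ∈ l}) ∧ 2 ≤ A.ncard) ∧
    ∀ A ∈ T.clusters, ∀ B ∈ T.clusters, A ⊆ B ∨ B ⊆ A ∨ Disjoint A B

/-- `T` is a planar rooted tree (with all internal vertices of valency at least three, the output
edge at the root being counted) whose input edges are labelled by `I`. -/
def IsRooted (T : PlanarTree I) : Prop :=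
  T.IsNested ∧ 2 ≤ T.labels.length ∧ ∀ A ∈ T.clusters, A ≠ Set.univ

/-- `T` is a planar unrooted tree whose leaves are cyclically labelled by `I`, with internal vertices
of valency at least three, represented with one of them as base vertex. Each internal edge separates
at least two leaves from at least two others, and it is given by the cluster on the side that does
not contain the base vertex; two clusters are not complementary. -/
def IsUnrooted (T : PlanarTree I) : Prop :=
  T.IsNested ∧ 3 ≤ T.labels.length ∧ (∀ A ∈ T.clusters, A.ncard + 2 ≤ T.labels.length) ∧
    ∀ A ∈ T.clusters, ∀ B ∈ T.clusters, A ∪ B ≠ Set.univ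

/-- The unrooted tree obtained by seeing the output edge of a rooted tree as a leaf, with the label
`none`. -/
def addRoot (T : PlanarTree I) : PlanarTree (Option I) where
  labels := none :: T.labels.map some
  clusters := (fun A => some '' A) '' T.clusters

/-- Some internal edge of `T` separates the leaves `a, b` from the leaves `c, d`. -/
def Separates (T : PlanarTree I) (a b c d : I) : Prop :=
  ∃ A ∈ T.clusters, (a ∈ A ∧ b ∈ A ∧ c ∉ A ∧ d ∉ A) ∨ (c ∈ A ∧ d ∈ A ∧ a ∉ A ∧ b ∉ A)

/-- The conditions on the cross-ratios that express that the planar tree of a stable curve is `T`, up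
to reflections at the vertices: four points occurring in the cyclic order `(a, b, c, d)` in `T` have
a degenerate cross-ratio if and only if an edge of `T` separates two of them from the two others,
and otherwise occur in this order, up to reflection, on a component of the curve. -/
def quadCell (T : PlanarTree I) : Set (QuadSpace I) :=
  {p | ∀ q : Fin 4 ↪ I, [q 0, q 1, q 2, q 3].Sublist T.labels →
    (T.Separates (q 0) (q 1) (q 2) (q 3) → p q = ((0 : ℝ) : OnePoint ℝ)) ∧
    (T.Separates (q 1) (q 2) (q 0) (q 3) → p q = OnePoint.infty) ∧
    (¬ T.Separates (q 0) (q 1) (q 2) (q 3) → ¬ T.Separates (q 1) (q 2) (q 0) (q 3) →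
      ∃ r : ℝ, 0 < r ∧ p q = (r : OnePoint ℝ))}

/-- The (open) stratum of the space of real stable curves labelled by the unrooted tree `T`. -/
def stratumBar (T : PlanarTree I) : Set (Mbar I) := {p | p.1 ∈ T.quadCell}

/-- The (open) stratum of the two-sheeted cover labelled by the rooted tree `T`: the affine
coordinates increase from the left to the right in `T`, those of two leaves being equal if and only
if they descend from the same internal vertex other than the root; and the planar tree of the stable
curve is `T`, up to reflections. -/
def stratumTilde [Fintype I] (T : PlanarTree I) : Set (Mtilde I) :=
  {y | (∀ i j, [i, j].Sublist T.labels → y.1.1 i ≤ y.1.1 j ∧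
      (y.1.1 i = y.1.1 j ↔ ∃ A ∈ T.clusters, i ∈ A ∧ j ∈ A)) ∧
    y.1.2 ∈ T.addRoot.quadCell}

/-- The dimension of the stratum labelled by a rooted tree: the number of input edges minus two,
minus the number of internal edges. -/
noncomputable def dimRooted (T : PlanarTree I) : ℕ := T.labels.length - (T.clusters.ncard + 2)

/-- The dimension of the stratum labelled by an unrooted tree: the number of leaves minus three,
minus the number of internal edges. -/
noncomputable def dimUnrooted (T : PlanarTree I) : ℕ := T.labels.length - (T.clusters.ncard + 3)

end PlanarTree

/-- The stratum of the tower represented, at level `n`, by the rooted tree `T`. -/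
def towerTildeStratum (n : ℕ) (T : PlanarTree (Label Unit n)) : Set TowerTilde :=
  SeqColimit.ι n '' T.stratumTilde

/-- The stratum of the cyclic tower represented, at level `n`, by the unrooted tree `T`. -/
def towerBarStratum (n : ℕ) (T : PlanarTree (Label (Fin 3) n)) : Set TowerBar :=
  SeqColimit.ι n '' T.stratumBar

/-- The strata of dimension `d` of the tower. -/
def stratTilde (d : ℕ) : Set (Set TowerTilde) :=
  {s | ∃ n T, PlanarTree.IsRooted T ∧ T.dimRooted = d ∧ s = towerTildeStratum n T}

/-- The strata of dimension `d` of the cyclic tower. -/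
def stratBar (d : ℕ) : Set (Set TowerBar) :=
  {s | ∃ n T, PlanarTree.IsUnrooted T ∧ T.dimUnrooted = d ∧ s = towerBarStratum n T}

/-- The group of the cellular homeomorphisms of a stratified space: those which permute the strata
of each dimension. -/
def HomeoCell {X : Type} [TopologicalSpace X] (S : ℕ → Set (Set X)) : Subgroup (X ≃ₜ X) where
  carrier := {φ | ∀ d s, φ '' s ∈ S d ↔ s ∈ S d}
  one_mem' := fun d s => by
    change (fun x => x) '' s ∈ S d ↔ _
    rw [Set.image_id']
  mul_mem' := by
    intro φ ψ hφ hψ d s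
    change (fun x => φ (ψ x)) '' s ∈ S d ↔ _
    rw [← Set.image_image, hφ, hψ]
  inv_mem' := by
    intro φ hφ d s
    change φ.symm '' s ∈ S d ↔ _
    rw [← hφ, Set.image_image]
    simp

/-! ### The action of symbols on strata -/

/-- The words of length `k`, in lexicographic order. -/
def words : ℕ → List (List Bool)
  | 0 => [[]]
  | k + 1 => (words k).map (false :: ·) ++ (words k).map (true :: ·)

/-- Composition of symbols, followed by expansion. Let `T` be a tree labelled by the vertices of
depth `n`, which are the leaves of the source tree of `s`. Relabelling the leaves of `T` by means of
`s.σ`, one gets a tree labelled by the leaves of the target tree of `s`. Expanding the latter to the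
complete tree of depth `m`, and correspondingly the leaves of `T`, one gets `T'`: the leaf labelled
by `f` is replaced by the `2 ^ (m - |f|)` descendants of `f` of depth `m` in their planar order, and
the new internal vertices are the descendants of `f` (including `f`) of depth less than `m`. -/
def TreeSymbol.ComposeExpand {R : Type} (s : TreeSymbol R) {n m : ℕ} (T : PlanarTree (Label R n))
    (T' : PlanarTree (Label R m)) : Prop :=
  s.source.leaves = {u | u.2.length = n} ∧ (∀ f ∈ s.target.leaves, f.2.length ≤ m) ∧
  T'.labels.map Label.vertex = T.labels.flatMap (fun w =>
    (words (m - (s.σ w.vertex).2.length)).map fun u =>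
      ((s.σ w.vertex).1, (s.σ w.vertex).2 ++ u)) ∧
  T'.clusters = {A | ∃ B ∈ T.clusters, A = {v | ∃ w ∈ B, (s.σ w.vertex).Le v.vertex}} ∪
    {A | ∃ u : Vertex R, (∃ f ∈ s.target.leaves, f.Le u) ∧ u.2.length < m ∧
      A = {v | u.Le v.vertex}}

/-- `g` sends the stratum `s` to the stratum `s'`, according to the definition of the action through
some choice of a symbol of `g`, of a level `n` and of a planar tree labelling `s` at this level, and
of a level `m` to which the composed symbol is expanded. -/
def ActsTilde (g : Equiv.Perm (End Unit)) (s s' : Set TowerTilde) : Prop :=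
  ∃ (σ : TreeSymbol Unit) (n m : ℕ) (T : PlanarTree (Label Unit n)) (T' : PlanarTree (Label Unit m)),
    σ.Represents g ∧ T.IsRooted ∧ s = towerTildeStratum n T ∧ σ.ComposeExpand T T' ∧ T'.IsRooted ∧
    s' = towerTildeStratum m T'

/-- The same for the cyclic tower. -/
def ActsBar (g : Equiv.Perm (End (Fin 3))) (s s' : Set TowerBar) : Prop :=
  ∃ (σ : TreeSymbol (Fin 3)) (n m : ℕ) (T : PlanarTree (Label (Fin 3) n))
    (T' : PlanarTree (Label (Fin 3) m)),
    σ.Represents g ∧ T.IsUnrooted ∧ s = towerBarStratum n T ∧ σ.ComposeExpand T T' ∧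
    T'.IsUnrooted ∧ s' = towerBarStratum m T'

/-- Neretin's spheromorphism group `N`. -/
abbrev NeretinN : Subgroup (Equiv.Perm (End Unit)) := spheromorphismGroup Unit

/-- Thompson's group `V`. -/
abbrev ThompsonV : Subgroup (Equiv.Perm (End Unit)) := thompsonGroup Unit

/-- The cyclic model `𝒩` of Neretin's group. -/
abbrev CyclicN : Subgroup (Equiv.Perm (End (Fin 3))) := spheromorphismGroup (Fin 3)

/-- The cyclic model `𝒱` of Thompson's group. -/
abbrev CyclicV : Subgroup (Equiv.Perm (End (Fin 3))) := thompsonGroup (Fin 3)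

end ModularTower

/-! The spaces of all levels are embedded, as sets, in one space on which every permutation of the
boundary acts by relabelling. A real stable curve of level `n` determines a cross-ratio for every
quadruple of ends: if the four ends have distinct labels at level `n`, it is the cross-ratio of the
curve; if not, the later stabilizations give it one of the degenerate values `0`, `∞`, `-1`, which
is read at the last level where two of the four labels coincide (`SplitTower.lift`). This is
compatible with stabilization and injective at each level, so the inductive limit injects in
`QuadSpace (End R)`.

The systems of cross-ratios that come from level `n` are characterized without coordinates
(`SplitTower.lift_mem_curves`, `SplitTower.lift_restrict`): all their finite restrictions are stable
curves, and each ball of ends below a vertex of depth at least `n` is a cluster, that is, is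
separated from its complement by an edge. The point is that a cluster forces the cross-ratios of
which it contains exactly two entries, and allows an entry alone in it to be moved inside it. A
spheromorphism `g` may send a small ball only to a ball: for every `n` there is an `m` such that the
preimages under `g` of balls of depth at least `m` are balls of depth at least `n`. Relabelling by
`g` therefore sends level `n` into level `m`, by a map which is continuous because each of its
components is a coordinate or a constant. The group law is inherited from the relabelling, and
homeomorphisms of the limit result (`SeqColimit.exists_action`).

A stratum is described on ends by the family of its clusters and the order of the leaves
(`SplitTower.mem_quadCell_iff`). Composing a tree with a symbol of `g` and expanding it transports
both as `g` does (`TreeSymbol.Represents.carries`), so the combinatorial image is the image under an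
action that involves no choice: this is why it is well defined. The dimension is preserved because a
binary subtree has one internal vertex less than it has leaves (`PlanarTree.graft_count`). For
faithfulness, if `g` moves an end `z`, some cross-ratio involves `z` while the one to which `g`
compares it does not, and moving the marked point near `z` changes only the first.

The two-sheeted cover is treated in the same way, with a base point added. It is cut out by
equations (`mem_Mtilde_iff`): the affine coordinates have zero sum and unit norm, and they give the
cross-ratios on the component of the base point. They are thus determined by the curve up to sign,
and their order fixes the sign. The order is recorded instead of the coordinates because the
normalization depends on the level and the order does not. -/

namespace ModularTower

/-! ### Relations between cross-ratios -/

section Relations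

variable {I J : Type}

/-- Reordering of a quadruple. -/
def reorder (q : Fin 4 ↪ I) (f : Fin 4 → Fin 4) (hf : Function.Injective f) : Fin 4 ↪ I :=
  ⟨fun k => q (f k), q.injective.comp hf⟩

@[simp] theorem reorder_apply (q : Fin 4 ↪ I) (f : Fin 4 → Fin 4) (hf : Function.Injective f)
    (k : Fin 4) : reorder q f hf k = q (f k) := rfl

/-- Restriction of a system of cross-ratios to a subset of the labels. -/
def restrict (ι : J ↪ I) (p : QuadSpace I) : QuadSpace J := fun q => p (q.trans ι)

theorem continuous_restrict (ι : J ↪ I) : Continuous (restrict ι) :=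
  continuous_pi fun _ => continuous_apply _

theorem restrict_mem_Mbar (ι : J ↪ I) {p : QuadSpace I} (hp : p ∈ Mbar I) :
    restrict ι p ∈ Mbar J := by
  refine map_mem_closure (continuous_restrict ι) hp ?_
  rintro _ ⟨X, hX, rfl⟩
  exact ⟨fun j => X (ι j), fun i j h => hX _ _ fun h' => h (ι.injective h'), rfl⟩

/-- The real cross-ratio of a configuration at a quadruple. -/
noncomputable def realRatio (q : Fin 4 ↪ I) (X : I → ℝ × ℝ) : ℝ :=
  det2 (X (q 0)) (X (q 1)) * det2 (X (q 2)) (X (q 3)) /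
    (det2 (X (q 1)) (X (q 2)) * det2 (X (q 0)) (X (q 3)))

/-- The device behind all the relations below: a point of the closure is a limit of configurations,
so identities between real cross-ratios pass to it, with values at infinity treated as limits. -/
theorem exists_limit_of_mem_Mbar {p : QuadSpace I} (hp : p ∈ Mbar I) :
    ∃ l : Filter (I → ℝ × ℝ), l.NeBot ∧ (∀ᶠ X in l, IsConfig X) ∧
      ∀ q, Tendsto (fun X => (realRatio q X : OnePoint ℝ)) l (𝓝 (p q)) := by
  let φ : {X : I → ℝ × ℝ // IsConfig X} → QuadSpace I := fun X => crossRatio X.1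
  have hne : (comap φ (𝓝 p)).NeBot := by
    refine comap_neBot_iff.2 fun t ht => ?_
    obtain ⟨_, h1, X, hX, rfl⟩ := mem_closure_iff_nhds.1 hp t ht
    exact ⟨⟨X, hX⟩, h1⟩
  refine ⟨map Subtype.val (comap φ (𝓝 p)), inferInstance,
    eventually_map.2 (Eventually.of_forall fun X => X.2), fun q => ?_⟩
  rw [tendsto_map'_iff]
  exact ((continuous_apply q).tendsto p).comp tendsto_comap

theorem tendsto_coe_iff {E : Type} {l : Filter E} {u : E → ℝ} {c : ℝ} :
    Tendsto (fun t => (u t : OnePoint ℝ)) l (𝓝 (c : OnePoint ℝ)) ↔ Tendsto u l (𝓝 c) :=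
  (OnePoint.isOpenEmbedding_coe.tendsto_nhds_iff).symm

theorem tendsto_coe_infty_iff {E : Type} {l : Filter E} {u : E → ℝ} :
    Tendsto (fun t => (u t : OnePoint ℝ)) l (𝓝 OnePoint.infty) ↔
      Tendsto u l (Bornology.cobounded ℝ) := by
  rw [Metric.cobounded_eq_cocompact, ← coclosedCompact_eq_cocompact,
    ← OnePoint.comap_coe_nhds_infty, tendsto_comap_iff]
  rfl

/-- The source of the additive identities used when two entries are transposed, when the pairs are
crossed, and when one entry is moved. -/
theorem det2_plucker (a b c d : ℝ × ℝ) :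
    det2 a c * det2 b d = det2 a b * det2 c d + det2 a d * det2 b c := by
  unfold det2; ring

variable {p : QuadSpace I}

theorem IsConfig.det2_ne {X : I → ℝ × ℝ} (hX : IsConfig X) (q : Fin 4 ↪ I) {i j : Fin 4}
    (h : i ≠ j) : det2 (X (q i)) (X (q j)) ≠ 0 := hX _ _ fun h' => h (q.injective h')

theorem Mbar.eq_of_realRatio_eq (hp : p ∈ Mbar I) {q q' : Fin 4 ↪ I}
    (h : ∀ X : I → ℝ × ℝ, IsConfig X → realRatio q' X = realRatio q X) : p q' = p q := by
  obtain ⟨l, hl, hc, ht⟩ := exists_limit_of_mem_Mbar hp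
  refine tendsto_nhds_unique (ht q') ((ht q).congr' ?_)
  filter_upwards [hc] with X hX
  rw [h X hX]

theorem Mbar.eq_coe_of_realRatio (hp : p ∈ Mbar I) {q q' : Fin 4 ↪ I} {c : ℝ} {φ : ℝ → ℝ}
    (hφ : ContinuousAt φ c)
    (h : ∀ X : I → ℝ × ℝ, IsConfig X → realRatio q' X = φ (realRatio q X)) (hq : p q = (c : ℝ)) :
    p q' = (φ c : ℝ) := by
  obtain ⟨l, hl, hc, ht⟩ := exists_limit_of_mem_Mbar hp
  have h1 := ht q
  rw [hq, tendsto_coe_iff] at h1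
  refine tendsto_nhds_unique (ht q') (Tendsto.congr' ?_ (tendsto_coe_iff.2 (hφ.tendsto.comp h1)))
  filter_upwards [hc] with X hX
  rw [h X hX]; rfl

/-- Exchanging the two pairs. -/
theorem Mbar.pair_swap (hp : p ∈ Mbar I) (q : Fin 4 ↪ I) :
    p (reorder q ![2, 3, 0, 1] (by decide)) = p q := by
  refine Mbar.eq_of_realRatio_eq hp fun X hX => ?_
  simp only [realRatio, reorder_apply, Matrix.cons_val]
  rw [det2_swap (X (q 0)) (X (q 3)), det2_swap (X (q 1)) (X (q 2))]
  congr 1 <;> ring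

/-- With `Mbar.pair_swap`, this generates the Klein four-group, which preserves cross-ratios and is
transitive on the four positions. -/
theorem Mbar.double_swap (hp : p ∈ Mbar I) (q : Fin 4 ↪ I) :
    p (reorder q ![1, 0, 3, 2] (by decide)) = p q := by
  refine Mbar.eq_of_realRatio_eq hp fun X hX => ?_
  simp only [realRatio, reorder_apply, Matrix.cons_val]
  rw [det2_swap (X (q 0)) (X (q 1)), det2_swap (X (q 2)) (X (q 3))]
  congr 1 <;> ring

/-- Transposing the first two entries changes the cross-ratio `x` into `-x / (1 + x)`, by the
Plücker relation; this function is continuous at `0`, where it vanishes. -/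
theorem Mbar.swap_zero (hp : p ∈ Mbar I) {q : Fin 4 ↪ I} (h : p q = (0 : ℝ)) :
    p (reorder q ![1, 0, 2, 3] (by decide)) = (0 : ℝ) := by
  have := Mbar.eq_coe_of_realRatio hp (q := q) (q' := reorder q ![1, 0, 2, 3] (by decide))
    (φ := fun x => -x / (1 + x)) (c := 0)
    (ContinuousAt.div (by fun_prop) (by fun_prop) (by norm_num)) (fun X hX => ?_) h
  · simpa using this
  · have h1 := hX.det2_ne q (i := 1) (j := 2) (by decide)
    have h2 := hX.det2_ne q (i := 0) (j := 3) (by decide)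
    have h3 := hX.det2_ne q (i := 0) (j := 2) (by decide)
    have h4 := hX.det2_ne q (i := 1) (j := 3) (by decide)
    have h5 := det2_plucker (X (q 0)) (X (q 1)) (X (q 2)) (X (q 3))
    simp only [realRatio, reorder_apply, Matrix.cons_val]
    rw [det2_swap (X (q 0)) (X (q 1)), one_add_div (mul_ne_zero h1 h2), neg_div,
      div_div_div_cancel_right₀ (mul_ne_zero h1 h2), ← neg_div, neg_mul]
    congr 1
    linarith

/-- A cyclic shift of the entries inverts the cross-ratio. -/
theorem Mbar.cyc_infty (hp : p ∈ Mbar I) {q : Fin 4 ↪ I}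
    (h : p (reorder q ![1, 2, 3, 0] (by decide)) = (0 : ℝ)) : p q = OnePoint.infty := by
  obtain ⟨l, hl, hc, ht⟩ := exists_limit_of_mem_Mbar hp
  have h1 := ht (reorder q ![1, 2, 3, 0] (by decide))
  rw [h, tendsto_coe_iff] at h1
  refine tendsto_nhds_unique (ht q) (tendsto_coe_infty_iff.2 ?_)
  -- The inverse tends to infinity because the ratio tends to `0` without vanishing, the points of a
  -- configuration being distinct.
  have h2 : Tendsto (fun X => realRatio (reorder q ![1, 2, 3, 0] (by decide)) X) l (𝓝[≠] 0) := by
    refine tendsto_nhdsWithin_iff.2 ⟨h1, ?_⟩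
    filter_upwards [hc] with X hX
    exact div_ne_zero
      (mul_ne_zero (hX.det2_ne _ (by decide)) (hX.det2_ne _ (by decide)))
      (mul_ne_zero (hX.det2_ne _ (by decide)) (hX.det2_ne _ (by decide)))
  refine (tendsto_inv₀_nhdsNE_zero.comp h2).congr fun X => ?_
  simp only [realRatio, reorder_apply, Matrix.cons_val, Function.comp, inv_div]
  rw [det2_swap (X (q 0)) (X (q 1)), det2_swap (X (q 0)) (X (q 3)), mul_neg, mul_neg,
    neg_div_neg_eq]
  congr 1 <;> ring

theorem Mbar.cyc_zero (hp : p ∈ Mbar I) {q : Fin 4 ↪ I} (h : p q = OnePoint.infty) :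
    p (reorder q ![1, 2, 3, 0] (by decide)) = (0 : ℝ) := by
  obtain ⟨l, hl, hc, ht⟩ := exists_limit_of_mem_Mbar hp
  have h1 := ht q
  rw [h, tendsto_coe_infty_iff] at h1
  refine tendsto_nhds_unique (ht _) (tendsto_coe_iff.2 ?_)
  refine (tendsto_inv₀_cobounded.comp h1).congr fun X => ?_
  simp only [realRatio, reorder_apply, Matrix.cons_val, Function.comp, inv_div]
  rw [det2_swap (X (q 0)) (X (q 1)), det2_swap (X (q 0)) (X (q 3)), mul_neg, mul_neg,
    neg_div_neg_eq]
  congr 1 <;> ring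

/-- If `y` is the cross-ratio with the two middle entries exchanged, the Plücker relation gives the
original one as `-1 - y`. -/
theorem Mbar.cross_neg_one (hp : p ∈ Mbar I) {q : Fin 4 ↪ I}
    (h : p (reorder q ![0, 2, 1, 3] (by decide)) = (0 : ℝ)) : p q = ((-1 : ℝ) : OnePoint ℝ) := by
  have := Mbar.eq_coe_of_realRatio hp (q := reorder q ![0, 2, 1, 3] (by decide)) (q' := q)
    (φ := fun x => -1 - x) (c := 0) (by fun_prop) (fun X hX => ?_) h
  · simpa using this
  · have h1 := hX.det2_ne q (i := 1) (j := 2) (by decide)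
    have h2 := hX.det2_ne q (i := 0) (j := 3) (by decide)
    have h5 := det2_plucker (X (q 0)) (X (q 1)) (X (q 2)) (X (q 3))
    simp only [realRatio, reorder_apply, Matrix.cons_val]
    rw [det2_swap (X (q 1)) (X (q 2))]
    field_simp
    linarith

/-- If two points collide with respect to two others, then they are interchangeable in a cross-ratio
containing the latter. -/
theorem Mbar.eq_of_collision (hp : p ∈ Mbar I) {q q' r : Fin 4 ↪ I} (h0 : r 0 = q 0)
    (h1 : r 1 = q' 0) (h2 : r 2 = q 1) (h3 : r 3 = q 3) (hq1 : q' 1 = q 1) (hq2 : q' 2 = q 2)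
    (hq3 : q' 3 = q 3) (hr : p r = (0 : ℝ)) : p q = p q' := by
  obtain ⟨l, hl, hc, ht⟩ := exists_limit_of_mem_Mbar hp
  have hr' := ht r
  rw [hr, tendsto_coe_iff] at hr'
  have hr1 : Tendsto (fun X => 1 + realRatio r X) l (𝓝 1) := by simpa using hr'.const_add 1
  -- By the Plücker relation, `1 + realRatio r X` is exactly the quotient of the two cross-ratios to
  -- be compared. It tends to `1`, so they have the same limit, finite or infinite.
  have hmul : ∀ᶠ X in l, (1 + realRatio r X) * realRatio q' X = realRatio q X := by
    filter_upwards [hc] with X hX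
    have e1 := hX.det2_ne q (i := 1) (j := 2) (by decide)
    have e2 := hX.det2_ne q (i := 0) (j := 3) (by decide)
    have e3 := hX.det2_ne q' (i := 0) (j := 3) (by decide)
    have e4 := hX.det2_ne q' (i := 0) (j := 1) (by decide)
    have h5 := det2_plucker (X (q 0)) (X (q' 0)) (X (q 1)) (X (q 3))
    simp only [realRatio, h0, h1, h2, h3, hq1, hq2, hq3] at e3 e4 ⊢
    field_simp
    linear_combination (-det2 (X (q 2)) (X (q 3))) * h5
  refine tendsto_nhds_unique (ht q) ?_
  have hq := ht q'
  rcases hv : p q' with _ | v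
  · rw [hv] at hq
    refine tendsto_coe_infty_iff.2 ?_
    have hq' := tendsto_coe_infty_iff.1 hq
    rw [← tendsto_norm_atTop_iff_cobounded] at hq' ⊢
    refine (Tendsto.pos_mul_atTop one_pos (by simpa using hr1.norm) hq').congr' ?_
    filter_upwards [hmul] with X hX
    rw [← hX, norm_mul]; rfl
  · rw [hv] at hq
    refine tendsto_coe_iff.2 ?_
    have := hr1.mul (tendsto_coe_iff.1 hq)
    rw [one_mul] at this
    exact this.congr' hmul

end Relations

/-! ### Stabilization along a general map -/

/-- Each point `j` is pushed off `Z (f j)` in the orthogonal direction, at its own speed `s j`, and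
the configurations so obtained converge to the stabilization. With three points in one fibre, the
limits would depend on the speeds. -/
theorem stabilize_mem_Mbar_of_fibres {I J : Type} [Finite J] {f : J → I}
    (hf : ∀ i j k, f i = f j → f j = f k → i = j ∨ j = k ∨ i = k) {p : QuadSpace I}
    (hp : p ∈ Mbar I) : stabilize f p ∈ Mbar J := by
  revert p
  suffices h : Set.MapsTo (stabilize f)
      {p | ∃ X : I → ℝ × ℝ, IsConfig X ∧ p = crossRatio X} (Mbar J) by
    intro p hp
    have := h.closure (continuous_stabilize _) hp
    rwa [Mbar, closure_closure] at this
  rintro _ ⟨X, hX, rfl⟩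
  obtain ⟨Z, hZ, hZ0, hXZ⟩ : ∃ Z : I → ℝ × ℝ, IsConfig Z ∧ (∀ i, Z i ≠ 0) ∧
      crossRatio X = crossRatio Z := by
    -- With at most one label there are no quadruples, but the vector of a configuration may vanish;
    -- it is then replaced by a nonzero one.
    by_cases hI : Subsingleton I
    · refine ⟨fun _ => (1, 0), fun i j h => absurd (Subsingleton.elim i j) h, fun _ h => ?_, ?_⟩
      · simpa using congrArg Prod.fst h
      · funext q
        exact absurd (q.injective (Subsingleton.elim (q 0) (q 1))) (by decide)
    · rw [not_subsingleton_iff_nontrivial] at hI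
      refine ⟨X, hX, fun i hi => ?_, rfl⟩
      obtain ⟨j, hj⟩ := exists_ne i
      exact hX j i hj (by rw [hi]; simp [det2])
  rw [hXZ]
  obtain ⟨s, hs⟩ : ∃ s : J → ℝ, Function.Injective s := by
    obtain ⟨n, ⟨e⟩⟩ := Finite.exists_equiv_fin J
    exact ⟨fun j => ((e j : ℕ) : ℝ), fun i j h => e.injective (Fin.ext (Nat.cast_injective h))⟩
  let Y : ℝ → J → ℝ × ℝ := fun t j => ((Z (f j)).1 - t * s j * (Z (f j)).2,
    (Z (f j)).2 + t * s j * (Z (f j)).1)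
  have hY : ∀ j, Tendsto (fun t => Y t j) (𝓝[≠] 0) (𝓝 (Z (f j))) := by
    intro j
    have h1 : Continuous fun t => Y t j := by fun_prop
    have h2 := h1.tendsto 0
    rw [show Y 0 j = Z (f j) by simp [Y]] at h2
    exact h2.mono_left nhdsWithin_le_nhds
  have hYc : ∀ᶠ t in 𝓝[≠] (0 : ℝ), IsConfig (Y t) := by
    refine eventually_isConfig hZ hY fun i j hij hfij => ?_
    filter_upwards [self_mem_nhdsWithin] with t ht
    have ht0 : t ≠ 0 := ht
    have h1 : det2 (Y t i) (Y t j) =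
        t * (s j - s i) * ((Z (f j)).1 ^ 2 + (Z (f j)).2 ^ 2) := by
      simp only [det2, Y, hfij]
      ring
    rw [h1]
    refine mul_ne_zero (mul_ne_zero ht0 (sub_ne_zero.2 fun h => hij (hs h.symm))) fun h0 =>
      hZ0 (f j) ?_
    have h2 : (Z (f j)).1 = 0 := by nlinarith [sq_nonneg (Z (f j)).1, sq_nonneg (Z (f j)).2]
    have h3 : (Z (f j)).2 = 0 := by nlinarith [sq_nonneg (Z (f j)).1, sq_nonneg (Z (f j)).2]
    exact Prod.ext h2 h3
  refine mem_closure_of_tendsto (tendsto_crossRatio hf hZ hY hYc) ?_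
  filter_upwards [hYc] with t ht using ⟨Y t, ht, rfl⟩

/-! ### Orders given by lists -/

section Lists

variable {I J : Type}

theorem pairwise_idxOf [DecidableEq I] {l : List I} (hl : l.Nodup) :
    l.Pairwise fun a b => l.idxOf a < l.idxOf b := by
  rw [List.pairwise_iff_getElem]
  intro i j hi hj hij
  rwa [hl.idxOf_getElem, hl.idxOf_getElem]

theorem sublist_iff_idxOf [DecidableEq I] {l xs : List I} (hl : l.Nodup) (hx : ∀ x ∈ xs, x ∈ l) :
    xs.Sublist l ↔ xs.Pairwise fun a b => l.idxOf a < l.idxOf b := by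
  refine ⟨fun h => (pairwise_idxOf hl).sublist h, fun h => ?_⟩
  have : Std.Antisymm fun a b => l.idxOf a < l.idxOf b := ⟨fun a b h1 h2 => absurd h1 h2.asymm⟩
  have hn : xs.Nodup := h.imp fun {a b} h' e => by rw [e] at h'; exact h'.false
  exact List.sublist_of_subperm_of_pairwise (hn.subperm hx) h (pairwise_idxOf hl)

theorem infix_ordConnected [DecidableEq I] {l l' : List I} (hl : l.Nodup) (h : l' <:+: l) {a b c : I}
    (ha : a ∈ l') (hc : c ∈ l') (h1 : l.idxOf a ≤ l.idxOf b) (h2 : l.idxOf b ≤ l.idxOf c) :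
    b ∈ l' := by
  obtain ⟨s, t, rfl⟩ := h
  have hd := (List.nodup_append.1 hl)
  have hd' := (List.nodup_append.1 hd.1)
  have hs : ∀ x ∈ l', x ∉ s := fun x hx hx' => hd'.2.2 x hx' x hx rfl
  have hidx : ∀ x ∈ l', (s ++ l' ++ t).idxOf x = l'.idxOf x + s.length := by
    intro x hx
    rw [List.idxOf_append_of_mem (by simp [hx]), List.idxOf_append_of_notMem (hs x hx), add_comm]
  rw [hidx a ha] at h1
  rw [hidx c hc] at h2
  have h3 := List.idxOf_lt_length_of_mem hc
  by_contra hb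
  by_cases hbs : b ∈ s
  · rw [List.append_assoc, List.idxOf_append_of_mem hbs] at h1
    have := List.idxOf_lt_length_of_mem hbs
    omega
  · rw [List.idxOf_append_of_notMem (by simp [hb, hbs])] at h2
    simp only [List.length_append] at h2
    omega

/-- The elements of one block have the same image, so a sublist whose images are distinct takes at
most one element in each block. -/
theorem map_sublist_of_sublist_flatMap {F : I → List J} {π : J → I}
    (hF : ∀ w, ∀ x ∈ F w, π x = w) (l : List I) :
    ∀ xs : List J, xs.Sublist (l.flatMap F) → (xs.map π).Nodup → (xs.map π).Sublist l := by
  induction l with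
  | nil =>
    intro xs h _
    simp at h
    simp [h]
  | cons w l ih =>
    intro xs h hn
    rw [List.flatMap_cons, List.sublist_append_iff] at h
    obtain ⟨ys, zs, rfl, hy, hz⟩ := h
    rw [List.map_append] at hn ⊢
    have hyw : ∀ y ∈ ys.map π, y = w := by
      intro y hy'
      obtain ⟨x, hx, rfl⟩ := List.mem_map.1 hy'
      exact hF w x (hy.subset hx)
    have h1 : (ys.map π).Sublist [w] := by
      have hys := (List.nodup_append.1 hn).1
      rcases hys' : ys.map π with _ | ⟨a, _ | ⟨b, t⟩⟩
      · simp
      · rw [hyw a (by simp [hys'])]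
      · rw [hys'] at hys
        have := hyw a (by simp [hys'])
        have := hyw b (by simp [hys'])
        simp_all
    exact h1.append (ih zs hz (List.nodup_append.1 hn).2.1)

theorem sublist_flatMap_of_map_sublist {F : I → List J} {π : J → I} (hF : ∀ x, x ∈ F (π x))
    (l : List I) : ∀ xs : List J, (xs.map π).Sublist l → xs.Sublist (l.flatMap F) := by
  induction l with
  | nil =>
    intro xs h
    simp at h
    simp [h]
  | cons w l ih =>
    intro xs h
    rw [List.flatMap_cons]
    rcases xs with _ | ⟨x, xs⟩
    · simp
    · rw [List.map_cons] at h
      rcases h with h | h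
      · exact (ih _ (by simpa using ‹_›)).trans (List.sublist_append_right _ _)
      · rename_i h
        exact (List.singleton_sublist.2 (hF x)).append (ih _ h)

end Lists

/-! ### Clusters -/

section Clusters

variable {E : Type}

/-- All the restrictions of `P` to finite sets of labels are real stable curves. -/
def IsCurve (P : QuadSpace E) : Prop :=
  ∀ (J : Type) [Finite J] (ι : J ↪ E), restrict ι P ∈ Mbar J

theorem isCurve_of_mem_Mbar {p : QuadSpace E} (hp : p ∈ Mbar E) : IsCurve p :=
  fun _ _ ι => restrict_mem_Mbar ι hp

theorem IsCurve.restrict {F : Type} {P : QuadSpace E} (hP : IsCurve P) (ι : F ↪ E) :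
    IsCurve (restrict ι P) := fun J _ κ => hP J (κ.trans ι)

/-- The labels in `S` are separated from the others by an edge. -/
def IsCl (P : QuadSpace E) (S : Set E) : Prop :=
  ∀ q : Fin 4 ↪ E, q 0 ∈ S → q 1 ∈ S → q 2 ∉ S → q 3 ∉ S → P q = ((0 : ℝ) : OnePoint ℝ)

variable {P : QuadSpace E} {S : Set E}

theorem IsCurve.pair_swap (hP : IsCurve P) (q : Fin 4 ↪ E) :
    P (reorder q ![2, 3, 0, 1] (by decide)) = P q :=
  Mbar.pair_swap (hP (Fin 4) q) (Function.Embedding.refl _)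

theorem IsCurve.double_swap (hP : IsCurve P) (q : Fin 4 ↪ E) :
    P (reorder q ![1, 0, 3, 2] (by decide)) = P q :=
  Mbar.double_swap (hP (Fin 4) q) (Function.Embedding.refl _)

theorem IsCurve.swap_zero (hP : IsCurve P) {q : Fin 4 ↪ E} (h : P q = (0 : ℝ)) :
    P (reorder q ![1, 0, 2, 3] (by decide)) = (0 : ℝ) :=
  Mbar.swap_zero (hP (Fin 4) q) (q := Function.Embedding.refl _) h

theorem IsCurve.cyc_infty (hP : IsCurve P) {q : Fin 4 ↪ E}
    (h : P (reorder q ![1, 2, 3, 0] (by decide)) = (0 : ℝ)) : P q = OnePoint.infty :=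
  Mbar.cyc_infty (hP (Fin 4) q) (q := Function.Embedding.refl _) h

theorem IsCurve.cyc_zero (hP : IsCurve P) {q : Fin 4 ↪ E} (h : P q = OnePoint.infty) :
    P (reorder q ![1, 2, 3, 0] (by decide)) = (0 : ℝ) :=
  Mbar.cyc_zero (hP (Fin 4) q) (q := Function.Embedding.refl _) h

theorem IsCurve.cross_neg_one (hP : IsCurve P) {q : Fin 4 ↪ E}
    (h : P (reorder q ![0, 2, 1, 3] (by decide)) = (0 : ℝ)) : P q = ((-1 : ℝ) : OnePoint ℝ) :=
  Mbar.cross_neg_one (hP (Fin 4) q) (q := Function.Embedding.refl _) h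

theorem IsCurve.eq_of_collision (hP : IsCurve P) {q q' r : Fin 4 ↪ E} (h0 : r 0 = q 0)
    (h1 : r 1 = q' 0) (h2 : r 2 = q 1) (h3 : r 3 = q 3) (hq1 : q' 1 = q 1) (hq2 : q' 2 = q 2)
    (hq3 : q' 3 = q 3) (hr : P r = (0 : ℝ)) : P q = P q' := by
  let s : Set E := range q ∪ range q' ∪ range r
  have : Finite s := ((finite_range q).union (finite_range q')).union (finite_range r)
  let u : Fin 4 ↪ s := ⟨fun i => ⟨q i, by simp [s]⟩, fun i j h => q.injective (congrArg Subtype.val h)⟩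
  let u' : Fin 4 ↪ s :=
    ⟨fun i => ⟨q' i, by simp [s]⟩, fun i j h => q'.injective (congrArg Subtype.val h)⟩
  let v : Fin 4 ↪ s := ⟨fun i => ⟨r i, by simp [s]⟩, fun i j h => r.injective (congrArg Subtype.val h)⟩
  exact Mbar.eq_of_collision (hP s (Function.Embedding.subtype _)) (q := u) (q' := u') (r := v)
    (Subtype.ext h0) (Subtype.ext h1) (Subtype.ext h2) (Subtype.ext h3) (Subtype.ext hq1)
    (Subtype.ext hq2) (Subtype.ext hq3) hr

/-- This lemma and the next four treat the other positions of the two entries that lie in a cluster: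
adjacent pairs, in the cyclic order, give `0` or `∞`, and opposite pairs give `-1`. -/
theorem IsCl.snd (hS : IsCl P S) (hP : IsCurve P) {q : Fin 4 ↪ E} (h2 : q 2 ∈ S) (h3 : q 3 ∈ S)
    (h0 : q 0 ∉ S) (h1 : q 1 ∉ S) : P q = (0 : ℝ) := by
  rw [← hP.pair_swap q]
  exact hS _ h2 h3 h0 h1

theorem IsCl.mid (hS : IsCl P S) (hP : IsCurve P) {q : Fin 4 ↪ E} (h1 : q 1 ∈ S) (h2 : q 2 ∈ S)
    (h0 : q 0 ∉ S) (h3 : q 3 ∉ S) : P q = OnePoint.infty :=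
  hP.cyc_infty (hS _ h1 h2 h3 h0)

theorem IsCl.outer (hS : IsCl P S) (hP : IsCurve P) {q : Fin 4 ↪ E} (h0 : q 0 ∈ S) (h3 : q 3 ∈ S)
    (h1 : q 1 ∉ S) (h2 : q 2 ∉ S) : P q = OnePoint.infty :=
  hP.cyc_infty (hS.snd hP h3 h0 h1 h2)

theorem IsCl.even (hS : IsCl P S) (hP : IsCurve P) {q : Fin 4 ↪ E} (h0 : q 0 ∈ S) (h2 : q 2 ∈ S)
    (h1 : q 1 ∉ S) (h3 : q 3 ∉ S) : P q = ((-1 : ℝ) : OnePoint ℝ) :=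
  hP.cross_neg_one (hS _ h0 h2 h1 h3)

theorem IsCl.odd (hS : IsCl P S) (hP : IsCurve P) {q : Fin 4 ↪ E} (h1 : q 1 ∈ S) (h3 : q 3 ∈ S)
    (h0 : q 0 ∉ S) (h2 : q 2 ∉ S) : P q = ((-1 : ℝ) : OnePoint ℝ) :=
  hP.cross_neg_one (hS.snd hP h1 h3 h0 h2)

/-- The quadruple `(q 0, q' 0, q 1, q 3)` has exactly its first two entries in the cluster, so its
cross-ratio is `0` and `IsCurve.eq_of_collision` applies. -/
theorem IsCl.eq_of_fst (hS : IsCl P S) (hP : IsCurve P) {q q' : Fin 4 ↪ E} (h0 : q 0 ∈ S)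
    (h0' : q' 0 ∈ S) (h : ∀ j, j ≠ 0 → q' j = q j ∧ q j ∉ S) : P q = P q' := by
  by_cases he : q 0 = q' 0
  · congr 1
    ext j
    by_cases hj : j = 0
    · rw [hj, he]
    · exact (h j hj).1.symm
  · have h1 := h 1 (by decide)
    have h2 := h 2 (by decide)
    have h3 := h 3 (by decide)
    have hr : Function.Injective ![q 0, q' 0, q 1, q 3] := by
      have e1 : q 0 ≠ q 1 := fun e => h1.2 (e ▸ h0)
      have e2 : q 0 ≠ q 3 := fun e => h3.2 (e ▸ h0)
      have e3 : q' 0 ≠ q 1 := fun e => h1.2 (e ▸ h0')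
      have e4 : q' 0 ≠ q 3 := fun e => h3.2 (e ▸ h0')
      have e5 : q 1 ≠ q 3 := fun e => absurd (q.injective e) (by decide)
      have hn : [q 0, q' 0, q 1, q 3].Nodup := by simp [he, e1, e2, e3, e4, e5]
      rw [← List.nodup_ofFn]
      simpa using hn
    exact hP.eq_of_collision (r := ⟨_, hr⟩) rfl rfl rfl rfl h1.1 h2.1 h3.1 (hS _ h0 h0' h1.2 h3.2)

/-- The Klein four-group brings the position `i` to the first place without changing the
cross-ratio. -/
theorem IsCl.eq_of_update (hS : IsCl P S) (hP : IsCurve P) {q q' : Fin 4 ↪ E} (i : Fin 4)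
    (h0 : q i ∈ S) (h0' : q' i ∈ S) (h : ∀ j, j ≠ i → q' j = q j ∧ q j ∉ S) : P q = P q' := by
  have key : ∀ f : Fin 4 → Fin 4, ∀ hf : Function.Injective f, f 0 = i →
      P (reorder q f hf) = P (reorder q' f hf) := fun f hf hi =>
    hS.eq_of_fst hP (by simpa [hi] using h0) (by simpa [hi] using h0')
      fun j hj => h (f j) fun e => hj (hf (e.trans hi.symm))
  fin_cases i
  · exact hS.eq_of_fst hP h0 h0' h
  · rw [← hP.double_swap q, ← hP.double_swap q']
    exact key _ _ rfl
  · rw [← hP.pair_swap q, ← hP.pair_swap q']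
    exact key _ _ rfl
  · rw [← hP.pair_swap q, ← hP.pair_swap q', ← hP.double_swap, ← hP.double_swap (reorder q' _ _)]
    exact key (fun k => ![2, 3, 0, 1] (![1, 0, 3, 2] k)) (by decide) rfl

/-- A cross-ratio is unchanged if its entries are moved inside disjoint clusters. -/
theorem IsCurve.eq_of_clusters (hP : IsCurve P) {S : Fin 4 → Set E} (hS : ∀ i, IsCl P (S i))
    (hd : ∀ i j, i ≠ j → Disjoint (S i) (S j)) {q q' : Fin 4 ↪ E} (hq : ∀ i, q i ∈ S i)
    (hq' : ∀ i, q' i ∈ S i) : P q = P q' := by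
  have hne : ∀ {x y i j}, i ≠ j → x ∈ S i → y ∈ S j → x ≠ y := fun hij hx hy e =>
    Set.disjoint_left.1 (hd _ _ hij) hx (e ▸ hy)
  -- `u k` has its first `k` entries from `q'` and the others from `q`, so that one entry changes at
  -- a time; the disjointness of the clusters keeps the entries distinct.
  let u : ℕ → Fin 4 → E := fun k i => if (i : ℕ) < k then q' i else q i
  have hu : ∀ k i, u k i ∈ S i := by
    intro k i
    simp only [u]
    split_ifs
    exacts [hq' i, hq i]
  have hinj : ∀ k, Function.Injective (u k) := by
    intro k i j h
    by_contra hij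
    exact hne hij (hu k i) (hu k j) h
  have step : ∀ k : Fin 4, P ⟨u k, hinj k⟩ = P ⟨u (k + 1), hinj (k + 1)⟩ := by
    intro k
    refine (hS k).eq_of_update hP k (hu _ k) (hu _ k) fun j hj => ⟨?_, fun h => ?_⟩
    · have : (j : ℕ) ≠ k := fun h => hj (Fin.ext h)
      change (if (j : ℕ) < k + 1 then q' j else q j) = if (j : ℕ) < k then q' j else q j
      split_ifs <;> first | rfl | omega
    · exact Set.disjoint_left.1 (hd _ _ hj) (hu _ j) h
  have h0 : q = ⟨u 0, hinj 0⟩ := by ext i; simp [u]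
  have h4 : q' = ⟨u 4, hinj 4⟩ := by ext i; simp [u]
  rw [h0, h4]
  exact (step 0).trans ((step 1).trans ((step 2).trans (step 3)))

end Clusters

/-! ### Towers of finite quotients in which every label splits into at most two -/

/-- A set `E` with a sequence of finite quotients `L n`, which separate its points, such that each
element of `L n` is the image of at most two elements of `L (n + 1)`. -/
structure SplitTower (E : Type) (L : ℕ → Type) where
  f : ∀ n, L (n + 1) → L n
  tr : ∀ n, E → L n
  sec : ∀ n, L n → E
  finite : ∀ n, Finite (L n)
  fibre : ∀ n i j k, f n i = f n j → f n j = f n k → i = j ∨ j = k ∨ i = k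
  f_tr : ∀ n z, f n (tr (n + 1) z) = tr n z
  tr_sec : ∀ n w, tr n (sec n w) = w
  separates : ∀ z z', (∀ n, tr n z = tr n z') → z = z'

namespace SplitTower

variable {E : Type} {L : ℕ → Type} (𝕋 : SplitTower E L)

theorem tr_eq_of_le {m n : ℕ} (h : n ≤ m) {z z' : E} (hz : 𝕋.tr m z = 𝕋.tr m z') :
    𝕋.tr n z = 𝕋.tr n z' := by
  induction m, h using Nat.le_induction with
  | base => exact hz
  | succ m _ ih => exact ih (by rw [← 𝕋.f_tr, hz, 𝕋.f_tr])

theorem eventually_injective {J : Type} [Finite J] (ι : J ↪ E) :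
    ∀ᶠ m in atTop, Function.Injective fun j => 𝕋.tr m (ι j) := by
  have : ∀ i j, ∀ᶠ m in atTop, 𝕋.tr m (ι i) = 𝕋.tr m (ι j) → i = j := by
    intro i j
    by_cases hij : i = j
    · exact Eventually.of_forall fun _ _ => hij
    · have : ¬ ∀ n, 𝕋.tr n (ι i) = 𝕋.tr n (ι j) := fun h => hij (ι.injective (𝕋.separates _ _ h))
      push Not at this
      obtain ⟨n, hn⟩ := this
      filter_upwards [eventually_ge_atTop n] with m hm h
      exact absurd (𝕋.tr_eq_of_le hm h) hn
  filter_upwards [eventually_all.2 fun i => eventually_all.2 fun j => this i j] with m hm i j h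
  exact hm i j h

theorem tr_injective_mono {J : Type} {ι : J → E} {m n : ℕ} (h : n ≤ m)
    (hn : Function.Injective fun j => 𝕋.tr n (ι j)) : Function.Injective fun j => 𝕋.tr m (ι j) :=
  fun _ _ hij => hn (𝕋.tr_eq_of_le h hij)

/-- Labels that are distinct at one level remain so at all higher levels, hence the level `j` is
unique. The degenerate value is read there. -/
theorem exists_last_level (q : Fin 4 ↪ E) {n : ℕ}
    (hn : ¬ Function.Injective fun k => 𝕋.tr n (q k)) :
    ∃ j ≥ n, (¬ Function.Injective fun k => 𝕋.tr j (q k)) ∧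
      Function.Injective fun k => 𝕋.tr (j + 1) (q k) := by
  obtain ⟨m, hm⟩ := (𝕋.eventually_injective q).exists
  have hnm : n ≤ m := by
    by_contra h
    exact hn (𝕋.tr_injective_mono (not_le.1 h).le hm)
  induction m, hnm using Nat.le_induction with
  | base => exact absurd hm hn
  | succ m hnm ih =>
    by_cases h : Function.Injective fun k => 𝕋.tr m (q k)
    · exact ih h
    · exact ⟨m, hnm, h, hm⟩

open Classical in
/-- The value of a cross-ratio prescribed by coincidences. -/
noncomputable def degenerate {I : Type} (u : Fin 4 → I) : OnePoint ℝ :=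
  if u 0 = u 1 ∨ u 2 = u 3 then ((0 : ℝ) : OnePoint ℝ)
  else if u 1 = u 2 ∨ u 0 = u 3 then OnePoint.infty
  else ((-1 : ℝ) : OnePoint ℝ)

open Classical in
/-- The system of cross-ratios on `E` determined by one at level `n`, by successive
stabilizations. -/
noncomputable def lift (n : ℕ) (p : QuadSpace (L n)) : QuadSpace E := fun q =>
  if h : Function.Injective fun k => 𝕋.tr n (q k) then p ⟨_, h⟩
  else degenerate fun k => 𝕋.tr (𝕋.exists_last_level q h).choose (q k)

theorem lift_of_injective {n : ℕ} (p : QuadSpace (L n)) {q : Fin 4 ↪ E}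
    (h : Function.Injective fun k => 𝕋.tr n (q k)) : 𝕋.lift n p q = p ⟨_, h⟩ := dif_pos h

theorem lift_of_last {n j : ℕ} (p : QuadSpace (L n)) {q : Fin 4 ↪ E} (hj : n ≤ j)
    (h : ¬ Function.Injective fun k => 𝕋.tr j (q k))
    (h' : Function.Injective fun k => 𝕋.tr (j + 1) (q k)) :
    𝕋.lift n p q = degenerate fun k => 𝕋.tr j (q k) := by
  have hn : ¬ Function.Injective fun k => 𝕋.tr n (q k) := fun h1 => h (𝕋.tr_injective_mono hj h1)
  have hs := (𝕋.exists_last_level q hn).choose_spec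
  unfold lift
  rw [dif_neg hn]
  have : (𝕋.exists_last_level q hn).choose = j := by
    refine le_antisymm ?_ ?_ <;> by_contra hlt
    · exact hs.2.1 (𝕋.tr_injective_mono (by omega) h')
    · exact h (𝕋.tr_injective_mono (by omega) hs.2.2)
  rw [this]

/-- This makes the lifts descend to the inductive limit. The delicate case is that of four elements
that become distinct exactly at level `n + 1`: `stabilize` then follows the same rule as
`degenerate`. -/
theorem lift_stabilize (n : ℕ) (p : QuadSpace (L n)) :
    𝕋.lift (n + 1) (stabilize (𝕋.f n) p) = 𝕋.lift n p := by
  funext q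
  by_cases h1 : Function.Injective fun k => 𝕋.tr (n + 1) (q k)
  · rw [lift_of_injective _ _ h1]
    by_cases h0 : Function.Injective fun k => 𝕋.tr n (q k)
    · rw [lift_of_injective _ _ h0]
      have h0' : Function.Injective fun k => 𝕋.f n (𝕋.tr (n + 1) (q k)) := by
        simpa only [𝕋.f_tr] using h0
      unfold stabilize
      simp only [Function.Embedding.coeFn_mk, dif_pos h0']
      congr 1
      ext k
      exact 𝕋.f_tr n (q k)
    · rw [lift_of_last _ _ le_rfl h0 h1]
      have h0' : ¬ Function.Injective fun k => 𝕋.f n (𝕋.tr (n + 1) (q k)) := by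
        simpa only [𝕋.f_tr] using h0
      unfold stabilize
      simp only [Function.Embedding.coeFn_mk, dif_neg h0']
      change degenerate (fun k => 𝕋.f n (𝕋.tr (n + 1) (q k))) = _
      congr 1
      exact funext fun k => 𝕋.f_tr n (q k)
  · obtain ⟨j, hj, hj0, hj1⟩ := 𝕋.exists_last_level q h1
    rw [lift_of_last _ _ hj hj0 hj1, lift_of_last _ _ (by omega : n ≤ j) hj0 hj1]

theorem continuous_lift_apply (n : ℕ) (q : Fin 4 ↪ E) :
    Continuous fun p : QuadSpace (L n) => 𝕋.lift n p q := by
  unfold lift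
  split_ifs
  · exact continuous_apply _
  · exact continuous_const

theorem continuous_lift (n : ℕ) : Continuous (𝕋.lift n) :=
  continuous_pi fun q => 𝕋.continuous_lift_apply n q

/-- The section as an embedding. -/
def secEmb (n : ℕ) : L n ↪ E :=
  ⟨𝕋.sec n, fun w w' h => by rw [← 𝕋.tr_sec n w, h, 𝕋.tr_sec]⟩

@[simp] theorem secEmb_apply (n : ℕ) (w : L n) : 𝕋.secEmb n w = 𝕋.sec n w := rfl

theorem restrict_lift (n : ℕ) (p : QuadSpace (L n)) : restrict (𝕋.secEmb n) (𝕋.lift n p) = p := by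
  funext q
  have h : Function.Injective fun k => 𝕋.tr n (q.trans (𝕋.secEmb n) k) := by
    intro i j hij
    simpa [𝕋.tr_sec] using hij
  unfold restrict
  rw [lift_of_injective _ _ h]
  congr 1
  ext k
  simp [𝕋.tr_sec]

theorem lift_injective (n : ℕ) : Function.Injective (𝕋.lift n) := fun p p' h => by
  rw [← 𝕋.restrict_lift n p, h, 𝕋.restrict_lift]

/-- The clusters above level `n`. -/
def balls (n : ℕ) : Set (Set E) := {C | ∃ k ≥ n, ∃ w : L k, C = 𝕋.tr k ⁻¹' {w}}

theorem tr_mem_balls {n k : ℕ} (h : n ≤ k) (w : L k) : 𝕋.tr k ⁻¹' {w} ∈ 𝕋.balls n := ⟨k, h, w, rfl⟩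

theorem balls_anti {m n : ℕ} (h : n ≤ m) : 𝕋.balls m ⊆ 𝕋.balls n := by
  rintro _ ⟨k, hk, w, rfl⟩
  exact ⟨k, h.trans hk, w, rfl⟩

/-- The curves that come from level `n`. -/
def curves (n : ℕ) : Set (QuadSpace E) := {P | IsCurve P ∧ ∀ C ∈ 𝕋.balls n, IsCl P C}

theorem exists_lift_eq {m n : ℕ} (h : n ≤ m) {p : QuadSpace (L n)} (hp : p ∈ Mbar (L n)) :
    ∃ p' ∈ Mbar (L m), 𝕋.lift m p' = 𝕋.lift n p := by
  induction m, h using Nat.le_induction with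
  | base => exact ⟨p, hp, rfl⟩
  | succ m _ ih =>
    obtain ⟨p', hp', h⟩ := ih
    have := 𝕋.finite (m + 1)
    exact ⟨_, stabilize_mem_Mbar_of_fibres (𝕋.fibre m) hp', by rw [𝕋.lift_stabilize, h]⟩

/-- Finitely many elements are separated at some level `m ≥ n`, where the lift is given by a
stabilized curve; on these elements it is a restriction of that curve. -/
theorem isCurve_lift {n : ℕ} {p : QuadSpace (L n)} (hp : p ∈ Mbar (L n)) :
    IsCurve (𝕋.lift n p) := by
  intro J _ ι
  obtain ⟨m, hm, hnm⟩ := ((𝕋.eventually_injective ι).and (eventually_ge_atTop n)).exists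
  obtain ⟨p', hp', h⟩ := 𝕋.exists_lift_eq hnm hp
  rw [← h]
  convert restrict_mem_Mbar ⟨_, hm⟩ hp' using 1
  funext q
  exact 𝕋.lift_of_injective p' (q := q.trans ι) (hm.comp q.injective)

theorem isCl_lift_ball {n : ℕ} (p : QuadSpace (L n)) {C : Set E} (hC : C ∈ 𝕋.balls n) :
    IsCl (𝕋.lift n p) C := by
  obtain ⟨k, hk, w, rfl⟩ := hC
  intro q h0 h1 h2 h3
  have h0 : 𝕋.tr k (q 0) = w := h0
  have h1 : 𝕋.tr k (q 1) = w := h1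
  have h2 : 𝕋.tr k (q 2) ≠ w := h2
  have h3 : 𝕋.tr k (q 3) ≠ w := h3
  have hk' : ¬ Function.Injective fun i => 𝕋.tr k (q i) := fun h =>
    absurd (h (h0.trans h1.symm)) (by decide)
  obtain ⟨j, hj, hj0, hj1⟩ := 𝕋.exists_last_level q hk'
  rw [lift_of_last _ _ (hk.trans hj) hj0 hj1, degenerate, if_pos]
  -- Otherwise a coincidence at level `j` joins one of the first two entries to one of the last two.
  -- It persists at level `k`, where the former lie over `w` and the latter do not.
  by_contra hcon
  push Not at hcon
  refine hj0 fun a b hab => ?_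
  have hab' : 𝕋.tr j (q a) = 𝕋.tr j (q b) := hab
  have hk := 𝕋.tr_eq_of_le hj hab'
  fin_cases a <;> fin_cases b <;> simp_all

theorem lift_mem_curves {n : ℕ} {p : QuadSpace (L n)} (hp : p ∈ Mbar (L n)) :
    𝕋.lift n p ∈ 𝕋.curves n := ⟨𝕋.isCurve_lift hp, fun _ hC => 𝕋.isCl_lift_ball p hC⟩

/-- Three distinct labels of level `j + 1` cannot lie in one fibre of `f j`: just before four
elements separate, they coincide at most by pairs. -/
theorem third_notMem {j : ℕ} {q : Fin 4 ↪ E} (h : Function.Injective fun k => 𝕋.tr (j + 1) (q k))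
    {a b c : Fin 4} (hab : a ≠ b) (hac : a ≠ c) (hbc : b ≠ c)
    (he : 𝕋.tr j (q a) = 𝕋.tr j (q b)) : 𝕋.tr j (q c) ≠ 𝕋.tr j (q a) := by
  intro hc
  rcases 𝕋.fibre j (𝕋.tr (j + 1) (q a)) (𝕋.tr (j + 1) (q b)) (𝕋.tr (j + 1) (q c))
    (by simpa [𝕋.f_tr] using he) (by simpa [𝕋.f_tr] using he.symm.trans hc.symm) with h' | h' | h'
  exacts [hab (h h'), hbc (h h'), hac (h h')]

theorem restrict_mem_Mbar_of_mem_curves {n : ℕ} {P : QuadSpace E} (hP : P ∈ 𝕋.curves n) (m : ℕ) :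
    restrict (𝕋.secEmb m) P ∈ Mbar (L m) :=
  have := 𝕋.finite m
  hP.1 _ _

theorem exists_pair_lt {u : Fin 4 → E} (h : ¬ Function.Injective u) : ∃ a b, a < b ∧ u a = u b := by
  simp only [Function.Injective, not_forall] at h
  obtain ⟨a, b, hab, hne⟩ := h
  rcases lt_or_gt_of_ne hne with h | h
  exacts [⟨a, b, h, hab⟩, ⟨b, a, h, hab.symm⟩]

/-- A cluster with exactly two of the four entries forces the value, and the six positions of the
pair match the cases of `degenerate`. The two other values of `u` may coincide too: complementary
pairs prescribe the same value. -/
theorem eq_degenerate {I : Type} {P : QuadSpace E} (hP : IsCurve P) {q : Fin 4 ↪ E} {u : Fin 4 → I}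
    {a b : Fin 4} (hab : a < b) (he : u a = u b) (h3 : ∀ c, c ≠ a → c ≠ b → u c ≠ u a) {C : Set E}
    (hC : IsCl P C) (hu : ∀ i, q i ∈ C ↔ u i = u a) : P q = degenerate u := by
  have ha : q a ∈ C := (hu a).2 rfl
  have hb : q b ∈ C := (hu b).2 he.symm
  have hc : ∀ c, c ≠ a → c ≠ b → q c ∉ C := fun c h1 h2 => by rw [hu]; exact h3 c h1 h2
  have d : ∀ c, c ≠ a → c ≠ b → u c ≠ u b := fun c h1 h2 => by rw [← he]; exact h3 c h1 h2
  have key : ∀ i j k l : Fin 4, i = a → j = b → k ≠ a → k ≠ b → l ≠ a → l ≠ b →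
      (u i = u j ∧ u k ≠ u i ∧ u k ≠ u j ∧ u l ≠ u i ∧ u l ≠ u j) ∧
        q i ∈ C ∧ q j ∈ C ∧ q k ∉ C ∧ q l ∉ C := by
    rintro i j k l rfl rfl h1 h2 h3' h4
    exact ⟨⟨he, h3 _ h1 h2, d _ h1 h2, h3 _ h3' h4, d _ h3' h4⟩, ha, hb, hc _ h1 h2, hc _ h3' h4⟩
  unfold degenerate
  fin_cases a <;> fin_cases b <;> first | exact absurd hab (by decide) | skip
  · obtain ⟨⟨h0, h1, h2, h3, h4⟩, i0, i1, i2, i3⟩ :=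
      key 0 1 2 3 rfl rfl (by decide) (by decide) (by decide) (by decide)
    rw [hC q i0 i1 i2 i3, if_pos (Or.inl h0)]
  · obtain ⟨⟨h0, h1, h2, h3, h4⟩, i0, i1, i2, i3⟩ :=
      key 0 2 1 3 rfl rfl (by decide) (by decide) (by decide) (by decide)
    rw [hC.even hP i0 i1 i2 i3, if_neg (by simp [h1.symm, h4.symm]), if_neg (by simp [h2, h3.symm])]
  · obtain ⟨⟨h0, h1, h2, h3, h4⟩, i0, i1, i2, i3⟩ :=
      key 0 3 1 2 rfl rfl (by decide) (by decide) (by decide) (by decide)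
    rw [hC.outer hP i0 i1 i2 i3, if_neg (by simp [h1.symm, h4]), if_pos (Or.inr h0)]
  · obtain ⟨⟨h0, h1, h2, h3, h4⟩, i0, i1, i2, i3⟩ :=
      key 1 2 0 3 rfl rfl (by decide) (by decide) (by decide) (by decide)
    rw [hC.mid hP i0 i1 i2 i3, if_neg (by simp [h1, h4.symm]), if_pos (Or.inl h0)]
  · obtain ⟨⟨h0, h1, h2, h3, h4⟩, i0, i1, i2, i3⟩ :=
      key 1 3 0 2 rfl rfl (by decide) (by decide) (by decide) (by decide)
    rw [hC.odd hP i0 i1 i2 i3, if_neg (by simp [h1, h4]), if_neg (by simp [h2, h3.symm])]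
  · obtain ⟨⟨h0, h1, h2, h3, h4⟩, i0, i1, i2, i3⟩ :=
      key 2 3 0 1 rfl rfl (by decide) (by decide) (by decide) (by decide)
    rw [hC.snd hP i0 i1 i2 i3, if_pos (Or.inr h0)]

/-- A curve for which all the balls are clusters is determined at level `n`. Four entries with
distinct labels can be moved, inside disjoint balls, to the chosen representatives; for the others,
the ball of the last coincidence forces the value. -/
theorem lift_restrict {n : ℕ} {P : QuadSpace E} (hP : P ∈ 𝕋.curves n) :
    𝕋.lift n (restrict (𝕋.secEmb n) P) = P := by
  funext q
  by_cases h : Function.Injective fun k => 𝕋.tr n (q k)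
  · rw [lift_of_injective _ _ h]
    refine hP.1.eq_of_clusters (S := fun i => 𝕋.tr n ⁻¹' {𝕋.tr n (q i)})
      (fun i => hP.2 _ (𝕋.tr_mem_balls le_rfl _)) (fun i j hij => ?_) (fun i => ?_) (fun i => rfl)
    · refine Set.disjoint_left.2 fun z hz hz' => hij (h ?_)
      exact (Eq.symm hz).trans hz'
    · simp [𝕋.tr_sec]
  · obtain ⟨j, hj, hj0, hj1⟩ := 𝕋.exists_last_level q h
    rw [lift_of_last _ _ hj hj0 hj1]
    obtain ⟨a, b, hab, he⟩ := exists_pair_lt hj0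
    exact (eq_degenerate (u := fun k => 𝕋.tr j (q k)) hP.1 hab he
      (fun c h1 h2 => 𝕋.third_notMem hj1 hab.ne h1.symm h2.symm he)
      (hP.2 _ (𝕋.tr_mem_balls hj (𝕋.tr j (q a)))) fun i => Iff.rfl).symm

/-- Adding a base point, which never splits. -/
def option : SplitTower (Option E) fun n => Option (L n) where
  f n := Option.map (𝕋.f n)
  tr n := Option.map (𝕋.tr n)
  sec n := Option.map (𝕋.sec n)
  finite n := have := 𝕋.finite n; inferInstance
  fibre n i j k h1 h2 := by
    rcases i with _ | i <;> rcases j with _ | j <;> rcases k with _ | k <;> simp_all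
    exact 𝕋.fibre n i j k (h1.trans h2.symm) h2
  f_tr n z := by cases z <;> simp [𝕋.f_tr]
  tr_sec n w := by cases w <;> simp [𝕋.tr_sec]
  separates z z' h := by
    rcases z with _ | z <;> rcases z' with _ | z' <;> simp_all
    exact 𝕋.separates z z' h

end SplitTower

/-! ### Strata in terms of clusters -/

namespace PlanarTree

variable {I : Type} {T : PlanarTree I}

theorem IsNested.sublist_iff [DecidableEq I] (hT : T.IsNested) (xs : List I) :
    xs.Sublist T.labels ↔ xs.Pairwise fun a b => T.labels.idxOf a < T.labels.idxOf b :=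
  sublist_iff_idxOf hT.1 fun x _ => hT.2.1 x

theorem IsNested.ordConnected [DecidableEq I] (hT : T.IsNested) {A : Set I} (hA : A ∈ T.clusters)
    {a b c : I} (ha : a ∈ A) (hc : c ∈ A) (h1 : T.labels.idxOf a ≤ T.labels.idxOf b)
    (h2 : T.labels.idxOf b ≤ T.labels.idxOf c) : b ∈ A := by
  obtain ⟨⟨l, hl, rfl⟩, -⟩ := hT.2.2.1 A hA
  exact infix_ordConnected hT.1 hl ha hc h1 h2

theorem IsNested.mem_of_sublist (hT : T.IsNested) {A : Set I} (hA : A ∈ T.clusters)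
    {a b c : I} (h : [a, b, c].Sublist T.labels) (ha : a ∈ A) (hc : c ∈ A) : b ∈ A := by
  classical
  rw [hT.sublist_iff] at h
  simp only [List.pairwise_cons, List.mem_cons, List.not_mem_nil, or_false, forall_eq_or_imp,
    forall_eq] at h
  exact hT.ordConnected hA ha hc h.1.1.le h.2.1.le

/-- Every cluster of a tree is a cluster of the curves in its cell. -/
theorem IsNested.isCl (hT : T.IsNested) {p : QuadSpace I} (hp : IsCurve p) (hpT : p ∈ T.quadCell)
    {B : Set I} (hB : B ∈ T.clusters) : IsCl p B := by
  classical
  have hsub : ∀ q : Fin 4 ↪ I, T.labels.idxOf (q 0) < T.labels.idxOf (q 1) →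
      T.labels.idxOf (q 1) < T.labels.idxOf (q 2) → T.labels.idxOf (q 2) < T.labels.idxOf (q 3) →
      [q 0, q 1, q 2, q 3].Sublist T.labels := by
    intro q h1 h2 h3
    rw [hT.sublist_iff]
    simp only [List.pairwise_cons, List.mem_cons, List.not_mem_nil, or_false, forall_eq_or_imp,
      forall_eq, IsEmpty.forall_iff, implies_true, List.Pairwise.nil, and_true]
    omega
  have hidx : ∀ {a b : I}, a ≠ b → T.labels.idxOf a ≠ T.labels.idxOf b := fun {a b} h h' =>
    h ((List.idxOf_inj (hT.2.1 a)).1 h')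
  -- The cell conditions only concern quadruples read from the left to the right. As `B` is an
  -- interval, `q 2` and `q 3` are both to the right of the pair `q 0, q 1`, both to its left, or on
  -- either side of it; a symmetry of cross-ratios brings each case back to the sorted quadruple.
  have main : ∀ q : Fin 4 ↪ I, q 0 ∈ B → q 1 ∈ B → q 2 ∉ B → q 3 ∉ B →
      T.labels.idxOf (q 0) < T.labels.idxOf (q 1) → T.labels.idxOf (q 2) < T.labels.idxOf (q 3) →
      p q = (0 : ℝ) := by
    intro q h0 h1 h2 h3 h01 h23
    have c2 : ¬ (T.labels.idxOf (q 0) ≤ T.labels.idxOf (q 2) ∧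
        T.labels.idxOf (q 2) ≤ T.labels.idxOf (q 1)) := fun h =>
      h2 (hT.ordConnected hB h0 h1 h.1 h.2)
    have c3 : ¬ (T.labels.idxOf (q 0) ≤ T.labels.idxOf (q 3) ∧
        T.labels.idxOf (q 3) ≤ T.labels.idxOf (q 1)) := fun h =>
      h3 (hT.ordConnected hB h0 h1 h.1 h.2)
    by_cases a1 : T.labels.idxOf (q 1) < T.labels.idxOf (q 2)
    · exact (hpT q (hsub q h01 a1 h23)).1 ⟨B, hB, Or.inl ⟨h0, h1, h2, h3⟩⟩
    by_cases a2 : T.labels.idxOf (q 3) < T.labels.idxOf (q 0)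
    · have hs := hsub (reorder q ![2, 3, 0, 1] (by decide)) h23 a2 h01
      rw [← hp.pair_swap q]
      exact (hpT _ hs).1 ⟨B, hB, Or.inr ⟨h0, h1, h2, h3⟩⟩
    -- In the sorted quadruple the pair in `B` is now in the middle, so the cell gives the value
    -- `∞`, which a cyclic shift changes into `0`.
    · have hs := hsub (reorder q ![2, 0, 1, 3] (by decide)) (by simp; omega) h01 (by simp; omega)
      have h4 := (hpT _ hs).2.1 ⟨B, hB, Or.inl ⟨h0, h1, h2, h3⟩⟩
      rw [← hp.double_swap q, ← hp.swap_zero (hp.cyc_zero h4)]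
      congr 1
      ext k
      fin_cases k <;> rfl
  intro q h0 h1 h2 h3
  have n01 : q 0 ≠ q 1 := fun h => absurd (q.injective h) (by decide)
  have n23 : q 2 ≠ q 3 := fun h => absurd (q.injective h) (by decide)
  rcases lt_or_gt_of_ne (hidx n01) with a | a <;> rcases lt_or_gt_of_ne (hidx n23) with b | b
  · exact main q h0 h1 h2 h3 a b
  · rw [← hp.double_swap q,
      ← hp.swap_zero (main (reorder q ![0, 1, 3, 2] (by decide)) h0 h1 h3 h2 a b)]
    congr 1
    ext k
    fin_cases k <;> rfl
  · rw [← hp.swap_zero (main (reorder q ![1, 0, 2, 3] (by decide)) h1 h0 h2 h3 a b)]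
    congr 1
    ext k
    fin_cases k <;> rfl
  · have := main (reorder q ![1, 0, 3, 2] (by decide)) h1 h0 h3 h2 a b
    rwa [hp.double_swap] at this

theorem IsNested.addRoot (hT : T.IsNested) : T.addRoot.IsNested := by
  refine ⟨?_, ?_, ?_, ?_⟩
  · simp only [PlanarTree.addRoot, List.nodup_cons, List.mem_map, reduceCtorEq, and_false,
      exists_false, not_false_eq_true, true_and]
    exact hT.1.map (Option.some_injective _)
  · rintro (_ | i)
    · simp [PlanarTree.addRoot]
    · simp [PlanarTree.addRoot, hT.2.1 i]
  · rintro _ ⟨A, hA, rfl⟩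
    obtain ⟨⟨l, hl, rfl⟩, h2⟩ := hT.2.2.1 A hA
    refine ⟨⟨l.map some, ?_, ?_⟩, ?_⟩
    · exact (hl.map some).trans (List.suffix_cons _ _).isInfix
    · ext i
      simp
    · rwa [Set.ncard_image_of_injective _ (Option.some_injective _)]
  · rintro _ ⟨A, hA, rfl⟩ _ ⟨B, hB, rfl⟩
    rcases hT.2.2.2 A hA B hB with h | h | h
    · exact Or.inl (image_mono h)
    · exact Or.inr (Or.inl (image_mono h))
    · exact Or.inr (Or.inr ((Set.disjoint_image_iff (Option.some_injective _)).2 h))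

end PlanarTree

/-- Some set of the family `𝒞` separates `a, b` from `c, d`. -/
def SepBy {E : Type} (𝒞 : Set (Set E)) (a b c d : E) : Prop :=
  ∃ C ∈ 𝒞, (a ∈ C ∧ b ∈ C ∧ c ∉ C ∧ d ∉ C) ∨ (c ∈ C ∧ d ∈ C ∧ a ∉ C ∧ b ∉ C)

/-! ### Strata as sets of systems of cross-ratios, and their transport by permutations -/

namespace SplitTower

variable {E : Type} {L : ℕ → Type} (𝕋 : SplitTower E L)

/-- The clusters, in `E`, of a tree of level `n`. -/
def clus (n : ℕ) (T : PlanarTree (L n)) : Set (Set E) :=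
  𝕋.balls n ∪ {C | ∃ B ∈ T.clusters, C = 𝕋.tr n ⁻¹' B}

/-- The labels of four elements of `E` occur in this order in the tree. -/
def InOrder (n : ℕ) (T : PlanarTree (L n)) (q : Fin 4 → E) : Prop :=
  [𝕋.tr n (q 0), 𝕋.tr n (q 1), 𝕋.tr n (q 2), 𝕋.tr n (q 3)].Sublist T.labels

/-- The curves that come from the stratum of a tree of level `n`. -/
def endStratum (n : ℕ) (T : PlanarTree (L n)) : Set (QuadSpace E) :=
  {P | IsCurve P ∧ (∀ C ∈ 𝕋.clus n T, IsCl P C) ∧ ∀ q : Fin 4 ↪ E, 𝕋.InOrder n T q →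
    ¬ SepBy (𝕋.clus n T) (q 0) (q 1) (q 2) (q 3) → ¬ SepBy (𝕋.clus n T) (q 1) (q 2) (q 0) (q 3) →
      ∃ r : ℝ, 0 < r ∧ P q = (r : OnePoint ℝ)}

theorem endStratum_subset (n : ℕ) (T : PlanarTree (L n)) : 𝕋.endStratum n T ⊆ 𝕋.curves n :=
  fun _ hP => ⟨hP.1, fun C hC => hP.2.1 C (Or.inl hC)⟩

variable {𝕋} {n : ℕ} {T : PlanarTree (L n)}

theorem InOrder.injective {q : Fin 4 → E} (h : 𝕋.InOrder n T q) (hT : T.IsNested) :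
    Function.Injective fun i => 𝕋.tr n (q i) := by
  have := hT.1.sublist h
  rw [← List.nodup_ofFn]
  simpa using this

theorem sepBy_clus_of_separates {a b c d : E}
    (h : T.Separates (𝕋.tr n a) (𝕋.tr n b) (𝕋.tr n c) (𝕋.tr n d)) :
    SepBy (𝕋.clus n T) a b c d := by
  obtain ⟨A, hA, h⟩ := h
  exact ⟨_, Or.inr ⟨A, hA, rfl⟩, h⟩

/-- All the elements of a ball of level at least `n` have the same label at level `n`, so only the
clusters of the tree can contain one of the two pairs. -/
theorem separates_of_sepBy {a b c d : E} (hab : 𝕋.tr n a ≠ 𝕋.tr n b) (hcd : 𝕋.tr n c ≠ 𝕋.tr n d)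
    (h : SepBy (𝕋.clus n T) a b c d) :
    T.Separates (𝕋.tr n a) (𝕋.tr n b) (𝕋.tr n c) (𝕋.tr n d) := by
  obtain ⟨_, ⟨k, hk, w, rfl⟩ | ⟨B, hB, rfl⟩, h⟩ := h
  · rcases h with h | h
    · exact absurd (𝕋.tr_eq_of_le hk (Eq.trans h.1 (Eq.symm h.2.1))) hab
    · exact absurd (𝕋.tr_eq_of_le hk (Eq.trans h.1 (Eq.symm h.2.1))) hcd
  · exact ⟨B, hB, h⟩

/-- If two of the four labels coincide, they are on the same side of `B`, and a ball of level `n`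
already forces the value `0`. -/
theorem isCl_lift {p : QuadSpace (L n)} (hp : p ∈ Mbar (L n)) {B : Set (L n)} (hB : IsCl p B) :
    IsCl (𝕋.lift n p) (𝕋.tr n ⁻¹' B) := by
  intro q h0 h1 h2 h3
  by_cases h : Function.Injective fun i => 𝕋.tr n (q i)
  · rw [lift_of_injective _ _ h]
    exact hB _ h0 h1 h2 h3
  · have hC := fun a => 𝕋.isCl_lift_ball p (𝕋.tr_mem_balls le_rfl (𝕋.tr n a))
    have hcur := 𝕋.isCurve_lift hp
    have hne : ∀ {a b}, a ∈ 𝕋.tr n ⁻¹' B → b ∉ 𝕋.tr n ⁻¹' B → 𝕋.tr n a ≠ 𝕋.tr n b := by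
      intro a b ha hb hab
      exact hb (by rw [mem_preimage, ← hab]; exact ha)
    by_cases h01 : 𝕋.tr n (q 0) = 𝕋.tr n (q 1)
    · exact hC (q 0) q rfl h01.symm (hne h0 h2).symm (hne h0 h3).symm
    by_cases h23 : 𝕋.tr n (q 2) = 𝕋.tr n (q 3)
    · exact (hC (q 2)).snd hcur rfl h23.symm (hne h0 h2) (hne h1 h2)
    refine absurd (fun a b hab => ?_) h
    have hab' : 𝕋.tr n (q a) = 𝕋.tr n (q b) := hab
    have e02 := hne h0 h2
    have e03 := hne h0 h3
    have e12 := hne h1 h2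
    have e13 := hne h1 h3
    fin_cases a <;> fin_cases b <;> simp_all

/-- The level disappears from the description of a stratum: the degenerate values become cluster
conditions, and only the positivity of the unseparated cross-ratios remains to be required. -/
theorem mem_quadCell_iff (hT : T.IsNested) {p : QuadSpace (L n)} (hp : p ∈ Mbar (L n)) :
    p ∈ T.quadCell ↔ 𝕋.lift n p ∈ 𝕋.endStratum n T := by
  have hcur := 𝕋.isCurve_lift hp
  constructor
  · intro hpT
    refine ⟨hcur, ?_, fun q hq h1 h2 => ?_⟩
    · rintro C (hC | ⟨B, hB, rfl⟩)
      · exact 𝕋.isCl_lift_ball p hC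
      · exact isCl_lift hp (hT.isCl (isCurve_of_mem_Mbar hp) hpT hB)
    · rw [lift_of_injective _ _ (hq.injective hT)]
      exact (hpT ⟨_, hq.injective hT⟩ hq).2.2 (fun h => h1 (sepBy_clus_of_separates h))
        fun h => h2 (sepBy_clus_of_separates h)
  · rintro ⟨-, hcl, hpos⟩ q hq
    have hpq : p q = 𝕋.lift n p (q.trans (𝕋.secEmb n)) := by
      conv_lhs => rw [← 𝕋.restrict_lift n p]
      rfl
    have hs : ∀ i, 𝕋.tr n (q.trans (𝕋.secEmb n) i) = q i := fun i => 𝕋.tr_sec n (q i)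
    rw [hpq]
    refine ⟨?_, ?_, fun h1 h2 => ?_⟩
    · rintro ⟨A, hA, h | h⟩ <;> simp only [← hs] at h
      · exact hcl _ (Or.inr ⟨A, hA, rfl⟩) _ h.1 h.2.1 h.2.2.1 h.2.2.2
      · exact (hcl _ (Or.inr ⟨A, hA, rfl⟩)).snd hcur h.1 h.2.1 h.2.2.1 h.2.2.2
    · rintro ⟨A, hA, h | h⟩ <;> simp only [← hs] at h
      · exact (hcl _ (Or.inr ⟨A, hA, rfl⟩)).mid hcur h.1 h.2.1 h.2.2.1 h.2.2.2
      · exact (hcl _ (Or.inr ⟨A, hA, rfl⟩)).outer hcur h.1 h.2.1 h.2.2.1 h.2.2.2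
    · have hne : ∀ {i j : Fin 4}, i ≠ j → 𝕋.tr n (q.trans (𝕋.secEmb n) i) ≠
          𝕋.tr n (q.trans (𝕋.secEmb n) j) := by
        intro i j hij
        rw [hs, hs]
        exact fun h => hij (q.injective h)
      refine hpos _ (by simpa only [InOrder, hs] using hq) (fun h => h1 ?_) (fun h => h2 ?_)
      · have := separates_of_sepBy (hne (by decide)) (hne (by decide)) h
        simpa only [hs] using this
      · have := separates_of_sepBy (hne (by decide)) (hne (by decide)) h
        simpa only [hs] using this

/-- The action of a permutation of the labels. -/
def act (g : Equiv.Perm E) (P : QuadSpace E) : QuadSpace E := restrict (g⁻¹ : Equiv.Perm E).toEmbedding P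

/-- The permutation `g` of `E` carries the tree `T` of level `n` to the tree `T'` of level `m`, in
which each leaf of `T` is replaced by a subtree. -/
structure Carries (𝕋 : SplitTower E L) (g : Equiv.Perm E) {n m : ℕ} (T : PlanarTree (L n))
    (T' : PlanarTree (L m)) : Prop where
  clus_iff : ∀ C, C ∈ 𝕋.clus n T ↔ g '' C ∈ 𝕋.clus m T'
  exists_labels : ∃ (π : L m → L n) (F : L n → List (L m)), (∀ z, π (𝕋.tr m (g z)) = 𝕋.tr n z) ∧
    T'.labels = T.labels.flatMap F ∧ ∀ x w, x ∈ F w ↔ π x = w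

theorem act_apply_image (g : Equiv.Perm E) (P : QuadSpace E) (q : Fin 4 ↪ E) :
    act g P (q.trans g.toEmbedding) = P q := by
  unfold act restrict
  congr 1
  ext i
  simp

theorem act_mul (g h : Equiv.Perm E) (P : QuadSpace E) : act (g * h) P = act g (act h P) := by
  funext q
  unfold act restrict
  congr 1

theorem act_one (P : QuadSpace E) : act 1 P = P := by
  funext q
  unfold act restrict
  congr 1

theorem act_inv_act (g : Equiv.Perm E) (P : QuadSpace E) : act g⁻¹ (act g P) = P := by
  rw [← act_mul, inv_mul_cancel, act_one]

theorem IsCurve_act {g : Equiv.Perm E} {P : QuadSpace E} : IsCurve (act g P) ↔ IsCurve P := by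
  refine ⟨fun h => ?_, fun h => h.restrict _⟩
  rw [← act_inv_act g P]
  exact h.restrict _

theorem isCl_act {g : Equiv.Perm E} {P : QuadSpace E} {C : Set E} :
    IsCl (act g P) (g '' C) ↔ IsCl P C := by
  constructor
  · intro h q h0 h1 h2 h3
    rw [← act_apply_image g P q]
    exact h _ (mem_image_of_mem g h0) (mem_image_of_mem g h1)
      (fun h' => h2 (g.injective.mem_set_image.1 h')) fun h' => h3 (g.injective.mem_set_image.1 h')
  · intro h q h0 h1 h2 h3
    rw [Equiv.image_eq_preimage_symm] at h0 h1 h2 h3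
    exact h _ h0 h1 h2 h3

theorem sepBy_image {𝒞 𝒞' : Set (Set E)} {g : Equiv.Perm E} (h : ∀ C, C ∈ 𝒞 ↔ g '' C ∈ 𝒞')
    (a b c d : E) : SepBy 𝒞' (g a) (g b) (g c) (g d) ↔ SepBy 𝒞 a b c d := by
  constructor
  · rintro ⟨C, hC, hs⟩
    refine ⟨g ⁻¹' C, (h _).2 (by rwa [image_preimage_eq _ g.surjective]), hs⟩
  · rintro ⟨C, hC, hs⟩
    refine ⟨_, (h _).1 hC, ?_⟩
    simpa only [g.injective.mem_set_image] using hs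

theorem Carries.inOrder_image {g : Equiv.Perm E} {m : ℕ} {T' : PlanarTree (L m)}
    (hg : 𝕋.Carries g T T') {q : Fin 4 → E} (h : 𝕋.InOrder n T q) :
    𝕋.InOrder m T' fun i => g (q i) := by
  obtain ⟨π, F, hπ, hl, hF⟩ := hg.exists_labels
  unfold InOrder
  rw [hl]
  refine sublist_flatMap_of_map_sublist (π := π) (fun x => (hF _ _).2 rfl) _ _ ?_
  simp only [List.map_cons, hπ, List.map_nil]
  exact h

theorem Carries.inOrder_of_image {g : Equiv.Perm E} {m : ℕ} {T' : PlanarTree (L m)}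
    (hg : 𝕋.Carries g T T') {q : Fin 4 → E} (h : 𝕋.InOrder m T' fun i => g (q i))
    (hq : Function.Injective fun i => 𝕋.tr n (q i)) : 𝕋.InOrder n T q := by
  obtain ⟨π, F, hπ, hl, hF⟩ := hg.exists_labels
  unfold InOrder at h
  rw [hl] at h
  have hn : [𝕋.tr n (q 0), 𝕋.tr n (q 1), 𝕋.tr n (q 2), 𝕋.tr n (q 3)].Nodup := by
    rw [← List.nodup_ofFn] at hq
    simpa using hq
  have := map_sublist_of_sublist_flatMap (fun w x hx => (hF x w).1 hx) _ _ h
  simp only [List.map_cons, hπ, List.map_nil] at this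
  exact this hn

/-- Were two labels equal at level `n`, the ball of the last coincidence would contain exactly two
of the four entries. If they are adjacent in the cyclic order, it separates them from the others,
which is excluded. If they are opposite, its image is either a ball, on which the labels of level
`m` coincide, or comes from an interval of `T'`, which would also contain an entry between them. -/
theorem Carries.injective_of_not_sepBy {g : Equiv.Perm E} {m : ℕ} {T' : PlanarTree (L m)}
    (hg : 𝕋.Carries g T T') (hT' : T'.IsNested) {q : Fin 4 ↪ E}
    (h : 𝕋.InOrder m T' fun i => g (q i)) (h1 : ¬ SepBy (𝕋.clus n T) (q 0) (q 1) (q 2) (q 3))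
    (h2 : ¬ SepBy (𝕋.clus n T) (q 1) (q 2) (q 0) (q 3)) :
    Function.Injective fun i => 𝕋.tr n (q i) := by
  by_contra hn
  obtain ⟨j, hj, hj0, hj1⟩ := 𝕋.exists_last_level q hn
  obtain ⟨a, b, hab, he⟩ := exists_pair_lt hj0
  have he : 𝕋.tr j (q a) = 𝕋.tr j (q b) := he
  have h3 : ∀ c, c ≠ a → c ≠ b → 𝕋.tr j (q c) ≠ 𝕋.tr j (q a) :=
    fun c h1 h2 => 𝕋.third_notMem hj1 hab.ne h1.symm h2.symm he
  have hC : 𝕋.tr j ⁻¹' {𝕋.tr j (q a)} ∈ 𝕋.clus n T := Or.inl (𝕋.tr_mem_balls hj _)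
  have hmem : ∀ c, q c ∈ 𝕋.tr j ⁻¹' {𝕋.tr j (q a)} ↔ c = a ∨ c = b := by
    intro c
    by_cases ha : c = a
    · simp [ha]
    by_cases hb : c = b
    · simp [hb, he]
    · simpa [ha, hb] using h3 c ha hb
  have hinj := h.injective hT'
  generalize 𝕋.tr j ⁻¹' {𝕋.tr j (q a)} = C at hC hmem
  rcases (hg.clus_iff C).1 hC with ⟨k, hk, w, hw⟩ | ⟨B, hB, hw⟩
  · have hga : g (q a) ∈ g '' C := mem_image_of_mem _ ((hmem a).2 (Or.inl rfl))
    have hgb : g (q b) ∈ g '' C := mem_image_of_mem _ ((hmem b).2 (Or.inr rfl))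
    rw [hw] at hga hgb
    exact hab.ne (hinj (𝕋.tr_eq_of_le hk (Eq.trans hga (Eq.symm hgb))))
  · have hB' : ∀ c, 𝕋.tr m (g (q c)) ∈ B ↔ c = a ∨ c = b := by
      intro c
      rw [← hmem, ← g.injective.mem_set_image, hw, mem_preimage]
    have s1 : [𝕋.tr m (g (q 0)), 𝕋.tr m (g (q 1)), 𝕋.tr m (g (q 2))].Sublist T'.labels :=
      List.Sublist.trans (by simp) h
    have s2 : [𝕋.tr m (g (q 1)), 𝕋.tr m (g (q 2)), 𝕋.tr m (g (q 3))].Sublist T'.labels :=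
      List.Sublist.trans (by simp) h
    have t1 := hT'.mem_of_sublist hB s1
    have t2 := hT'.mem_of_sublist hB s2
    simp only [hB'] at t1 t2
    have u1 := fun h => h1 ⟨C, hC, h⟩
    have u2 := fun h => h2 ⟨C, hC, h⟩
    simp only [hmem] at u1 u2
    clear * - hab t1 t2 u1 u2
    fin_cases a <;> fin_cases b <;> simp at hab t1 t2 u1 u2

/-- Only the positivity conditions need care, since order in `T'` does not imply order in `T` when
entries have the same label at level `n`. Such quadruples are separated by a cluster, and no
positivity is required of them. -/
theorem Carries.mem_endStratum_iff {g : Equiv.Perm E} {m : ℕ} {T' : PlanarTree (L m)}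
    (hg : 𝕋.Carries g T T') (hT' : T'.IsNested) {P : QuadSpace E} :
    act g P ∈ 𝕋.endStratum m T' ↔ P ∈ 𝕋.endStratum n T := by
  unfold endStratum
  refine and_congr IsCurve_act (and_congr ⟨fun h C hC => ?_, fun h C hC => ?_⟩ ⟨?_, ?_⟩)
  · exact isCl_act.1 (h _ ((hg.clus_iff C).1 hC))
  · rw [← image_preimage_eq C g.surjective] at hC ⊢
    exact isCl_act.2 (h _ ((hg.clus_iff _).2 hC))
  · intro h q hq h1 h2
    rw [← act_apply_image g P q]
    refine h _ (hg.inOrder_image hq) ?_ ?_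
    · exact fun h' => h1 ((sepBy_image hg.clus_iff _ _ _ _).1 h')
    · exact fun h' => h2 ((sepBy_image hg.clus_iff _ _ _ _).1 h')
  · intro h q' hq' h1 h2
    obtain ⟨q, rfl⟩ : ∃ q : Fin 4 ↪ E, q' = q.trans g.toEmbedding :=
      ⟨q'.trans g.symm.toEmbedding, by ext; simp⟩
    rw [act_apply_image]
    have h1' := fun h' => h1 ((sepBy_image hg.clus_iff (q 0) (q 1) (q 2) (q 3)).2 h')
    have h2' := fun h' => h2 ((sepBy_image hg.clus_iff (q 1) (q 2) (q 0) (q 3)).2 h')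
    exact h q (hg.inOrder_of_image hq' (hg.injective_of_not_sepBy hT' hq' h1' h2')) h1' h2'

theorem Carries.act_image_endStratum {g : Equiv.Perm E} {m : ℕ} {T' : PlanarTree (L m)}
    (hg : 𝕋.Carries g T T') (hT' : T'.IsNested) :
    act g '' 𝕋.endStratum n T = 𝕋.endStratum m T' := by
  ext P
  constructor
  · rintro ⟨P, hP, rfl⟩
    exact (hg.mem_endStratum_iff hT').2 hP
  · intro hP
    have := act_inv_act g⁻¹ P
    rw [inv_inv] at this
    exact ⟨act g⁻¹ P, (hg.mem_endStratum_iff hT').1 (by rwa [this]), this⟩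

theorem mem_clus_option {C : Set (Option E)} :
    C ∈ 𝕋.option.clus n T.addRoot ↔ C = {none} ∨ ∃ D ∈ 𝕋.clus n T, C = some '' D := by
  constructor
  · rintro (⟨k, hk, w | w, rfl⟩ | ⟨_, ⟨B, hB, rfl⟩, rfl⟩)
    · left
      ext (_ | z) <;> simp [option]
    · refine Or.inr ⟨_, Or.inl (𝕋.tr_mem_balls hk w), ?_⟩
      ext (_ | z) <;> simp [option]
    · refine Or.inr ⟨_, Or.inr ⟨B, hB, rfl⟩, ?_⟩
      ext (_ | z) <;> simp [option]
  · rintro (rfl | ⟨_, ⟨k, hk, w, rfl⟩ | ⟨B, hB, rfl⟩, rfl⟩)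
    · refine Or.inl ⟨n, le_rfl, none, ?_⟩
      ext (_ | z) <;> simp [option]
    · refine Or.inl ⟨k, hk, some w, ?_⟩
      ext (_ | z) <;> simp [option]
    · refine Or.inr ⟨_, ⟨B, hB, rfl⟩, ?_⟩
      ext (_ | z) <;> simp [option]

theorem Carries.option {g : Equiv.Perm E} {m : ℕ} {T' : PlanarTree (L m)}
    (hg : 𝕋.Carries g T T') : 𝕋.option.Carries (Equiv.optionCongr g) T.addRoot T'.addRoot := by
  constructor
  · intro C
    rw [mem_clus_option, mem_clus_option]
    have hi : ∀ D : Set E, Equiv.optionCongr g '' (some '' D) = some '' (g '' D) := fun D => by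
      rw [image_image, image_image]; rfl
    have hn : Equiv.optionCongr g '' {none} = {none} := by simp
    constructor
    · rintro (rfl | ⟨D, hD, rfl⟩)
      · exact Or.inl hn
      · exact Or.inr ⟨_, (hg.clus_iff D).1 hD, hi D⟩
    · have hinj := (Equiv.optionCongr g).injective.image_injective
      rintro (h | ⟨D, hD, h⟩)
      · exact Or.inl (hinj (h.trans hn.symm))
      · refine Or.inr ⟨g ⁻¹' D, (hg.clus_iff _).2 ?_, hinj ?_⟩
        · rwa [image_preimage_eq _ g.surjective]
        · rw [h, hi, image_preimage_eq _ g.surjective]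
  · obtain ⟨π, F, hπ, hl, hF⟩ := hg.exists_labels
    refine ⟨Option.map π, fun w => w.elim [none] fun w => (F w).map some, ?_, ?_, ?_⟩
    · rintro (_ | z)
      · rfl
      · simp [SplitTower.option, hπ]
    · simp only [PlanarTree.addRoot, hl, List.flatMap_cons, Option.elim_none, List.singleton_append,
        List.map_flatMap, List.flatMap_map, Option.elim_some]
    · rintro (_ | x) (_ | w) <;> simp [hF]

end SplitTower

/-! ### Group actions on inductive limits -/

namespace SeqColimit

variable {X : ℕ → Type} {f : ∀ n, X n → X (n + 1)} {Y : Type}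

theorem ι_succ (n : ℕ) (x : X n) : (ι (n + 1) (f n x) : SeqColimit X f) = ι n x :=
  (Quot.sound (r := fun a b : Σ n, X n => b = ⟨a.1 + 1, f a.1 a.2⟩) (a := ⟨n, x⟩) rfl).symm

theorem exists_ι (z : SeqColimit X f) : ∃ n x, z = ι n x := by
  induction z using Quot.ind with
  | mk a => exact ⟨a.1, a.2, rfl⟩

theorem exists_ι_eq_of_le {n m : ℕ} (h : n ≤ m) (x : X n) :
    ∃ x' : X m, (ι m x' : SeqColimit X f) = ι n x := by
  induction m, h using Nat.le_induction with
  | base => exact ⟨x, rfl⟩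
  | succ m _ ih =>
    obtain ⟨x', hx'⟩ := ih
    exact ⟨f m x', by rw [ι_succ, hx']⟩

/-- The map defined on an inductive limit by a compatible family of maps. -/
def desc (Φ : ∀ n, X n → Y) (hΦ : ∀ n x, Φ (n + 1) (f n x) = Φ n x) : SeqColimit X f → Y :=
  Quot.lift (fun a => Φ a.1 a.2) fun a b hab => by subst hab; exact (hΦ a.1 a.2).symm

variable {Φ : ∀ n, X n → Y} {hΦ : ∀ n x, Φ (n + 1) (f n x) = Φ n x}

theorem desc_injective (hinj : ∀ n, Function.Injective (Φ n)) :
    Function.Injective (desc Φ hΦ) := by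
  intro a b hab
  obtain ⟨n, x, rfl⟩ := exists_ι a
  obtain ⟨m, y, rfl⟩ := exists_ι b
  obtain ⟨x', hx⟩ := exists_ι_eq_of_le (f := f) (le_max_left n m) x
  obtain ⟨y', hy⟩ := exists_ι_eq_of_le (f := f) (le_max_right n m) y
  rw [← hx, ← hy] at hab ⊢
  exact congrArg _ (hinj _ hab)

variable [∀ n, TopologicalSpace (X n)]

theorem continuous_ι (n : ℕ) : Continuous (ι n : X n → SeqColimit X f) :=
  continuous_quot_mk.comp (continuous_sigmaMk (σ := X))

theorem continuous_of_ι {Z : Type} [TopologicalSpace Z] {φ : SeqColimit X f → Z}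
    (h : ∀ n, Continuous fun x : X n => φ (ι n x)) : Continuous φ :=
  continuous_quot_lift (f := fun a : Σ n, X n => φ (ι a.1 a.2))
    (fun a b hab => by subst hab; exact congrArg φ (ι_succ a.1 a.2).symm)
    (continuous_sigma fun n => h n) |>.congr fun z => by
      induction z using Quot.ind; rfl

/-- `Y` carries no topology: it only contains the inductive limit as a set, so that the group law is
inherited from `ρ`. Continuity is checked level by level, the maps `k` being allowed to change the
level. -/
theorem exists_action {G : Type} [Group G] (ρ : G →* Equiv.Perm Y)
    (hinj : ∀ n, Function.Injective (Φ n))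
    (h : ∀ g n, ∃ m, ∃ k : X n → X m, Continuous k ∧ ∀ x, Φ m (k x) = ρ g (Φ n x)) :
    ∃ γ : G →* (SeqColimit X f ≃ₜ SeqColimit X f),
      ∀ g z, desc Φ hΦ (γ g z) = ρ g (desc Φ hΦ z) := by
  have hex : ∀ g (z : SeqColimit X f), ∃ z', desc Φ hΦ z' = ρ g (desc Φ hΦ z) := by
    intro g z
    obtain ⟨n, x, rfl⟩ := exists_ι z
    obtain ⟨m, k, -, hk⟩ := h g n
    exact ⟨ι m (k x), hk x⟩
  choose a ha using hex
  have hi := desc_injective (hΦ := hΦ) hinj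
  have hmul : ∀ g g' z, a (g * g') z = a g (a g' z) := fun g g' z =>
    hi (by rw [ha, ha, ha, map_mul, Equiv.Perm.mul_apply])
  have hone : ∀ z, a 1 z = z := fun z => hi (by rw [ha, map_one, Equiv.Perm.one_apply])
  have hc : ∀ g, Continuous (a g) := by
    intro g
    refine continuous_of_ι fun n => ?_
    obtain ⟨m, k, hkc, hk⟩ := h g n
    refine ((continuous_ι m).comp hkc).congr fun x => hi ?_
    rw [ha]
    exact hk x
  let γ : G → (SeqColimit X f ≃ₜ SeqColimit X f) := fun g =>
    { toFun := a g
      invFun := a g⁻¹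
      left_inv := fun z => by rw [← hmul, inv_mul_cancel, hone]
      right_inv := fun z => by rw [← hmul, mul_inv_cancel, hone]
      continuous_toFun := hc g
      continuous_invFun := hc g⁻¹ }
  exact ⟨⟨⟨γ, Homeomorph.ext hone⟩, fun g g' => Homeomorph.ext (hmul g g')⟩, fun g z => ha g z⟩

/-- A faithful group action on an inductive limit, which permutes the strata in a prescribed way. -/
theorem exists_cellular_action {G : Type} [Group G] (ρ : G →* Equiv.Perm Y)
    (hinj : ∀ n, Function.Injective (Φ n))
    (h : ∀ g n, ∃ m, ∃ k : X n → X m, Continuous k ∧ ∀ x, Φ m (k x) = ρ g (Φ n x))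
    (hfaith : ∀ g, (∀ z, ρ g (desc Φ hΦ z) = desc Φ hΦ z) → g = 1)
    {S : ℕ → Set (Set (SeqColimit X f))}
    {Acts : G → Set (SeqColimit X f) → Set (SeqColimit X f) → Prop}
    (hacts : ∀ g s s', Acts g s s' → ρ g '' (desc Φ hΦ '' s) = desc Φ hΦ '' s')
    (hex : ∀ g d, ∀ s ∈ S d, ∃ s' ∈ S d, Acts g s s') :
    (∀ g, ∀ s ∈ ⋃ d, S d, ∃! s', Acts g s s') ∧
      ∃ γ : G →* HomeoCell S, Function.Injective γ ∧
        ∀ g s s', Acts g s s' → (γ g : SeqColimit X f ≃ₜ SeqColimit X f) '' s = s' := by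
  obtain ⟨γ, hγ⟩ := exists_action (hΦ := hΦ) ρ hinj h
  have hi := desc_injective (hΦ := hΦ) hinj
  have key : ∀ g s s', Acts g s s' → γ g '' s = s' := by
    intro g s s' hs
    refine hi.image_injective ?_
    rw [← hacts g s s' hs, image_image, image_image]
    simp only [hγ]
  have hS : ∀ g d s, s ∈ S d → γ g '' s ∈ S d := by
    intro g d s hs
    obtain ⟨s', hs', ha⟩ := hex g d s hs
    rwa [key g s s' ha]
  have hcell : ∀ g, γ g ∈ HomeoCell S := by
    intro g d s
    refine ⟨fun hs => ?_, hS g d s⟩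
    have h1 := hS g⁻¹ d _ hs
    rw [image_image] at h1
    have h2 : ∀ x, γ g⁻¹ (γ g x) = x := fun x => by
      change (γ g⁻¹ * γ g) x = x
      rw [← map_mul, inv_mul_cancel, map_one]
      rfl
    simpa only [h2, image_id'] using h1
  refine ⟨fun g s hs => ?_, γ.codRestrict _ hcell, ?_, key⟩
  · obtain ⟨d, hd⟩ := mem_iUnion.1 hs
    obtain ⟨s', -, ha⟩ := hex g d s hd
    exact ⟨s', ha, fun t ht => by rw [← key g s t ht, key g s s' ha]⟩
  · rw [injective_iff_map_eq_one]
    intro g hg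
    refine hfaith g fun z => ?_
    have h1 : γ g = 1 := congrArg Subtype.val hg
    rw [← hγ, h1]
    rfl

end SeqColimit

/-! ### The tower of the ends of the dyadic tree -/

section Ends

variable {R : Type}

theorem Label.vertex_length {n : ℕ} (w : Label R n) : w.vertex.2.length = n := by
  simp [Label.vertex]

theorem Label.vertex_injective {n : ℕ} : Function.Injective (Label.vertex : Label R n → Vertex R) :=
  fun _ _ h => Prod.ext (Prod.ext_iff.1 h).1 (List.ofFn_injective (Prod.ext_iff.1 h).2)

/-- The label of a vertex of depth `n`. -/
def toLabel (n : ℕ) (u : Vertex R) : Label R n := (u.1, fun i => u.2.getD i false)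

theorem vertex_toLabel {n : ℕ} {u : Vertex R} (h : u.2.length = n) : (toLabel n u).vertex = u := by
  subst h
  refine Prod.ext rfl ?_
  refine List.ext_getElem (by simp [Label.vertex, toLabel]) fun i h1 h2 => ?_
  simp [Label.vertex, toLabel]

theorem toLabel_vertex {n : ℕ} (w : Label R n) : toLabel n w.vertex = w :=
  Label.vertex_injective (vertex_toLabel w.vertex_length)

/-- The label of level `n` above an end. -/
def trunc (n : ℕ) (z : End R) : Label R n := (z.1, fun i => z.2.get i)

theorem ofFn_get (z : Stream' Bool) (n : ℕ) : List.ofFn (fun i : Fin n => z.get i) = z.take n := by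
  refine List.ext_getElem (by simp) fun i h1 h2 => ?_
  simp

theorem vertex_trunc (n : ℕ) (z : End R) : (trunc n z).vertex = (z.1, z.2.take n) :=
  Prod.ext rfl (ofFn_get z.2 n)

theorem Label.isAbove_iff {n : ℕ} (w : Label R n) (z : End R) :
    w.vertex.IsAbove z ↔ trunc n z = w := by
  constructor
  · rintro ⟨h1, h2⟩
    refine Label.vertex_injective ?_
    rw [vertex_trunc]
    rw [w.vertex_length] at h2
    exact Prod.ext h1.symm h2
  · rintro rfl
    refine ⟨rfl, ?_⟩
    rw [Label.vertex_length, vertex_trunc]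

/-- An end below a vertex. -/
def someEnd (u : Vertex R) : End R := (u.1, u.2 ++ₛ Stream'.const false)

theorem isAbove_someEnd (u : Vertex R) : u.IsAbove (someEnd u) := ⟨rfl, take_append_stream_self _ _⟩

theorem Vertex.IsAbove.exists_eq {u : Vertex R} {z : End R} (h : u.IsAbove z) :
    ∃ x, z = (u.1, u.2 ++ₛ x) :=
  ⟨z.2.drop u.2.length, Prod.ext h.1.symm (eq_append_of_take h.2).symm⟩

theorem Vertex.Le.isAbove {u v : Vertex R} (h : u.Le v) {z : End R} (hv : v.IsAbove z) :
    u.IsAbove z := by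
  refine ⟨h.1.trans hv.1, ?_⟩
  have h1 := take_isPrefix z.2 h.2.length_le
  rw [show z.2.take v.2.length = v.2 from hv.2] at h1
  exact (List.prefix_of_prefix_length_le h1 h.2 (by simp)).eq_of_length (by simp)

theorem Vertex.IsAbove.le {u v : Vertex R} {z : End R} (hu : u.IsAbove z) (hv : v.IsAbove z)
    (h : u.2.length ≤ v.2.length) : u.Le v := by
  refine ⟨hu.1.trans hv.1.symm, ?_⟩
  rw [← show z.2.take v.2.length = v.2 from hv.2, ← show z.2.take u.2.length = u.2 from hu.2]
  exact take_isPrefix _ h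

theorem Vertex.isAbove_iff_le {u : Vertex R} {m : ℕ} (h : u.2.length ≤ m) (z : End R) :
    u.IsAbove z ↔ u.Le (trunc m z).vertex := by
  have h1 : (trunc m z).vertex.IsAbove z := ((trunc m z).isAbove_iff z).2 rfl
  exact ⟨fun hu => hu.le h1 (by rwa [Label.vertex_length]), fun hu => hu.isAbove h1⟩

/-- The ends below a vertex. -/
def ball (u : Vertex R) : Set (End R) := {z | u.IsAbove z}

theorem ball_vertex {n : ℕ} (w : Label R n) : ball w.vertex = trunc n ⁻¹' {w} :=
  Set.ext fun z => w.isAbove_iff z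

theorem trunc_someEnd {n : ℕ} (w : Label R n) : trunc n (someEnd w.vertex) = w :=
  (w.isAbove_iff _).1 (isAbove_someEnd _)

variable (R) in
/-- The tower of the ends of the dyadic tree. -/
def endTower [Finite R] : SplitTower (End R) (Label R) where
  f n w := (Label.split R n w).1
  tr := trunc
  sec n w := someEnd w.vertex
  finite n := inferInstance
  fibre n := fibre_le_two (Label.split R n)
  f_tr n z := rfl
  tr_sec n w := trunc_someEnd w
  separates z z' h := by
    refine Prod.ext (Prod.ext_iff.1 (h 0)).1 (Stream'.ext fun i => ?_)
    exact congrFun (Prod.ext_iff.1 (h (i + 1))).2 ⟨i, i.lt_succ_self⟩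

theorem mem_balls_iff [Finite R] {n : ℕ} {C : Set (End R)} :
    C ∈ (endTower R).balls n ↔ ∃ u : Vertex R, n ≤ u.2.length ∧ C = ball u := by
  constructor
  · rintro ⟨k, hk, w, rfl⟩
    exact ⟨w.vertex, by rwa [w.vertex_length], (ball_vertex w).symm⟩
  · rintro ⟨u, hu, rfl⟩
    refine ⟨_, hu, toLabel _ u, ?_⟩
    change _ = trunc _ ⁻¹' _
    rw [← ball_vertex, vertex_toLabel rfl]

theorem ball_eq_preimage {u : Vertex R} {m : ℕ} (h : u.2.length ≤ m) :
    ball u = trunc m ⁻¹' {v | u.Le v.vertex} := Set.ext fun z => u.isAbove_iff_le h z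

theorem mem_words {k : ℕ} {u : List Bool} : u ∈ words k ↔ u.length = k := by
  induction k generalizing u with
  | zero => simp [words]
  | succ k ih =>
    rcases u with _ | ⟨_ | _, u⟩ <;> simp [words, ih]

end Ends

/-! ### Symbols act on balls -/

namespace TreeSymbol

variable {R : Type} {s : TreeSymbol R} {g : Equiv.Perm (End R)}

theorem _root_.ModularTower.TreeAut.apply_nil (a : TreeAut) : a.toEquiv [] = [] :=
  List.length_eq_zero_iff.1 (by rw [a.length_eq]; rfl)

theorem Represents.isAbove (h : s.Represents g) {e : Vertex R} (he : e ∈ s.source.leaves) {z : End R}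
    (hz : e.IsAbove z) : (s.σ e).IsAbove (g z) := by
  obtain ⟨x, rfl⟩ := hz.exists_eq
  have h1 := h e he x
  refine ⟨h1.1.symm, ?_⟩
  simpa [TreeAut.apply_nil] using h1.2 0

theorem Represents.isAbove_iff (h : s.Represents g) {e : Vertex R} (he : e ∈ s.source.leaves)
    {z : End R} : (s.σ e).IsAbove (g z) ↔ e.IsAbove z := by
  refine ⟨fun hz => ?_, h.isAbove he⟩
  obtain ⟨e', ⟨he', hz'⟩, -⟩ := s.source.existsUnique z
  have := (s.target.existsUnique (g z)).unique ⟨s.bijOn.mapsTo he, hz⟩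
    ⟨s.bijOn.mapsTo he', h.isAbove he' hz'⟩
  rwa [s.bijOn.injOn he he' this]

/-- After the prefix `σ(e)`, the next letters of the image of `e⌢x` are the image under `q e` of as
many letters of `x`; since `q e` is injective, they are those of `(q e) w` only when `x` begins with
`w`. -/
theorem Represents.image_ball (h : s.Represents g) {e : Vertex R} (he : e ∈ s.source.leaves)
    (w : List Bool) : g '' ball (e.1, e.2 ++ w) =
      ball ((s.σ e).1, (s.σ e).2 ++ (s.q e).toEquiv w) := by
  have key : ∀ x, ball ((s.σ e).1, (s.σ e).2 ++ (s.q e).toEquiv w) (g (e.1, e.2 ++ₛ x)) ↔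
      x.take w.length = w := by
    intro x
    have h1 := h e he x
    change _ ∧ Stream'.take ((s.σ e).2 ++ (s.q e).toEquiv w).length _ = _ ↔ _
    rw [List.length_append, (s.q e).length_eq, h1.2]
    simp [h1.1]
  have key' : ∀ x, ball (e.1, e.2 ++ w) (e.1, e.2 ++ₛ x) ↔ x.take w.length = w := by
    intro x
    change _ ∧ Stream'.take (e.2 ++ w).length _ = _ ↔ _
    rw [List.length_append, take_append_stream]
    simp
  have hle : Vertex.Le e (e.1, e.2 ++ w) := ⟨rfl, List.prefix_append _ _⟩
  have hle' : Vertex.Le (s.σ e) ((s.σ e).1, (s.σ e).2 ++ (s.q e).toEquiv w) :=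
    ⟨rfl, List.prefix_append _ _⟩
  ext z
  constructor
  · rintro ⟨z, hz, rfl⟩
    obtain ⟨x, rfl⟩ := (hle.isAbove hz).exists_eq
    exact (key x).2 ((key' x).1 hz)
  · intro hz
    obtain ⟨z, rfl⟩ := g.surjective z
    obtain ⟨x, rfl⟩ := ((h.isAbove_iff he).1 (hle'.isAbove hz)).exists_eq
    exact mem_image_of_mem _ ((key' x).2 ((key x).1 hz))

variable {n : ℕ}

theorem mem_source (hs : s.source.leaves = {u | u.2.length = n}) (w : Label R n) :
    w.vertex ∈ s.source.leaves := by
  rw [hs]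
  exact w.vertex_length

theorem Represents.isAbove_vertex_iff (h : s.Represents g)
    (hs : s.source.leaves = {u | u.2.length = n}) (w : Label R n) (z : End R) :
    (s.σ w.vertex).IsAbove (g z) ↔ trunc n z = w := by
  rw [h.isAbove_iff (mem_source hs w), w.isAbove_iff]

theorem Represents.image_ball_of_le (h : s.Represents g)
    (hs : s.source.leaves = {u | u.2.length = n}) {u : Vertex R} (hu : n ≤ u.2.length) :
    ∃ u', (∃ f ∈ s.target.leaves, f.Le u') ∧ g '' ball u = ball u' := by
  have he : ((u.1, u.2.take n) : Vertex R) ∈ s.source.leaves := by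
    rw [hs]
    simp [hu]
  have := h.image_ball he (u.2.drop n)
  rw [show ((u.1, u.2.take n ++ u.2.drop n) : Vertex R) = u by simp] at this
  refine ⟨_, ?_, this⟩
  exact ⟨_, s.bijOn.mapsTo he, rfl, List.prefix_append _ _⟩

theorem Represents.exists_image_ball (h : s.Represents g)
    (hs : s.source.leaves = {u | u.2.length = n}) {f u : Vertex R} (hf : f ∈ s.target.leaves)
    (hu : f.Le u) : ∃ u', n ≤ u'.2.length ∧ g '' ball u' = ball u := by
  obtain ⟨e, he, rfl⟩ := s.bijOn.surjOn hf
  obtain ⟨h1, w, hw⟩ := hu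
  refine ⟨(e.1, e.2 ++ (s.q e).toEquiv.symm w), ?_, ?_⟩
  · rw [hs] at he
    have : e.2.length = n := he
    simp [this]
  · rw [h.image_ball he, Equiv.apply_symm_apply, hw, h1]

theorem exists_target_le {m : ℕ} (hm : ∀ f ∈ s.target.leaves, f.2.length ≤ m) {u : Vertex R}
    (hu : m ≤ u.2.length) : ∃ f ∈ s.target.leaves, f.Le u := by
  obtain ⟨f, ⟨hf, hfz⟩, -⟩ := s.target.existsUnique (someEnd u)
  exact ⟨f, hf, hfz.le (isAbove_someEnd u) ((hm f hf).trans hu)⟩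

/-- A vertex of depth at least `m` lies below some target leaf, and the vertices below the target
leaves correspond to those below the source leaves. -/
theorem Represents.preimage_ball [Finite R] (h : s.Represents g)
    (hs : s.source.leaves = {u | u.2.length = n}) {m : ℕ}
    (hm : ∀ f ∈ s.target.leaves, f.2.length ≤ m) {C : Set (End R)} (hC : C ∈ (endTower R).balls m) :
    g ⁻¹' C ∈ (endTower R).balls n := by
  obtain ⟨u, hu, rfl⟩ := mem_balls_iff.1 hC
  obtain ⟨f, hf, hfu⟩ := exists_target_le hm hu
  obtain ⟨u', hu', h'⟩ := h.exists_image_ball hs hf hfu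
  rw [← h', preimage_image_eq _ g.injective]
  exact mem_balls_iff.2 ⟨u', hu', rfl⟩

/-- Composition with a symbol of `g`, followed by expansion, transports the strata as `g` does. -/
theorem Represents.carries [Finite R] (h : s.Represents g) {m : ℕ} {T : PlanarTree (Label R n)}
    {T' : PlanarTree (Label R m)} (hT : s.ComposeExpand T T') : (endTower R).Carries g T T' := by
  obtain ⟨hs, hm, hl, hc⟩ := hT
  have hσm : ∀ w : Label R n, (s.σ w.vertex).2.length ≤ m := fun w =>
    hm _ (s.bijOn.mapsTo (mem_source hs w))
  have hB : ∀ B : Set (Label R n), g '' (trunc n ⁻¹' B) =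
      trunc m ⁻¹' {v | ∃ w ∈ B, (s.σ w.vertex).Le v.vertex} := by
    intro B
    ext z
    obtain ⟨z, rfl⟩ := g.surjective z
    rw [g.injective.mem_set_image]
    simp only [mem_preimage, mem_ofPred_eq, ← Vertex.isAbove_iff_le (hσm _),
      h.isAbove_vertex_iff hs]
    exact ⟨fun hz => ⟨_, hz, rfl⟩, fun ⟨w, hw, e⟩ => e ▸ hw⟩
  have hinj := g.injective.image_injective
  constructor
  · intro C
    constructor
    · rintro (hC | ⟨B, hB', rfl⟩)
      · obtain ⟨u, hu, rfl⟩ := mem_balls_iff.1 hC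
        obtain ⟨u', hfu, he⟩ := h.image_ball_of_le hs hu
        rw [he]
        -- An image vertex of depth less than `m` is one of the internal vertices created by the
        -- expansion; a deeper one gives a ball of level at least `m`.
        by_cases hu' : m ≤ u'.2.length
        · exact Or.inl (mem_balls_iff.2 ⟨u', hu', rfl⟩)
        · refine Or.inr ⟨_, ?_, ball_eq_preimage (not_le.1 hu').le⟩
          rw [hc]
          exact Or.inr ⟨u', hfu, not_le.1 hu', rfl⟩
      · refine Or.inr ⟨_, ?_, hB B⟩
        rw [hc]
        exact Or.inl ⟨B, hB', rfl⟩
    · have hball : ∀ u : Vertex R, (∃ f ∈ s.target.leaves, f.Le u) → g '' C = ball u →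
          C ∈ (endTower R).clus n T := by
        rintro u ⟨f, hf, hfu⟩ he
        obtain ⟨u', hu', h'⟩ := h.exists_image_ball hs hf hfu
        rw [hinj (he.trans h'.symm)]
        exact Or.inl (mem_balls_iff.2 ⟨u', hu', rfl⟩)
      rintro (hC | ⟨B', hB', he⟩)
      · obtain ⟨u, hu, he⟩ := mem_balls_iff.1 hC
        exact hball u (exists_target_le hm hu) he
      · rw [hc] at hB'
        rcases hB' with ⟨B, hB'', rfl⟩ | ⟨u, hfu, hu, rfl⟩
        · exact Or.inr ⟨B, hB'', hinj (he.trans (hB B).symm)⟩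
        · exact hball u hfu (he.trans (ball_eq_preimage hu.le).symm)
  -- A label `v` of level `m` lies below a unique target leaf, so all the ends below `v` have
  -- preimages with the same label of level `n`; any of them serves to define `π`.
  · refine ⟨fun v => trunc n (g.symm (someEnd v.vertex)), fun w =>
      (words (m - (s.σ w.vertex).2.length)).map fun u =>
        toLabel m ((s.σ w.vertex).1, (s.σ w.vertex).2 ++ u), fun z => ?_, ?_, fun x w => ?_⟩
    · change trunc n (g.symm (someEnd (trunc m (g z)).vertex)) = trunc n z
      rw [← h.isAbove_vertex_iff hs, Equiv.apply_symm_apply, Vertex.isAbove_iff_le (hσm _),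
        trunc_someEnd, ← Vertex.isAbove_iff_le (hσm _), h.isAbove_vertex_iff hs]
    · refine Label.vertex_injective.list_map ?_
      rw [hl, List.map_flatMap]
      congr 1
      funext w
      rw [List.map_map]
      refine List.map_congr_left fun u hu => ?_
      rw [mem_words] at hu
      refine (vertex_toLabel ?_).symm
      have := hσm w
      simp only [List.length_append, hu]
      omega
    · rw [← h.isAbove_vertex_iff hs, Equiv.apply_symm_apply, Vertex.isAbove_iff_le (hσm _),
        trunc_someEnd]
      have hw := hσm w
      constructor
      · intro hx
        obtain ⟨u, hu, rfl⟩ := List.mem_map.1 hx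
        rw [mem_words] at hu
        rw [vertex_toLabel (by simp only [List.length_append, hu]; omega)]
        exact ⟨rfl, List.prefix_append _ _⟩
      · rintro ⟨h1, u, hu⟩
        refine List.mem_map.2 ⟨u, mem_words.2 ?_, ?_⟩
        · have h2 := congrArg List.length hu
          rw [List.length_append, x.vertex_length] at h2
          omega
        · rw [hu, h1]
          exact toLabel_vertex x

end TreeSymbol

/-- An element of the spheromorphism group is represented by symbols with source the complete tree
of any sufficiently large depth. -/
theorem exists_symbol_of_mem {R : Type} [Finite R] {g : Equiv.Perm (End R)}
    (hg : g ∈ spheromorphismGroup R) : ∃ N, ∀ n ≥ N, ∃ s : TreeSymbol R, s.Represents g ∧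
      s.source.leaves = {u | u.2.length = n} := by
  obtain ⟨s, hs⟩ := hg
  obtain ⟨N, hN⟩ := locallySphero_of_symbol (Q := Set.univ) (fun _ _ _ => trivial)
    (fun _ _ => trivial) hs
  refine ⟨N, fun n hn => ?_⟩
  have : LocallySphero Set.univ n g := by
    intro u hu
    obtain ⟨v, a, ha, h1, h2⟩ := hN u (hn.trans hu)
    exact ⟨v, a, ha, by omega, h2⟩
  obtain ⟨t, -, ht, ht'⟩ := exists_symbol_of_locallySphero this
  exact ⟨t, ht, ht'⟩

theorem TreeSymbol.exists_bound {R : Type} (s : TreeSymbol R) :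
    ∃ m, ∀ f ∈ s.target.leaves, f.2.length ≤ m := by
  obtain ⟨m, hm⟩ := (s.target.finite.image fun e => e.2.length).bddAbove
  exact ⟨m, fun f hf => hm ⟨f, hf, rfl⟩⟩

/-! ### Grafting subtrees on the leaves of a planar tree -/

namespace PlanarTree

variable {I J : Type}

theorem ncard_setOf_mem {l : List I} (hl : l.Nodup) : {i | i ∈ l}.ncard = l.length := by
  classical
  rw [← List.coe_toFinset, Set.ncard_coe_finset, List.toFinset_card_of_nodup hl]

theorem IsNested.length_eq {T : PlanarTree I} (hT : T.IsNested) : T.labels.length = Nat.card I := by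
  rw [← ncard_setOf_mem hT.1, ← Set.ncard_univ]
  congr 1
  exact Set.eq_univ_of_forall hT.2.1

theorem ncard_add_two_le_iff [Finite I] {A : Set I} :
    A.ncard + 2 ≤ Nat.card I ↔ ∃ x y, x ≠ y ∧ x ∉ A ∧ y ∉ A := by
  rw [← Set.ncard_add_ncard_compl A, Nat.add_le_add_iff_left]
  change 1 < _ ↔ _
  rw [Set.one_lt_ncard_iff]
  exact ⟨fun ⟨a, b, ha, hb, h⟩ => ⟨a, b, h, ha, hb⟩, fun ⟨a, b, h, ha, hb⟩ => ⟨a, b, ha, hb, h⟩⟩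

/-- Subtrees with leaves labelled by the fibres of `π : J → I`, given by the lists of their leaves
and by the clusters of their internal vertices (including the root). -/
structure Subtrees (π : J → I) (F : I → List J) (N : I → Set (Set J)) : Prop where
  mem_iff : ∀ x w, x ∈ F w ↔ π x = w
  nodup : ∀ w, (F w).Nodup
  interval : ∀ w, ∀ A ∈ N w, (∃ l, l <:+: F w ∧ A = {i | i ∈ l}) ∧ 2 ≤ A.ncard
  nested : ∀ w, ∀ A ∈ N w, ∀ B ∈ N w, A ⊆ B ∨ B ⊆ A ∨ Disjoint A B
  card : ∀ w, (N w).ncard + 1 = (F w).length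

/-- Replacing each leaf of a planar tree by a subtree. -/
def graft (T : PlanarTree I) (π : J → I) (F : I → List J) (N : I → Set (Set J)) : PlanarTree J where
  labels := T.labels.flatMap F
  clusters := {A | ∃ B ∈ T.clusters, A = π ⁻¹' B} ∪ {A | ∃ w, A ∈ N w}

variable {π : J → I} {F : I → List J} {N : I → Set (Set J)} {T : PlanarTree I}

theorem Subtrees.surjective (h : Subtrees π F N) : Function.Surjective π := by
  intro w
  obtain ⟨x, hx⟩ := List.exists_mem_of_length_pos (by rw [← h.card w]; omega : 0 < (F w).length)
  exact ⟨x, (h.mem_iff x w).1 hx⟩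

theorem Subtrees.subset (h : Subtrees π F N) {w : I} {A : Set J} (hA : A ∈ N w) : A ⊆ π ⁻¹' {w} := by
  obtain ⟨⟨l, hl, rfl⟩, -⟩ := h.interval w A hA
  exact fun x hx => (h.mem_iff x w).1 (hl.subset hx)

theorem preimage_two_le [Finite J] (hπ : Function.Surjective π) {B : Set I} (hB : 2 ≤ B.ncard) :
    2 ≤ (π ⁻¹' B).ncard := by
  refine hB.trans ?_
  conv_lhs => rw [← Set.image_preimage_eq B hπ]
  exact Set.ncard_image_le (Set.toFinite _)

theorem IsNested.graft [Finite J] (hT : T.IsNested) (h : Subtrees π F N) :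
    (T.graft π F N).IsNested := by
  refine ⟨?_, ?_, ?_, ?_⟩
  · refine List.nodup_flatMap.2 ⟨fun w _ => h.nodup w, hT.1.imp ?_⟩
    intro a b hab x hxa hxb
    exact hab (((h.mem_iff x a).1 hxa).symm.trans ((h.mem_iff x b).1 hxb))
  · intro x
    exact List.mem_flatMap.2 ⟨π x, hT.2.1 _, (h.mem_iff _ _).2 rfl⟩
  · rintro _ (⟨B, hB, rfl⟩ | ⟨w, hA⟩)
    · obtain ⟨⟨l, hl, rfl⟩, h2⟩ := hT.2.2.1 B hB
      refine ⟨⟨l.flatMap F, ?_, ?_⟩, preimage_two_le h.surjective h2⟩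
      · obtain ⟨s, t, hst⟩ := hl
        exact ⟨s.flatMap F, t.flatMap F, by
          rw [← List.flatMap_append, ← List.flatMap_append, hst]; rfl⟩
      · ext x
        simp [h.mem_iff]
    · obtain ⟨⟨l, hl, rfl⟩, h2⟩ := h.interval w _ hA
      refine ⟨⟨l, hl.trans ?_, rfl⟩, h2⟩
      obtain ⟨s, t, hst⟩ := List.append_of_mem (hT.2.1 w)
      exact ⟨s.flatMap F, t.flatMap F, by
        change _ = T.labels.flatMap F
        rw [hst, List.flatMap_append, List.flatMap_cons, List.append_assoc]⟩
  · have key : ∀ B ∈ T.clusters, ∀ w, ∀ A ∈ N w, A ⊆ π ⁻¹' B ∨ Disjoint A (π ⁻¹' B) := by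
      intro B _ w A hA
      by_cases hw : w ∈ B
      · exact Or.inl fun x hx => by rw [mem_preimage, h.subset hA hx]; exact hw
      · refine Or.inr (Set.disjoint_left.2 fun x hx hxB => hw ?_)
        rwa [mem_preimage, h.subset hA hx] at hxB
    rintro _ (⟨B, hB, rfl⟩ | ⟨w, hA⟩) _ (⟨B', hB', rfl⟩ | ⟨w', hA'⟩)
    · rcases hT.2.2.2 B hB B' hB' with h1 | h1 | h1
      · exact Or.inl (preimage_mono h1)
      · exact Or.inr (Or.inl (preimage_mono h1))
      · exact Or.inr (Or.inr (h1.preimage π))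
    · rcases key B hB w' _ hA' with h1 | h1
      · exact Or.inr (Or.inl h1)
      · exact Or.inr (Or.inr h1.symm)
    · rcases key B' hB' w _ hA with h1 | h1
      · exact Or.inl h1
      · exact Or.inr (Or.inr h1)
    · by_cases hw : w = w'
      · subst hw
        exact h.nested w _ hA _ hA'
      · refine Or.inr (Or.inr (Set.disjoint_left.2 fun x hx hx' => hw ?_))
        exact (Eq.symm (h.subset hA hx)).trans (h.subset hA' hx')

/-- Grafting a binary subtree with `k` leaves adds `k - 1` leaves and `k - 1` internal edges, hence
does not change the dimension of the stratum. -/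
theorem graft_count [Finite I] [Finite J] (hT : T.IsNested) (h : Subtrees π F N) :
    (T.graft π F N).labels.length + T.clusters.ncard =
      T.labels.length + (T.graft π F N).clusters.ncard := by
  classical
  have := Fintype.ofFinite I
  have hd : ∀ w w', w ≠ w' → Disjoint (N w) (N w') := by
    intro w w' hw
    refine Set.disjoint_left.2 fun A hA hA' => hw ?_
    obtain ⟨x, hx⟩ := Set.nonempty_of_ncard_ne_zero
      (by have := (h.interval w A hA).2; omega : A.ncard ≠ 0)
    exact (Eq.symm (h.subset hA hx)).trans (h.subset hA' hx)
  have h1 : {A | ∃ w, A ∈ N w}.ncard = ∑ w, (N w).ncard := by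
    have hU : {A | ∃ w, A ∈ N w} = ⋃ w, N w := by ext; simp
    rw [hU, ← Nat.card_coe_set_eq, Nat.card_congr (Set.unionEqSigmaOfDisjoint hd), Nat.card_sigma]
    rfl
  have h2 : {A | ∃ B ∈ T.clusters, A = π ⁻¹' B}.ncard = T.clusters.ncard := by
    rw [show {A | ∃ B ∈ T.clusters, A = π ⁻¹' B} = (fun B => π ⁻¹' B) '' T.clusters by
      ext A; simp [eq_comm]]
    exact Set.ncard_image_of_injective _ h.surjective.preimage_injective
  -- A cluster of `T` contains at least two labels, whereas a cluster of a subtree lies over a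
  -- single one.
  have h3 : Disjoint {A | ∃ B ∈ T.clusters, A = π ⁻¹' B} {A | ∃ w, A ∈ N w} := by
    refine Set.disjoint_left.2 ?_
    rintro _ ⟨B, hB, rfl⟩ ⟨w, hA⟩
    have h4 := (hT.2.2.1 B hB).2
    have h5 : B ⊆ {w} := by
      rw [← Set.preimage_subset_preimage_iff (f := π) (by simp [h.surjective.range_eq])]
      exact h.subset hA
    have := Set.ncard_le_ncard h5
    rw [Set.ncard_singleton] at this
    omega
  have h4 : (T.graft π F N).labels.length = ∑ w, (F w).length := by
    change (T.labels.flatMap F).length = _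
    rw [List.length_flatMap, ← List.sum_toFinset _ hT.1]
    congr 1
    exact Finset.eq_univ_iff_forall.2 fun w => by simpa using hT.2.1 w
  have h5 : (T.graft π F N).clusters.ncard = T.clusters.ncard + ∑ w, (N w).ncard := by
    change ({A | ∃ B ∈ T.clusters, A = π ⁻¹' B} ∪ {A | ∃ w, A ∈ N w}).ncard = _
    rw [Set.ncard_union_eq h3, h1, h2]
  rw [h4, h5, hT.length_eq, Nat.card_eq_fintype_card]
  simp only [← h.card, Finset.sum_add_distrib, Finset.sum_const, Finset.card_univ]
  simp only [smul_eq_mul, mul_one]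
  omega

theorem length_le_graft [Finite J] (hT : T.IsNested) (h : Subtrees π F N) :
    T.labels.length ≤ (T.graft π F N).labels.length := by
  rw [hT.length_eq, (hT.graft h).length_eq]
  exact Nat.card_le_card_of_surjective π h.surjective

theorem graft_cluster_subset (h : Subtrees π F N) {A : Set J} (hA : A ∈ (T.graft π F N).clusters) :
    ∃ C : Set I, (C ∈ T.clusters ∨ ∃ w, C = {w}) ∧ A ⊆ π ⁻¹' C := by
  rcases hA with ⟨B, hB, rfl⟩ | ⟨w, hA⟩
  · exact ⟨B, Or.inl hB, subset_rfl⟩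
  · exact ⟨{w}, Or.inr ⟨w, rfl⟩, h.subset hA⟩

theorem IsRooted.graft [Finite I] [Finite J] (hT : T.IsRooted) (h : Subtrees π F N) :
    (T.graft π F N).IsRooted := by
  obtain ⟨hn, h2, hu⟩ := hT
  refine ⟨hn.graft h, h2.trans (length_le_graft hn h), fun A hA hA' => ?_⟩
  obtain ⟨C, hC, hAC⟩ := graft_cluster_subset h hA
  rw [hA', univ_subset_iff, Set.preimage_eq_univ_iff, h.surjective.range_eq, univ_subset_iff] at hAC
  rcases hC with hC | ⟨w, rfl⟩
  · exact hu C hC hAC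
  · have := congrArg Set.ncard hAC
    rw [Set.ncard_singleton, Set.ncard_univ, ← hn.length_eq] at this
    omega

/-- Every new cluster lies over a cluster of `T` or over a single label, and each of these omits at
least two labels. Hence adding one label to such a set never gives everything, and two clusters of
`T` never do by assumption. -/
theorem IsUnrooted.graft [Finite I] [Finite J] (hT : T.IsUnrooted) (h : Subtrees π F N) :
    (T.graft π F N).IsUnrooted := by
  obtain ⟨hn, h3, h2, hu⟩ := hT
  have hout : ∀ C : Set I, (C ∈ T.clusters ∨ ∃ w, C = {w}) → ∃ x y, x ≠ y ∧ x ∉ C ∧ y ∉ C := by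
    rintro C (hC | ⟨w, rfl⟩) <;> rw [← ncard_add_two_le_iff, ← hn.length_eq]
    · exact h2 C hC
    · rw [Set.ncard_singleton]
      omega
  refine ⟨hn.graft h, h3.trans (length_le_graft hn h), fun A hA => ?_, fun A hA B hB hAB => ?_⟩
  · obtain ⟨C, hC, hAC⟩ := graft_cluster_subset h hA
    obtain ⟨x, y, hxy, hx, hy⟩ := hout C hC
    obtain ⟨x, rfl⟩ := h.surjective x
    obtain ⟨y, rfl⟩ := h.surjective y
    rw [(hn.graft h).length_eq, ncard_add_two_le_iff]
    exact ⟨x, y, fun e => hxy (congrArg π e), fun h' => hx (hAC h'), fun h' => hy (hAC h')⟩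
  · obtain ⟨C, hC, hAC⟩ := graft_cluster_subset h hA
    obtain ⟨D, hD, hBD⟩ := graft_cluster_subset h hB
    have hCD : C ∪ D = univ := by
      refine eq_univ_of_forall fun w => ?_
      obtain ⟨x, rfl⟩ := h.surjective w
      have hx : x ∈ A ∪ B := by rw [hAB]; trivial
      rcases hx with hx | hx
      exacts [Or.inl (hAC hx), Or.inr (hBD hx)]
    have hs : ∀ C : Set I, (C ∈ T.clusters ∨ ∃ w, C = {w}) → ∀ w, C ∪ {w} ≠ univ := by
      intro C hC w hCw
      obtain ⟨x, y, hxy, hx, hy⟩ := hout C hC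
      have hx' : x ∈ C ∪ {w} := by rw [hCw]; trivial
      have hy' : y ∈ C ∪ {w} := by rw [hCw]; trivial
      exact hxy ((hx'.resolve_left hx).trans (hy'.resolve_left hy).symm)
    rcases hD with hD' | ⟨w, rfl⟩
    · rcases hC with hC | ⟨w, rfl⟩
      · exact hu C hC D hD' hCD
      · rw [union_comm] at hCD
        exact hs D (Or.inl hD') w hCD
    · exact hs C hC w hCD

end PlanarTree

/-! ### The complete subtrees hanging at a vertex -/

section Descendants

variable {R : Type}

/-- The descendants of depth `m` of a vertex, from the left to the right. -/
def descendants (m : ℕ) (f : Vertex R) : List (Label R m) :=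
  (words (m - f.2.length)).map fun u => toLabel m (f.1, f.2 ++ u)

theorem map_vertex_descendants {m : ℕ} {f : Vertex R} (h : f.2.length ≤ m) :
    (descendants m f).map Label.vertex =
      (words (m - f.2.length)).map fun u => (f.1, f.2 ++ u) := by
  rw [descendants, List.map_map]
  refine List.map_congr_left fun u hu => ?_
  rw [mem_words] at hu
  exact vertex_toLabel (by simp only [List.length_append, hu]; omega)

theorem mem_descendants {m : ℕ} {f : Vertex R} (h : f.2.length ≤ m) {x : Label R m} :
    x ∈ descendants m f ↔ f.Le x.vertex := by
  rw [← List.mem_map_of_injective Label.vertex_injective, map_vertex_descendants h]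
  constructor
  · intro hx
    obtain ⟨u, -, hu⟩ := List.mem_map.1 hx
    rw [← hu]
    exact ⟨rfl, List.prefix_append _ _⟩
  · rintro ⟨h1, u, hu⟩
    refine List.mem_map.2 ⟨u, mem_words.2 ?_, Prod.ext h1 hu⟩
    have h2 := congrArg List.length hu
    rw [List.length_append, x.vertex_length] at h2
    omega

theorem words_nodup : ∀ k, (words k).Nodup
  | 0 => by simp [words]
  | k + 1 => by
    have h := words_nodup k
    rw [words, List.nodup_append]
    refine ⟨h.map List.cons_injective, h.map List.cons_injective, ?_⟩
    intro a ha b hb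
    obtain ⟨a, -, rfl⟩ := List.mem_map.1 ha
    obtain ⟨b, -, rfl⟩ := List.mem_map.1 hb
    simp

theorem words_length : ∀ k, (words k).length = 2 ^ k
  | 0 => rfl
  | k + 1 => by
    rw [words, List.length_append, List.length_map, List.length_map, words_length k, pow_succ]
    omega

/-- In lexicographic order, the words that begin with `u` are consecutive. -/
theorem words_infix (u : List Bool) : ∀ k, (words k).map (u ++ ·) <:+: words (u.length + k) := by
  induction u with
  | nil =>
    intro k
    simp
  | cons b u ih =>
    intro k
    have h1 := (ih k).map (b :: ·)
    rw [List.map_map] at h1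
    have h2 : (words (u.length + k)).map (b :: ·) <:+: words ((b :: u).length + k) := by
      rw [List.length_cons, Nat.add_right_comm, words]
      cases b
      · exact (List.prefix_append _ _).isInfix
      · exact (List.suffix_append _ _).isInfix
    exact List.IsInfix.trans h1 h2

theorem descendants_nodup {m : ℕ} {f : Vertex R} (h : f.2.length ≤ m) :
    (descendants m f).Nodup := by
  refine List.Nodup.of_map Label.vertex ?_
  rw [map_vertex_descendants h]
  exact (words_nodup _).map fun u v huv => List.append_cancel_left (Prod.ext_iff.1 huv).2

theorem descendants_length (m : ℕ) (f : Vertex R) :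
    (descendants m f).length = 2 ^ (m - f.2.length) := by
  rw [descendants, List.length_map, words_length]

theorem descendants_infix {m : ℕ} {f f' : Vertex R} (h : f.Le f') (h' : f'.2.length ≤ m) :
    descendants m f' <:+: descendants m f := by
  obtain ⟨h1, u, hu⟩ := h
  have hl := congrArg List.length hu
  rw [List.length_append] at hl
  have h2 := (words_infix u (m - f'.2.length)).map fun v => toLabel m (f.1, f.2 ++ v)
  rw [List.map_map, show u.length + (m - f'.2.length) = m - f.2.length by omega] at h2
  refine Eq.subst (motive := fun l => l <:+: descendants m f) (List.map_congr_left fun v _ => ?_) h2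
  simp only [Function.comp]
  rw [← List.append_assoc, hu, h1]

theorem le_nested {f f' : Vertex R} (m : ℕ) :
    {v : Label R m | f.Le v.vertex} ⊆ {v | f'.Le v.vertex} ∨
      {v : Label R m | f'.Le v.vertex} ⊆ {v | f.Le v.vertex} ∨
      Disjoint {v : Label R m | f.Le v.vertex} {v | f'.Le v.vertex} := by
  have trans : ∀ {a b c : Vertex R}, a.Le b → b.Le c → a.Le c := fun h1 h2 =>
    ⟨h1.1.trans h2.1, h1.2.trans h2.2⟩
  by_cases h : Disjoint {v : Label R m | f.Le v.vertex} {v | f'.Le v.vertex}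
  · exact Or.inr (Or.inr h)
  · obtain ⟨v, hv, hv'⟩ := Set.not_disjoint_iff.1 h
    have hv : f.Le v.vertex := hv
    have hv' : f'.Le v.vertex := hv'
    rcases le_total f.2.length f'.2.length with hl | hl
    · have : f.Le f' := ⟨hv.1.trans hv'.1.symm, List.prefix_of_prefix_length_le hv.2 hv'.2 hl⟩
      exact Or.inr (Or.inl fun x hx => trans this hx)
    · have : f'.Le f := ⟨hv'.1.trans hv.1.symm, List.prefix_of_prefix_length_le hv'.2 hv.2 hl⟩
      exact Or.inl fun x hx => trans this hx

/-- If `v` were strictly below `u`, the ends through the son of `u` not leading to `v` would be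
below `u` and not below `v`. -/
theorem le_of_ball_eq {u v : Vertex R} (h : ball u = ball v) (hl : u.2.length ≤ v.2.length) :
    u = v := by
  have hv : someEnd v ∈ ball u := by rw [h]; exact isAbove_someEnd v
  have hle : u.Le v := Vertex.IsAbove.le hv (isAbove_someEnd v) hl
  obtain ⟨h1, t, ht⟩ := hle
  rcases t with _ | ⟨b, t⟩
  · exact Prod.ext h1 (by simpa using ht)
  · exfalso
    have h2 : someEnd ((u.1, u.2 ++ [!b]) : Vertex R) ∈ ball v := by
      rw [← h]
      have hle : Vertex.Le u ((u.1, u.2 ++ [!b]) : Vertex R) := ⟨rfl, List.prefix_append _ _⟩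
      exact hle.isAbove (isAbove_someEnd _)
    have h3 : Vertex.Le ((u.1, u.2 ++ [!b]) : Vertex R) v := by
      refine Vertex.IsAbove.le (isAbove_someEnd _) h2 ?_
      rw [← ht]
      simp
    obtain ⟨-, t', ht'⟩ := h3
    rw [← ht, List.append_assoc] at ht'
    have := List.append_cancel_left ht'
    simp at this

theorem ball_injective : Function.Injective (ball : Vertex R → Set (End R)) := by
  intro u v h
  rcases le_total u.2.length v.2.length with hl | hl
  · exact le_of_ball_eq h hl
  · exact (le_of_ball_eq h.symm hl).symm

theorem ncard_length_lt (k : ℕ) :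
    {u : List Bool | u.length < k}.Finite ∧ {u : List Bool | u.length < k}.ncard + 1 = 2 ^ k := by
  induction k with
  | zero => simp
  | succ k ih =>
    have h1 : {u : List Bool | u.length = k} = {u | u ∈ words k} := by
      ext u; simp [mem_words]
    have h2 : {u : List Bool | u.length < k + 1} = {u | u.length < k} ∪ {u | u.length = k} := by
      ext u; simp only [mem_union, mem_ofPred_eq]; omega
    have h3 : {u : List Bool | u.length = k}.Finite := List.finite_length_eq Bool k
    refine ⟨by rw [h2]; exact ih.1.union h3, ?_⟩
    rw [h2, Set.ncard_union_eq (Set.disjoint_left.2 fun u hu hu' => ?_) ih.1 h3, h1,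
      PlanarTree.ncard_setOf_mem (words_nodup k), words_length, pow_succ]
    · omega
    · have h4 : u.length < k := hu
      have h5 : u.length = k := hu'
      omega

/-- The clusters of the complete subtree hanging at `f`, cut at depth `m`. -/
def subtreeClusters (m : ℕ) (f : Vertex R) : Set (Set (Label R m)) :=
  {A | ∃ u, f.Le u ∧ u.2.length < m ∧ A = {v | u.Le v.vertex}}

/-- Distinct internal vertices have distinct clusters by `ball_injective`, so the count is that of
the words of length less than `m - f.2.length`. -/
theorem subtreeClusters_ncard {m : ℕ} {f : Vertex R} (h : f.2.length ≤ m) :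
    (subtreeClusters m f).ncard + 1 = 2 ^ (m - f.2.length) := by
  rw [← (ncard_length_lt (m - f.2.length)).2]
  congr 1
  symm
  refine Set.ncard_congr (fun u _ => {v | Vertex.Le (f.1, f.2 ++ u) v.vertex}) ?_ ?_ ?_
  · intro u hu
    have hu : u.length < m - f.2.length := hu
    exact ⟨(f.1, f.2 ++ u), ⟨rfl, List.prefix_append _ _⟩, by
      change (f.2 ++ u).length < m
      rw [List.length_append]; omega, rfl⟩
  · intro u u' hu hu' he
    have hu : u.length < m - f.2.length := hu
    have hu' : u'.length < m - f.2.length := hu'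
    have h1 := ball_eq_preimage (u := (f.1, f.2 ++ u)) (m := m)
      (by change (f.2 ++ u).length ≤ m; rw [List.length_append]; omega)
    have h2 := ball_eq_preimage (u := (f.1, f.2 ++ u')) (m := m)
      (by change (f.2 ++ u').length ≤ m; rw [List.length_append]; omega)
    rw [he, ← h2] at h1
    exact List.append_cancel_left (Prod.ext_iff.1 (ball_injective h1)).2
  · rintro _ ⟨u, ⟨h1, t, ht⟩, hu, rfl⟩
    have hl := congrArg List.length ht
    rw [List.length_append] at hl
    refine ⟨t, ?_, ?_⟩
    · change t.length < _
      omega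
    · rw [ht, h1]

end Descendants

/-! ### Existence of the composed and expanded trees -/

namespace TreeSymbol

variable {R : Type} {s : TreeSymbol R} {n m : ℕ}

/-- Each vertex of depth `m` lies below exactly one target leaf, which defines `π`. The tree
prescribed by `TreeSymbol.ComposeExpand` is then a graft of complete binary subtrees. -/
theorem exists_composeExpand [Finite R] (hs : s.source.leaves = {u | u.2.length = n})
    (hm : ∀ f ∈ s.target.leaves, f.2.length ≤ m) (T : PlanarTree (Label R n)) :
    ∃ (π : Label R m → Label R n) (F : Label R n → List (Label R m))
      (N : Label R n → Set (Set (Label R m))), PlanarTree.Subtrees π F N ∧ s.ComposeExpand T (T.graft π F N) := by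
  have hσm : ∀ w : Label R n, (s.σ w.vertex).2.length ≤ m := fun w =>
    hm _ (s.bijOn.mapsTo (mem_source hs w))
  have hex : ∀ v : Label R m, ∃! w : Label R n, (s.σ w.vertex).Le v.vertex := by
    intro v
    have key : ∀ w : Label R n, (s.σ w.vertex).Le v.vertex ↔
        (s.σ w.vertex).IsAbove (someEnd v.vertex) := by
      intro w
      rw [Vertex.isAbove_iff_le (hσm w), trunc_someEnd]
    simp only [key]
    obtain ⟨f, ⟨hf, hfv⟩, hu⟩ := s.target.existsUnique (someEnd v.vertex)
    obtain ⟨e, he, rfl⟩ := s.bijOn.surjOn hf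
    have he' : e.2.length = n := by rw [hs] at he; exact he
    refine ⟨toLabel n e, by simpa only [vertex_toLabel he'] using hfv, fun w hw => ?_⟩
    have h1 := hu _ ⟨s.bijOn.mapsTo (mem_source hs w), hw⟩
    rw [← s.bijOn.injOn (mem_source hs w) he h1, toLabel_vertex]
  choose π hπ hπu using hex
  refine ⟨π, fun w => descendants m (s.σ w.vertex), fun w => subtreeClusters m (s.σ w.vertex),
    ⟨fun x w => ?_, fun w => descendants_nodup (hσm w), ?_, ?_, fun w => ?_⟩, hs, hm, ?_, ?_⟩
  · rw [mem_descendants (hσm w)]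
    exact ⟨fun h => (hπu x w h).symm, fun h => h ▸ hπ x⟩
  · rintro w _ ⟨u, hfu, hu, rfl⟩
    have h1 : {v : Label R m | u.Le v.vertex} = {v | v ∈ descendants m u} := by
      ext v
      exact (mem_descendants hu.le).symm
    refine ⟨⟨_, descendants_infix hfu hu.le, h1⟩, ?_⟩
    rw [h1, PlanarTree.ncard_setOf_mem (descendants_nodup hu.le), descendants_length]
    exact Nat.le_self_pow (by omega) 2
  · rintro w _ ⟨u, -, -, rfl⟩ _ ⟨u', -, -, rfl⟩
    exact le_nested m
  · rw [subtreeClusters_ncard (hσm w), descendants_length]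
  · change (T.labels.flatMap _).map _ = _
    rw [List.map_flatMap]
    congr 1
    funext w
    exact map_vertex_descendants (hσm w)
  · change _ ∪ _ = _ ∪ _
    congr 1
    · ext A
      refine exists_congr fun B => and_congr_right fun _ => ?_
      have : π ⁻¹' B = {v | ∃ w ∈ B, (s.σ w.vertex).Le v.vertex} := by
        ext v
        exact ⟨fun h => ⟨π v, h, hπ v⟩, fun ⟨w, hw, hv⟩ => by
          rw [mem_preimage, ← hπu v w hv]; exact hw⟩
      rw [this]
    · ext A
      constructor
      · rintro ⟨w, u, h1, h2, h3⟩
        exact ⟨u, ⟨_, s.bijOn.mapsTo (mem_source hs w), h1⟩, h2, h3⟩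
      · rintro ⟨u, ⟨f, hf, h1⟩, h2, h3⟩
        obtain ⟨e, he, rfl⟩ := s.bijOn.surjOn hf
        have he' : e.2.length = n := by rw [hs] at he; exact he
        exact ⟨toLabel n e, u, by rwa [vertex_toLabel he'], h2, h3⟩

theorem exists_composeExpand_rooted [Finite R] (hs : s.source.leaves = {u | u.2.length = n})
    (hm : ∀ f ∈ s.target.leaves, f.2.length ≤ m) {T : PlanarTree (Label R n)} (hT : T.IsRooted) :
    ∃ T' : PlanarTree (Label R m), s.ComposeExpand T T' ∧ T'.IsRooted ∧
      T'.dimRooted = T.dimRooted := by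
  obtain ⟨π, F, N, h, hc⟩ := exists_composeExpand hs hm T
  refine ⟨_, hc, hT.graft h, ?_⟩
  have := PlanarTree.graft_count hT.1 h
  unfold PlanarTree.dimRooted
  omega

theorem exists_composeExpand_unrooted [Finite R] (hs : s.source.leaves = {u | u.2.length = n})
    (hm : ∀ f ∈ s.target.leaves, f.2.length ≤ m) {T : PlanarTree (Label R n)} (hT : T.IsUnrooted) :
    ∃ T' : PlanarTree (Label R m), s.ComposeExpand T T' ∧ T'.IsUnrooted ∧
      T'.dimUnrooted = T.dimUnrooted := by
  obtain ⟨π, F, N, h, hc⟩ := exists_composeExpand hs hm T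
  refine ⟨_, hc, hT.graft h, ?_⟩
  have := PlanarTree.graft_count hT.1 h
  unfold PlanarTree.dimUnrooted
  omega

end TreeSymbol

/-! ### Moving one point of a configuration -/

/-- Three points being fixed, a cross-ratio is an injective function of the fourth: equality would
make `det2 (X' (q 0)) (X' (q 2)) * det2 (X (q 1)) (X' (q 1))` vanish. -/
theorem crossRatio_ne_of_move {I : Type} {X X' : I → ℝ × ℝ} (hX : IsConfig X) (hX' : IsConfig X')
    (q : Fin 4 ↪ I) (h : ∀ i, i ≠ q 1 → X i = X' i) (hd : det2 (X (q 1)) (X' (q 1)) ≠ 0) :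
    crossRatio X q ≠ crossRatio X' q := by
  intro he
  have hq : ∀ {i j : Fin 4}, i ≠ j → q i ≠ q j := fun hij e => hij (q.injective e)
  have h0 := h (q 0) (hq (by decide))
  have h2 := h (q 2) (hq (by decide))
  have h3 := h (q 3) (hq (by decide))
  have n02 := hX' _ _ (hq (by decide : (0 : Fin 4) ≠ 2))
  have n03 := hX' _ _ (hq (by decide : (0 : Fin 4) ≠ 3))
  have n12 := hX _ _ (hq (by decide : (1 : Fin 4) ≠ 2))
  have n12' := hX' _ _ (hq (by decide : (1 : Fin 4) ≠ 2))
  have n23 := hX' _ _ (hq (by decide : (2 : Fin 4) ≠ 3))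
  unfold crossRatio at he
  rw [OnePoint.coe_eq_coe, h0, h2, h3] at he
  rw [h2] at n12
  rw [div_eq_div_iff (mul_ne_zero n12 n03) (mul_ne_zero n12' n03)] at he
  have he' : det2 (X' (q 0)) (X (q 1)) * det2 (X' (q 1)) (X' (q 2)) =
      det2 (X' (q 0)) (X' (q 1)) * det2 (X (q 1)) (X' (q 2)) := by
    refine mul_right_cancel₀ (mul_ne_zero n23 n03) ?_
    linear_combination he
  refine mul_ne_zero n02 hd ?_
  have : det2 (X' (q 0)) (X' (q 2)) * det2 (X (q 1)) (X' (q 1)) =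
      det2 (X' (q 0)) (X (q 1)) * det2 (X' (q 1)) (X' (q 2)) * (-1) -
      det2 (X' (q 0)) (X' (q 1)) * det2 (X (q 1)) (X' (q 2)) * (-1) := by
    unfold det2
    ring
  rw [this, he', sub_self]

theorem crossRatio_congr_of_eq {I : Type} {X X' : I → ℝ × ℝ} {q : Fin 4 ↪ I}
    (h : ∀ k, X (q k) = X' (q k)) : crossRatio X q = crossRatio X' q := by
  unfold crossRatio
  simp only [h]

/-- Two systems of distinct real numbers which differ exactly at `i`. -/
theorem exists_move {I : Type} [Finite I] (i : I) : ∃ a a' : I → ℝ, Function.Injective a ∧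
    Function.Injective a' ∧ (∀ j, j ≠ i → a j = a' j) ∧ a i ≠ a' i := by
  classical
  obtain ⟨n, ⟨e⟩⟩ := Finite.exists_equiv_fin I
  -- The coordinates are natural numbers, so `-1` is a new position distinct from all of them.
  refine ⟨fun j => ((e j : ℕ) : ℝ), Function.update (fun j => ((e j : ℕ) : ℝ)) i (-1),
    fun j k h => e.injective (Fin.ext (by simpa using h)), fun j k h => ?_, fun j hj => ?_, ?_⟩
  · have hn : ∀ l : I, (-1 : ℝ) ≠ ((e l : ℕ) : ℝ) := fun l hl => by
      have : (0 : ℝ) ≤ ((e l : ℕ) : ℝ) := Nat.cast_nonneg _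
      linarith
    by_cases hj : j = i <;> by_cases hk : k = i
    · rw [hj, hk]
    · subst hj
      rw [Function.update_self, Function.update_of_ne hk] at h
      exact absurd h (hn k)
    · subst hk
      rw [Function.update_self, Function.update_of_ne hj] at h
      exact absurd h.symm (hn j)
    · rw [Function.update_of_ne hj, Function.update_of_ne hk] at h
      exact e.injective (Fin.ext (by simpa using h))
  · rw [Function.update_of_ne hj]
  · rw [Function.update_self]
    have : (0 : ℝ) ≤ ((e i : ℕ) : ℝ) := Nat.cast_nonneg _
    intro h
    linarith

/-! ### Relabelling at finite levels, and its faithfulness -/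

namespace SplitTower

variable {E : Type} {L : ℕ → Type} {𝕋 : SplitTower E L}

/-- The action of the permutations of the labels. -/
def actHom (E : Type) : Equiv.Perm E →* Equiv.Perm (QuadSpace E) where
  toFun g := ⟨act g, act g⁻¹, act_inv_act g, fun P => by
    rw [← act_mul, mul_inv_cancel, act_one]⟩
  map_one' := Equiv.ext act_one
  map_mul' g h := Equiv.ext (act_mul g h)

-- An invariant curve has the same cross-ratio at `Q` and at the quadruple `g⁻¹ Q`. Once the level
-- separates all these elements, moving the point labelled by `Q 1` changes the first and not the
-- second, so `X` and `X'` cannot both give invariant curves.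
variable (𝕋) in
theorem eventually_act_ne {g : Equiv.Perm E} {Q : Fin 4 ↪ E} (hQ : ∀ k, g⁻¹ (Q k) ≠ Q 1) :
    ∀ᶠ n in atTop, ∀ X X' : L n → ℝ × ℝ, IsConfig X → IsConfig X' →
      (∀ w, w ≠ 𝕋.tr n (Q 1) → X w = X' w) →
      det2 (X (𝕋.tr n (Q 1))) (X' (𝕋.tr n (Q 1))) ≠ 0 →
      act g (𝕋.lift n (crossRatio X)) ≠ 𝕋.lift n (crossRatio X) ∨
        act g (𝕋.lift n (crossRatio X')) ≠ 𝕋.lift n (crossRatio X') := by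
  let S : Set E := range Q ∪ range fun k => g⁻¹ (Q k)
  have hS : S.Finite := (finite_range _).union (finite_range _)
  have : Finite {z // z ∈ S} := hS.to_subtype
  filter_upwards [𝕋.eventually_injective (Function.Embedding.subtype (· ∈ S))] with n hn X X' hX hX' h hd
  have hinj : ∀ a ∈ S, ∀ b ∈ S, 𝕋.tr n a = 𝕋.tr n b → a = b := fun a ha b hb hab =>
    congrArg Subtype.val (hn (a₁ := ⟨a, ha⟩) (a₂ := ⟨b, hb⟩) hab)
  have hm : ∀ k, Q k ∈ S := fun k => Or.inl ⟨k, rfl⟩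
  have hm' : ∀ k, g⁻¹ (Q k) ∈ S := fun k => Or.inr ⟨k, rfl⟩
  have hq : Function.Injective fun k => 𝕋.tr n (Q k) := fun i j hij =>
    Q.injective (hinj _ (hm i) _ (hm j) hij)
  have hq' : Function.Injective fun k => 𝕋.tr n (Q.trans (g⁻¹ : Equiv.Perm E).toEmbedding k) :=
    fun i j hij => Q.injective (g⁻¹.injective (hinj _ (hm' i) _ (hm' j) hij))
  have key : ∀ p, act g (𝕋.lift n p) = 𝕋.lift n p → p ⟨_, hq'⟩ = p ⟨_, hq⟩ := by
    intro p hp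
    rw [← 𝕋.lift_of_injective p hq, ← 𝕋.lift_of_injective p hq']
    exact congrFun hp Q
  by_contra hcon
  push Not at hcon
  refine crossRatio_ne_of_move hX hX' ⟨_, hq⟩ h hd ?_
  rw [← key _ hcon.1, ← key _ hcon.2]
  refine crossRatio_congr_of_eq fun k => h _ fun hk => hQ k ?_
  exact hinj _ (hm' k) _ (hm 1) hk

theorem act_mem_curves {g : Equiv.Perm E} {n m : ℕ} (h : ∀ C ∈ 𝕋.balls m, g ⁻¹' C ∈ 𝕋.balls n)
    {P : QuadSpace E} (hP : P ∈ 𝕋.curves n) : act g P ∈ 𝕋.curves m := by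
  refine ⟨IsCurve_act.2 hP.1, fun C hC => ?_⟩
  rw [← image_preimage_eq C g.surjective]
  exact isCl_act.2 (hP.2 _ (h C hC))

theorem mem_balls_option {n : ℕ} {C : Set (Option E)} :
    C ∈ 𝕋.option.balls n ↔ C = {none} ∨ ∃ D ∈ 𝕋.balls n, C = some '' D := by
  -- For a tree without clusters, `clus` consists of the balls alone.
  have := mem_clus_option (𝕋 := 𝕋) (n := n) (T := ⟨[], ∅⟩) (C := C)
  simpa [clus, PlanarTree.addRoot] using this

theorem preimage_balls_option {g : Equiv.Perm E} {n m : ℕ}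
    (h : ∀ C ∈ 𝕋.balls m, g ⁻¹' C ∈ 𝕋.balls n) {C : Set (Option E)} (hC : C ∈ 𝕋.option.balls m) :
    Equiv.optionCongr g ⁻¹' C ∈ 𝕋.option.balls n := by
  rw [mem_balls_option] at hC ⊢
  rcases hC with rfl | ⟨D, hD, rfl⟩
  · left
    ext (_ | z) <;> simp
  · refine Or.inr ⟨_, h D hD, ?_⟩
    ext (_ | z) <;> simp

variable (𝕋) in
/-- The action read on finite levels. -/
noncomputable def levelAct (g : Equiv.Perm E) (n m : ℕ) (p : QuadSpace (L n)) : QuadSpace (L m) :=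
  restrict (𝕋.secEmb m) (act g (𝕋.lift n p))

theorem continuous_levelAct (g : Equiv.Perm E) (n m : ℕ) : Continuous (𝕋.levelAct g n m) :=
  (continuous_restrict _).comp ((continuous_restrict _).comp (𝕋.continuous_lift n))

theorem levelAct_mem {g : Equiv.Perm E} {n m : ℕ} (h : ∀ C ∈ 𝕋.balls m, g ⁻¹' C ∈ 𝕋.balls n)
    {p : QuadSpace (L n)} (hp : p ∈ Mbar (L n)) : 𝕋.levelAct g n m p ∈ Mbar (L m) :=
  𝕋.restrict_mem_Mbar_of_mem_curves (act_mem_curves h (𝕋.lift_mem_curves hp)) m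

theorem lift_levelAct {g : Equiv.Perm E} {n m : ℕ} (h : ∀ C ∈ 𝕋.balls m, g ⁻¹' C ∈ 𝕋.balls n)
    {p : QuadSpace (L n)} (hp : p ∈ Mbar (L n)) :
    𝕋.lift m (𝕋.levelAct g n m p) = act g (𝕋.lift n p) :=
  𝕋.lift_restrict (act_mem_curves h (𝕋.lift_mem_curves hp))

theorem lift_image_quadCell {n : ℕ} {T : PlanarTree (L n)} (hT : T.IsNested) :
    𝕋.lift n '' (T.quadCell ∩ Mbar (L n)) = 𝕋.endStratum n T := by
  ext P
  constructor
  · rintro ⟨p, ⟨hp, hp'⟩, rfl⟩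
    exact (mem_quadCell_iff hT hp').1 hp
  · intro hP
    have hc := 𝕋.endStratum_subset n T hP
    have hm := 𝕋.restrict_mem_Mbar_of_mem_curves hc n
    refine ⟨_, ⟨(mem_quadCell_iff (𝕋 := 𝕋) hT hm).2 ?_, hm⟩, 𝕋.lift_restrict hc⟩
    rwa [𝕋.lift_restrict hc]

end SplitTower

open SplitTower

/-! ### Auxiliary ends and symbols -/

section Points

variable {R : Type}

theorem infinite_end [Nonempty R] : Infinite (End R) := by
  have : Infinite (Stream' Bool) := by
    refine Infinite.of_injective (fun n : ℕ => (fun k => decide (k = n) : Stream' Bool)) ?_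
    intro m n h
    have := congrFun h m
    simpa using this
  infer_instance

theorem exists_points [Nonempty R] (z z' : End R) : ∃ b c d : End R, b ≠ c ∧ b ≠ d ∧ c ≠ d ∧
    (b ≠ z ∧ b ≠ z') ∧ (c ≠ z ∧ c ≠ z') ∧ (d ≠ z ∧ d ≠ z') := by
  classical
  have := infinite_end (R := R)
  obtain ⟨b, hb⟩ := Infinite.exists_notMem_finset ({z, z'} : Finset (End R))
  obtain ⟨c, hc⟩ := Infinite.exists_notMem_finset ({z, z', b} : Finset (End R))
  obtain ⟨d, hd⟩ := Infinite.exists_notMem_finset ({z, z', b, c} : Finset (End R))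
  simp only [Finset.mem_insert, Finset.mem_singleton, not_or] at hb hc hd
  exact ⟨b, c, d, Ne.symm hc.2.2, Ne.symm hd.2.2.1, Ne.symm hd.2.2.2, ⟨hb.1, hb.2⟩,
    ⟨hc.1, hc.2.1⟩, hd.1, hd.2.1⟩

end Points

section Symbols

variable {R : Type} [Finite R]

theorem exists_preimage_balls {g : Equiv.Perm (End R)} (hg : g ∈ spheromorphismGroup R) (n : ℕ) :
    ∃ m, ∀ C ∈ (endTower R).balls m, g ⁻¹' C ∈ (endTower R).balls n := by
  obtain ⟨N, hN⟩ := exists_symbol_of_mem hg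
  obtain ⟨s, hs, hsn⟩ := hN (max n N) (le_max_right _ _)
  obtain ⟨m, hm⟩ := s.exists_bound
  exact ⟨m, fun C hC => (endTower R).balls_anti (le_max_left _ _) (hs.preimage_ball hsn hm hC)⟩

/-- A symbol of the identity whose trees are complete. -/
theorem exists_symbol_one (R : Type) [Finite R] (n : ℕ) : ∃ s : TreeSymbol R, s.Represents 1 ∧
    s.source.leaves = {u | u.2.length = n} ∧ ∀ f ∈ s.target.leaves, f.2.length = n := by
  have h0 : LocallySphero (R := R) Set.univ n 1 := fun u _ =>
    ⟨u, TreeAut.id, trivial, by omega, fun x => ⟨rfl, fun k => take_append_stream _ _ _⟩⟩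
  obtain ⟨s, -, hs, hsn⟩ := exists_symbol_of_locallySphero h0
  refine ⟨s, hs, hsn, fun f hf => ?_⟩
  obtain ⟨e, he, rfl⟩ := s.bijOn.surjOn hf
  have h1 := hs.image_ball he []
  simp only [TreeAut.apply_nil, List.append_nil] at h1
  rw [Equiv.Perm.coe_one, image_id] at h1
  have h2 : e = s.σ e := ball_injective h1
  rw [← h2]
  rw [hsn] at he
  exact he

end Symbols

/-! ### The cyclic tower -/

/-- The system of cross-ratios of all quadruples of ends, for a point of finite level. -/
noncomputable def barMap (n : ℕ) (p : Mbar (Label (Fin 3) n)) : QuadSpace (End (Fin 3)) :=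
  (endTower (Fin 3)).lift n p.1

theorem barMap_exp (n : ℕ) (p : Mbar (Label (Fin 3) n)) :
    barMap (n + 1) (expBar (Fin 3) n p) = barMap n p :=
  (endTower (Fin 3)).lift_stabilize n p.1

theorem barMap_injective (n : ℕ) : Function.Injective (barMap n) := fun _ _ h =>
  Subtype.ext ((endTower (Fin 3)).lift_injective n h)

theorem desc_image_towerBarStratum {n : ℕ} {T : PlanarTree (Label (Fin 3) n)} (hT : T.IsNested) :
    SeqColimit.desc barMap barMap_exp '' towerBarStratum n T = (endTower (Fin 3)).endStratum n T := by
  rw [← lift_image_quadCell hT, towerBarStratum, image_image]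
  ext P
  constructor
  · rintro ⟨p, hp, rfl⟩
    exact ⟨p.1, ⟨hp, p.2⟩, rfl⟩
  · rintro ⟨p, ⟨hp, hp'⟩, rfl⟩
    exact ⟨⟨p, hp'⟩, hp, rfl⟩

theorem ActsBar.act_image {g : Equiv.Perm (End (Fin 3))} {s s' : Set TowerBar}
    (h : ActsBar g s s') : act g '' (SeqColimit.desc barMap barMap_exp '' s) =
      SeqColimit.desc barMap barMap_exp '' s' := by
  obtain ⟨σ, n, m, T, T', hσ, hT, rfl, hc, hT', rfl⟩ := h
  rw [desc_image_towerBarStratum hT.1, desc_image_towerBarStratum hT'.1,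
    (hσ.carries hc).act_image_endStratum hT'.1]

/-- Composition with a symbol of the identity is a mere expansion, and the identity acts trivially:
the expanded tree labels the same stratum at a higher level. -/
theorem towerBarStratum_expand {n m : ℕ} (h : n ≤ m) {T : PlanarTree (Label (Fin 3) n)}
    (hT : T.IsUnrooted) : ∃ T' : PlanarTree (Label (Fin 3) m), T'.IsUnrooted ∧
      T'.dimUnrooted = T.dimUnrooted ∧ towerBarStratum m T' = towerBarStratum n T := by
  obtain ⟨s, hs, hsn, hst⟩ := exists_symbol_one (Fin 3) n
  obtain ⟨T', hc, hT', hd⟩ := TreeSymbol.exists_composeExpand_unrooted hsn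
    (fun f hf => (hst f hf).trans_le h) hT
  refine ⟨T', hT', hd, ?_⟩
  have := ActsBar.act_image ⟨s, n, m, T, T', hs, hT, rfl, hc, hT', rfl⟩
  rw [show (act 1 : QuadSpace (End (Fin 3)) → _) = id from funext act_one, image_id] at this
  exact (SeqColimit.desc_injective barMap_injective).image_injective this.symm

/-- The tree is first expanded to a level at which `g` has a symbol whose source is the complete
tree. -/
theorem exists_actsBar {g : Equiv.Perm (End (Fin 3))} (hg : g ∈ CyclicN) {d : ℕ} {s : Set TowerBar}
    (hs : s ∈ stratBar d) : ∃ s' ∈ stratBar d, ActsBar g s s' := by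
  obtain ⟨n, T, hT, hd, rfl⟩ := hs
  obtain ⟨N, hN⟩ := exists_symbol_of_mem hg
  obtain ⟨T₁, hT₁, hd₁, he⟩ := towerBarStratum_expand (le_max_left n N) hT
  obtain ⟨σ, hσ, hσn⟩ := hN (max n N) (le_max_right _ _)
  obtain ⟨m, hm⟩ := σ.exists_bound
  obtain ⟨T', hc, hT', hd'⟩ := TreeSymbol.exists_composeExpand_unrooted hσn hm hT₁
  exact ⟨_, ⟨m, T', hT', by rw [hd', hd₁, hd], rfl⟩, σ, _, m, T₁, T', hσ, hT₁, he.symm, hc, hT', rfl⟩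

theorem bar_faithful {g : Equiv.Perm (End (Fin 3))} (h : ∀ n p, act g (barMap n p) = barMap n p) :
    g = 1 := by
  by_contra hg
  obtain ⟨z, hz⟩ : ∃ z, g z ≠ z := by
    by_contra hcon
    push Not at hcon
    exact hg (Equiv.ext hcon)
  obtain ⟨b, c, d, hbc, hbd, hcd, hb, hc, hd⟩ := exists_points z (g z)
  -- The moved end `z` is the second entry. The preimage of this quadruple under `g` avoids `z`,
  -- since none of its entries equals `g z`.
  have hQ : Function.Injective ![b, z, c, d] := by
    intro i j hij
    fin_cases i <;> fin_cases j <;> simp_all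
  have hgQ : ∀ k, g⁻¹ ((⟨_, hQ⟩ : Fin 4 ↪ _) k) ≠ (⟨_, hQ⟩ : Fin 4 ↪ _) 1 := by
    intro k hk
    have hk : ![b, z, c, d] k = g z := by rw [Equiv.Perm.inv_eq_iff_eq] at hk; exact hk
    fin_cases k
    exacts [hb.2 hk, hz hk.symm, hc.2 hk, hd.2 hk]
  obtain ⟨n, hn⟩ := ((endTower (Fin 3)).eventually_act_ne hgQ).exists
  obtain ⟨a, a', ha, ha', hne, hi⟩ := exists_move (trunc n z)
  have hconf : ∀ {a : Label (Fin 3) n → ℝ}, Function.Injective a →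
      IsConfig fun w => ((a w, 1) : ℝ × ℝ) := fun {a} ha i j hij =>
    isConfig_affineConfig ha (some i) (some j) (by simpa using hij)
  rcases hn (fun w => (a w, 1)) (fun w => (a' w, 1)) (hconf ha) (hconf ha')
    (fun w hw => by rw [hne w hw]) (by
      change a (trunc n z) * 1 - 1 * a' (trunc n z) ≠ 0
      rw [mul_one, one_mul]
      exact sub_ne_zero.2 hi) with h' | h'
  · exact h' (h n ⟨_, subset_closure ⟨_, hconf ha, rfl⟩⟩)
  · exact h' (h n ⟨_, subset_closure ⟨_, hconf ha', rfl⟩⟩)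

theorem bar_cellular_action :
    (∀ g : CyclicN, ∀ s ∈ ⋃ d, stratBar d, ∃! s', ActsBar g s s') ∧
      ∃ γ : CyclicN →* HomeoCell stratBar, Function.Injective γ ∧
        ∀ (g : CyclicN) (s s' : Set TowerBar), ActsBar g s s' →
          (γ g : TowerBar ≃ₜ TowerBar) '' s = s' := by
  refine SeqColimit.exists_cellular_action (hΦ := barMap_exp)
    ((actHom (End (Fin 3))).comp CyclicN.subtype) barMap_injective (fun g n => ?_) (fun g h => ?_)
    (Acts := fun g s s' => ActsBar g s s') (fun g s s' h => h.act_image)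
    (fun g d s hs => exists_actsBar g.2 hs)
  · obtain ⟨m, hm⟩ := exists_preimage_balls g.2 n
    exact ⟨m, fun p => ⟨_, levelAct_mem hm p.2⟩,
      ((continuous_levelAct _ n m).comp continuous_subtype_val).subtype_mk _,
      fun p => lift_levelAct hm p.2⟩
  · exact Subtype.ext (bar_faithful fun n p => h (SeqColimit.ι n p))

/-! ### Affine coordinates normalized on the unit sphere -/

theorem crossRatio_sub {I : Type} (a : I → ℝ) (m : ℝ) :
    crossRatio (affineConfig fun i => a i - m) = crossRatio (affineConfig a) := by
  refine crossRatio_congr (k := 1) (μ := fun _ => 1) one_ne_zero (fun _ => one_ne_zero) ?_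
  rintro (_ | i) (_ | j) <;> simp [det2, affineConfig]

theorem exists_ne_of_injective {I : Type} [Nontrivial I] {a : I → ℝ} (ha : Function.Injective a) :
    ∃ i j, a i ≠ a j := by
  obtain ⟨i, j, hij⟩ := exists_pair_ne I
  exact ⟨i, j, fun h => hij (ha h)⟩

section Normalize

variable {I : Type} [Fintype I]

/-- The normalization of affine coordinates: zero sum, and unit norm. -/
noncomputable def sphereNormalize (a : I → ℝ) (i : I) : ℝ :=
  (a i - (∑ j, a j) / Fintype.card I) / √(∑ k, (a k - (∑ j, a j) / Fintype.card I) ^ 2)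

theorem sphereNormalize_pos {a : I → ℝ} (h : ∃ i j, a i ≠ a j) :
    0 < √(∑ k, (a k - (∑ j, a j) / Fintype.card I) ^ 2) := by
  obtain ⟨i, j, hij⟩ := h
  refine Real.sqrt_pos.2 (Finset.sum_pos' (fun _ _ => sq_nonneg _) ?_)
  by_cases hi : a i = (∑ j, a j) / Fintype.card I
  · exact ⟨j, Finset.mem_univ _, pow_pos_of_ne (sub_ne_zero.2 fun hj => hij (hi.trans hj.symm))⟩
  · exact ⟨i, Finset.mem_univ _, pow_pos_of_ne (sub_ne_zero.2 hi)⟩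
where
  pow_pos_of_ne {x : ℝ} (h : x ≠ 0) : 0 < x ^ 2 := by positivity

theorem sum_sphereNormalize [Nonempty I] (a : I → ℝ) : ∑ i, sphereNormalize a i = 0 := by
  have hc : (Fintype.card I : ℝ) ≠ 0 := Nat.cast_ne_zero.2 Fintype.card_ne_zero
  unfold sphereNormalize
  rw [← Finset.sum_div, Finset.sum_sub_distrib, Finset.sum_const, Finset.card_univ, nsmul_eq_mul,
    mul_div_cancel₀ _ hc, sub_self, zero_div]

theorem sum_sq_sphereNormalize {a : I → ℝ} (h : ∃ i j, a i ≠ a j) :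
    ∑ i, sphereNormalize a i ^ 2 = 1 := by
  have hp := sphereNormalize_pos h
  unfold sphereNormalize
  simp only [div_pow]
  rw [← Finset.sum_div, Real.sq_sqrt (Real.sqrt_pos.1 hp).le, div_self (Real.sqrt_pos.1 hp).ne']

theorem exists_ne_of_sum {a : I → ℝ} (h0 : ∑ i, a i = 0) (h1 : ∑ i, a i ^ 2 = 1) :
    ∃ i j, a i ≠ a j := by
  by_contra hcon
  push Not at hcon
  by_cases hI : IsEmpty I
  · simp at h1
  · rw [not_isEmpty_iff] at hI
    obtain ⟨i⟩ := hI
    have hi : ∀ j, a j = a i := fun j => hcon j i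
    simp only [hi, Finset.sum_const, Finset.card_univ, nsmul_eq_mul] at h0 h1
    rcases mul_eq_zero.1 h0 with h | h
    · rw [h] at h1
      simp at h1
    · rw [h] at h1
      simp at h1

theorem continuous_sphereNormalize {Z : Type} [TopologicalSpace Z] {a : Z → I → ℝ}
    (ha : Continuous a) (h : ∀ z, ∃ i j, a z i ≠ a z j) :
    Continuous fun z => sphereNormalize (a z) := by
  have hi : ∀ i, Continuous fun z => a z i := fun i => (continuous_apply i).comp ha
  have hm : Continuous fun z => (∑ j, a z j) / (Fintype.card I : ℝ) :=
    (continuous_finsetSum _ fun j _ => hi j).div_const _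
  refine continuous_pi fun i => ((hi i).sub hm).div ?_ fun z => (sphereNormalize_pos (h z)).ne'
  exact Real.continuous_sqrt.comp (continuous_finsetSum _ fun j _ => ((hi j).sub hm).pow 2)

theorem crossRatio_sphereNormalize {a : I → ℝ} (h : ∃ i j, a i ≠ a j) :
    crossRatio (affineConfig (sphereNormalize a)) = crossRatio (affineConfig a) :=
  (crossRatio_smul _ (sphereNormalize_pos h).ne').trans (crossRatio_sub a _)

theorem sphereNormalize_le_iff {a : I → ℝ} (h : ∃ i j, a i ≠ a j) {i j : I} :
    sphereNormalize a i ≤ sphereNormalize a j ↔ a i ≤ a j := by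
  unfold sphereNormalize
  rw [div_le_div_iff_of_pos_right (sphereNormalize_pos h), sub_le_sub_iff_right]

theorem sphereNormalize_injective {a : I → ℝ} (h : ∃ i j, a i ≠ a j)
    (ha : Function.Injective a) : Function.Injective (sphereNormalize a) := fun _ _ hij =>
  ha (le_antisymm ((sphereNormalize_le_iff h).1 hij.le) ((sphereNormalize_le_iff h).1 hij.ge))

theorem sphereNormalize_mem_Mtilde [Nontrivial I] {a : I → ℝ} (ha : Function.Injective a) :
    ((sphereNormalize a, crossRatio (affineConfig a)) : (I → ℝ) × QuadSpace (Option I)) ∈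
      Mtilde I :=
  have h := exists_ne_of_injective ha
  subset_closure ⟨sum_sphereNormalize a, sum_sq_sphereNormalize h, sphereNormalize_injective h ha,
    (crossRatio_sphereNormalize h).symm⟩

end Normalize

/-! ### Equations of the two-sheeted cover -/

/-- The affine coordinates `a` are those of the component of the curve containing the point at
infinity. -/
def Compat {E : Type} (a : E → ℝ) (P : QuadSpace (Option E)) : Prop :=
  ∀ (q : Fin 4 ↪ Option E) (i j k : E), q 0 = none → q 1 = some i → q 2 = some j → q 3 = some k →
    a i ≠ a j → P q = (((a j - a k) / (a i - a j) : ℝ) : OnePoint ℝ)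

theorem compat_crossRatio {E : Type} (a : E → ℝ) : Compat a (crossRatio (affineConfig a)) := by
  intro q i j k h0 h1 h2 h3 _
  simp [crossRatio, h0, h1, h2, h3, det2, affineConfig]

theorem Compat.affine {E : Type} {a : E → ℝ} {P : QuadSpace (Option E)} (h : Compat a P) {c : ℝ}
    (hc : c ≠ 0) (m : ℝ) : Compat (fun i => (a i - m) / c) P := by
  intro q i j k h0 h1 h2 h3 hij
  have hij' : a i ≠ a j := fun e => hij (by simp only [e])
  rw [h q i j k h0 h1 h2 h3 hij', ← sub_div, ← sub_div, div_div_div_cancel_right₀ hc,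
    sub_sub_sub_cancel_right, sub_sub_sub_cancel_right]

theorem Compat.sphereNormalize {I : Type} [Fintype I] {a : I → ℝ} {p : QuadSpace (Option I)}
    (h : Compat a p) (ha : ∃ i j, a i ≠ a j) : Compat (sphereNormalize a) p :=
  h.affine (sphereNormalize_pos ha).ne' _

/-- Provides a denominator that is nonzero for both systems of coordinates. -/
theorem exists_common_pair {E : Type} {a b : E → ℝ} (ha : ∃ i j, a i ≠ a j)
    (hb : ∃ i j, b i ≠ b j) : ∃ i j, a i ≠ a j ∧ b i ≠ b j := by
  obtain ⟨i, j, hij⟩ := ha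
  by_cases h : b i = b j
  · obtain ⟨k, hk⟩ : ∃ k, b k ≠ b i := by
      by_contra hcon
      push Not at hcon
      obtain ⟨k, l, hkl⟩ := hb
      exact hkl (by rw [hcon k, hcon l])
    by_cases h' : a k = a i
    · exact ⟨k, j, by rw [h']; exact hij, by rw [← h]; exact hk⟩
    · exact ⟨k, i, h', hk⟩
  · exact ⟨i, j, hij, h⟩

/-- The cross-ratios of the base point, `i`, `j` and a variable `k` give the position of `k`
relative to `i` and `j`, hence all the coordinates up to an affine change. -/
theorem Compat.exists_affine {E : Type} {a b : E → ℝ} {P : QuadSpace (Option E)} (ha : Compat a P)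
    (hb : Compat b P) (ha' : ∃ i j, a i ≠ a j) (hb' : ∃ i j, b i ≠ b j) :
    ∃ c m : ℝ, ∀ i, b i = c * a i + m := by
  obtain ⟨i, j, hi, hj⟩ := exists_common_pair ha' hb'
  have hi' := sub_ne_zero.2 hi
  have hj' := sub_ne_zero.2 hj
  refine ⟨(b i - b j) / (a i - a j), b j - (b i - b j) / (a i - a j) * a j, fun k => ?_⟩
  have key : (a j - a k) * (b i - b j) = (b j - b k) * (a i - a j) := by
    by_cases hki : k = i
    · subst hki
      ring
    by_cases hkj : k = j
    · subst hkj
      ring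
    have hij : i ≠ j := fun e => hi (by rw [e])
    have hinj : Function.Injective ![none, some i, some j, some k] := by
      intro s t hst
      fin_cases s <;> fin_cases t <;> simp_all
    have h1 := ha ⟨_, hinj⟩ i j k rfl rfl rfl rfl hi
    rw [hb ⟨_, hinj⟩ i j k rfl rfl rfl rfl hj, OnePoint.coe_eq_coe, div_eq_div_iff hj' hi'] at h1
    exact h1.symm
  field_simp
  linear_combination key

/-- The zero sum removes the translation and the unit norm leaves only a sign. -/
theorem Compat.eq_or_neg {I : Type} [Fintype I] {a b : I → ℝ} {p : QuadSpace (Option I)}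
    (ha : Compat a p) (hb : Compat b p) (ha0 : ∑ i, a i = 0) (ha1 : ∑ i, a i ^ 2 = 1)
    (hb0 : ∑ i, b i = 0) (hb1 : ∑ i, b i ^ 2 = 1) : b = a ∨ b = fun i => -a i := by
  obtain ⟨c, m, h⟩ := ha.exists_affine hb (exists_ne_of_sum ha0 ha1) (exists_ne_of_sum hb0 hb1)
  obtain ⟨i, -⟩ := exists_ne_of_sum ha0 ha1
  have hm : m = 0 := by
    simp only [h, Finset.sum_add_distrib, ← Finset.mul_sum, ha0, mul_zero, zero_add,
      Finset.sum_const, Finset.card_univ, nsmul_eq_mul] at hb0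
    have : Nonempty I := ⟨i⟩
    exact (mul_eq_zero.1 hb0).resolve_left (Nat.cast_ne_zero.2 Fintype.card_ne_zero)
  subst hm
  simp only [add_zero] at h
  simp only [h, mul_pow, ← Finset.mul_sum, ha1, mul_one] at hb1
  rcases sq_eq_one_iff.1 hb1 with rfl | rfl
  · exact Or.inl (funext fun i => by rw [h, one_mul])
  · exact Or.inr (funext fun i => by rw [h, neg_one_mul])

/-- Every configuration has affine coordinates, the point labelled `none` being at infinity. -/
theorem IsConfig.exists_affineConfig {I : Type} [Nonempty I] {X : Option I → ℝ × ℝ}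
    (hX : IsConfig X) : ∃ a : I → ℝ, Function.Injective a ∧
      crossRatio X = crossRatio (affineConfig a) := by
  have hd : ∀ i, det2 (X none) (X (some i)) ≠ 0 := fun i => hX _ _ (by simp)
  have hN : (X none).1 ^ 2 + (X none).2 ^ 2 ≠ 0 := by
    intro h0
    obtain ⟨i⟩ := ‹Nonempty I›
    refine hd i ?_
    have h2 : (X none).1 = 0 := by nlinarith [sq_nonneg (X none).1, sq_nonneg (X none).2]
    have h3 : (X none).2 = 0 := by nlinarith [sq_nonneg (X none).1, sq_nonneg (X none).2]
    simp [det2, h2, h3]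
  -- In orthogonal axes of which the first is along `X none`, this is the quotient of the two
  -- coordinates of `X (some i)`; the point `X none` is then at infinity.
  let a : I → ℝ := fun i =>
    ((X none).1 * (X (some i)).1 + (X none).2 * (X (some i)).2) / det2 (X none) (X (some i))
  let μ : Option I → ℝ := fun i => i.elim ((X none).1 ^ 2 + (X none).2 ^ 2)⁻¹ fun i =>
    (det2 (X none) (X (some i)))⁻¹
  have hμ : ∀ i, μ i ≠ 0 := by
    rintro (_ | i)
    exacts [inv_ne_zero hN, inv_ne_zero (hd i)]
  have hdet : ∀ i j, det2 (affineConfig a i) (affineConfig a j) =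
      ((X none).1 ^ 2 + (X none).2 ^ 2) * μ i * μ j * det2 (X i) (X j) := by
    rintro (_ | i) (_ | j)
    · simp [det2_self]
    · simp only [μ, Option.elim_none, Option.elim_some]
      rw [mul_inv_cancel₀ hN, one_mul, inv_mul_cancel₀ (hd j)]
      simp [det2, affineConfig]
    · simp only [μ, Option.elim_none, Option.elim_some]
      rw [mul_right_comm (_ ^ 2 + _ ^ 2), mul_inv_cancel₀ hN, one_mul, det2_swap (X none), mul_neg,
        inv_mul_cancel₀ (hd i)]
      simp [det2, affineConfig]
    · have h1 := hd i
      have h2 := hd j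
      simp only [μ, Option.elim_some]
      change a i * 1 - 1 * a j = _
      simp only [a]
      field_simp
      simp only [det2]
      ring
  refine ⟨a, fun i j hij => ?_, (crossRatio_congr hN hμ hdet).symm⟩
  by_contra hne
  have h1 := hdet (some i) (some j)
  have h2 : det2 (affineConfig a (some i)) (affineConfig a (some j)) = 0 := by
    simp [det2, affineConfig, hij]
  rw [h2] at h1
  exact mul_ne_zero (mul_ne_zero (mul_ne_zero hN (hμ _)) (hμ _))
    (hX (some i) (some j) (by simpa using hne)) h1.symm

section Mtilde

variable {I : Type} [Fintype I]

/-- These conditions hold on the open part and are closed. In `Compat`, the limit is legitimate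
because only pairs whose coordinates differ at the limit appear in denominators. -/
theorem Mtilde.equations {y : (I → ℝ) × QuadSpace (Option I)} (hy : y ∈ Mtilde I) :
    ∑ i, y.1 i = 0 ∧ ∑ i, y.1 i ^ 2 = 1 ∧ y.2 ∈ Mbar (Option I) ∧ Compat y.1 y.2 := by
  have hci : ∀ i, Continuous fun y : (I → ℝ) × QuadSpace (Option I) => y.1 i := fun i =>
    (continuous_apply i).comp continuous_fst
  refine ⟨?_, ?_, ?_, fun q i j k h0 h1 h2 h3 hij => ?_⟩
  · have hc : IsClosed {y : (I → ℝ) × QuadSpace (Option I) | ∑ i, y.1 i = 0} :=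
      isClosed_eq (continuous_finsetSum _ fun i _ => hci i) continuous_const
    exact closure_minimal (fun y h => h.1) hc hy
  · have hc : IsClosed {y : (I → ℝ) × QuadSpace (Option I) | ∑ i, y.1 i ^ 2 = 1} :=
      isClosed_eq (continuous_finsetSum _ fun i _ => (hci i).pow 2) continuous_const
    exact closure_minimal (fun y h => h.2.1) hc hy
  · have hc : IsClosed {y : (I → ℝ) × QuadSpace (Option I) | y.2 ∈ Mbar (Option I)} :=
      isClosed_closure.preimage continuous_snd
    refine closure_minimal ?_ hc hy
    rintro y ⟨-, -, h2, h3⟩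
    exact subset_closure ⟨_, isConfig_affineConfig h2, h3⟩
  · rw [Mtilde, mem_closure_iff_nhdsWithin_neBot] at hy
    have hl : ∀ i, Tendsto (fun z : (I → ℝ) × QuadSpace (Option I) => z.1 i)
        (𝓝[{y | ∑ i, y.1 i = 0 ∧ ∑ i, y.1 i ^ 2 = 1 ∧ Function.Injective y.1 ∧
          y.2 = crossRatio (affineConfig y.1)}] y) (𝓝 (y.1 i)) := fun i =>
      ((hci i).tendsto y).mono_left nhdsWithin_le_nhds
    have h4 := ((hl j).sub (hl k)).div ((hl i).sub (hl j)) (sub_ne_zero.2 hij)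
    have h5 := (OnePoint.continuous_coe.tendsto _).comp h4
    have h6 : Tendsto (fun z : (I → ℝ) × QuadSpace (Option I) => z.2 q) (𝓝 y) (𝓝 (y.2 q)) :=
      ((continuous_apply q).comp continuous_snd).tendsto y
    refine tendsto_nhds_unique (h6.mono_left nhdsWithin_le_nhds) (h5.congr' ?_)
    filter_upwards [self_mem_nhdsWithin] with z hz
    rw [hz.2.2.2]
    refine (compat_crossRatio z.1 q i j k h0 h1 h2 h3 fun h => hij ?_).symm
    rw [hz.2.2.1 h]

theorem isCompact_Mtilde : IsCompact (Mtilde I) := by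
  have hK : IsCompact ((Set.univ.pi fun _ : I => Set.Icc (-1 : ℝ) 1) ×ˢ
      (Set.univ : Set (QuadSpace (Option I)))) :=
    (isCompact_univ_pi fun _ => isCompact_Icc).prod isCompact_univ
  refine hK.of_isClosed_subset isClosed_closure fun y hy => ⟨fun i _ => ?_, trivial⟩
  have h1 := (Mtilde.equations hy).2.1
  have h2 : y.1 i ^ 2 ≤ 1 := by
    rw [← h1]
    exact Finset.single_le_sum (f := fun i => y.1 i ^ 2) (fun _ _ => sq_nonneg _)
      (Finset.mem_univ i)
  exact abs_le.1 (by rwa [sq_le_one_iff_abs_le_one] at h2)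

/-- By compactness the projection to the curves has a closed image, and this image contains all the
configurations. -/
theorem exists_mem_Mtilde [Nontrivial I] {p : QuadSpace (Option I)} (hp : p ∈ Mbar (Option I)) :
    ∃ a, (a, p) ∈ Mtilde I := by
  have hc : IsClosed (Prod.snd '' Mtilde I) := (isCompact_Mtilde.image continuous_snd).isClosed
  have hs : {p | ∃ X : Option I → ℝ × ℝ, IsConfig X ∧ p = crossRatio X} ⊆
      Prod.snd '' Mtilde I := by
    rintro _ ⟨X, hX, rfl⟩
    obtain ⟨a, ha, h⟩ := hX.exists_affineConfig
    exact ⟨_, sphereNormalize_mem_Mtilde ha, h.symm⟩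
  obtain ⟨⟨a, p'⟩, h, rfl⟩ := closure_minimal hs hc hp
  exact ⟨a, h⟩

theorem neg_mem_Mtilde {a : I → ℝ} {p : QuadSpace (Option I)} (h : (a, p) ∈ Mtilde I) :
    ((fun i => -a i, p) : (I → ℝ) × QuadSpace (Option I)) ∈ Mtilde I := by
  have hm : MapsTo (fun y : (I → ℝ) × QuadSpace (Option I) =>
      ((fun i => -y.1 i, y.2) : (I → ℝ) × QuadSpace (Option I)))
      {y | ∑ i, y.1 i = 0 ∧ ∑ i, y.1 i ^ 2 = 1 ∧ Function.Injective y.1 ∧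
        y.2 = crossRatio (affineConfig y.1)}
      {y | ∑ i, y.1 i = 0 ∧ ∑ i, y.1 i ^ 2 = 1 ∧ Function.Injective y.1 ∧
        y.2 = crossRatio (affineConfig y.1)} := by
    rintro y ⟨h0, h1, h2, h3⟩
    refine ⟨by simp [h0], by simpa using h1, fun i j hij => h2 (neg_injective hij), ?_⟩
    have := crossRatio_smul y.1 (c := -1) (by norm_num)
    simp only [div_neg, div_one] at this
    exact h3.trans this.symm
  exact hm.closure (Continuous.prodMk (continuous_pi fun i =>
    ((continuous_apply i).comp continuous_fst).neg) continuous_snd) h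

/-- The equations dispense with approximations by configurations. Conversely to `Mtilde.equations`,
the curve has some lift in `Mtilde I`, the given coordinates agree with those of the lift up to
sign, and `Mtilde I` is stable under the change of sign. -/
theorem mem_Mtilde_iff {y : (I → ℝ) × QuadSpace (Option I)} : y ∈ Mtilde I ↔
    ∑ i, y.1 i = 0 ∧ ∑ i, y.1 i ^ 2 = 1 ∧ y.2 ∈ Mbar (Option I) ∧ Compat y.1 y.2 := by
  refine ⟨Mtilde.equations, ?_⟩
  obtain ⟨a, p⟩ := y
  rintro ⟨h0, h1, h2, h3⟩
  obtain ⟨i, j, hij⟩ := exists_ne_of_sum h0 h1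
  have : Nontrivial I := ⟨i, j, fun e => hij (by rw [e])⟩
  obtain ⟨b, hb⟩ := exists_mem_Mtilde h2
  have he := Mtilde.equations hb
  rcases he.2.2.2.eq_or_neg h3 he.1 he.2.1 h0 h1 with h | h
  · have h : a = b := h
    rwa [h]
  · have h : a = fun i => -b i := h
    rw [h]
    exact neg_mem_Mtilde hb

end Mtilde

/-! ### The two-sheeted covers of a tower -/

/-- The order of the affine coordinates. -/
def orderRel {E : Type} (A : E → ℝ) : E → E → Prop := fun z z' => A z ≤ A z'

namespace SplitTower

variable {E : Type} {L : ℕ → Type} {𝕋 : SplitTower E L}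

theorem mem_ball_option {n : ℕ} {z z' : E} :
    some z' ∈ 𝕋.option.tr n ⁻¹' {𝕋.option.tr n (some z)} ↔ 𝕋.tr n z' = 𝕋.tr n z := by
  simp [option]

theorem none_notMem_ball_option {n : ℕ} {z : E} :
    none ∉ 𝕋.option.tr n ⁻¹' {𝕋.option.tr n (some z)} := by
  simp [option]

/-- If `k` has the label of `i` or of `j`, the cross-ratio is degenerate, with value `-1` or `0`, as
the formula requires; otherwise the equation is the one of level `n`. -/
theorem compat_lift {n : ℕ} {a : L n → ℝ} {p : QuadSpace (Option (L n))} (h : Compat a p)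
    (hp : p ∈ Mbar (Option (L n))) : Compat (fun z => a (𝕋.tr n z)) (𝕋.option.lift n p) := by
  intro q i j k h0 h1 h2 h3 hij
  have hcur := 𝕋.option.isCurve_lift hp
  have hcl := fun z : E => 𝕋.option.isCl_lift_ball p
    (𝕋.option.tr_mem_balls le_rfl (𝕋.option.tr n (some z)))
  have hne : 𝕋.tr n i ≠ 𝕋.tr n j := fun e => hij (by simp only [e])
  by_cases hik : 𝕋.tr n k = 𝕋.tr n i
  · rw [(hcl i).odd hcur (by rw [h1, mem_ball_option]) (by rw [h3, mem_ball_option, hik])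
      (by rw [h0]; exact none_notMem_ball_option) (by rw [h2, mem_ball_option]; exact hne.symm)]
    have : a (𝕋.tr n i) - a (𝕋.tr n j) ≠ 0 := sub_ne_zero.2 hij
    simp only [hik]
    rw [OnePoint.coe_eq_coe, eq_div_iff this]
    ring
  by_cases hjk : 𝕋.tr n k = 𝕋.tr n j
  · rw [(hcl j).snd hcur (by rw [h2, mem_ball_option]) (by rw [h3, mem_ball_option, hjk])
      (by rw [h0]; exact none_notMem_ball_option) (by rw [h1, mem_ball_option]; exact hne)]
    simp only [hjk, sub_self, zero_div]
  have hinj : Function.Injective fun s => 𝕋.option.tr n (q s) := by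
    intro s t hst
    have hst : 𝕋.option.tr n (q s) = 𝕋.option.tr n (q t) := hst
    fin_cases s <;> fin_cases t <;> simp_all [option]
  rw [lift_of_injective _ _ hinj]
  refine h ⟨_, hinj⟩ (𝕋.tr n i) (𝕋.tr n j) (𝕋.tr n k) ?_ ?_ ?_ ?_ hij
  · change 𝕋.option.tr n (q 0) = _
    rw [h0]; rfl
  · change 𝕋.option.tr n (q 1) = _
    rw [h1]; rfl
  · change 𝕋.option.tr n (q 2) = _
    rw [h2]; rfl
  · change 𝕋.option.tr n (q 3) = _
    rw [h3]; rfl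

theorem compat_act {A : E → ℝ} {P : QuadSpace (Option E)} (h : Compat A P) (g : Equiv.Perm E) :
    Compat (fun z => A (g⁻¹ z)) (act (Equiv.optionCongr g) P) := by
  intro q i j k h0 h1 h2 h3 hij
  refine h (q.trans (Equiv.optionCongr g⁻¹).toEmbedding) (g⁻¹ i) (g⁻¹ j) (g⁻¹ k) ?_ ?_ ?_ ?_ hij
  · simp [h0]
  · simp [h1]
  · simp [h2]
  · simp [h3]

theorem compat_restrict {A : E → ℝ} {P : QuadSpace (Option E)} (h : Compat A P) (n : ℕ) :
    Compat (fun w => A (𝕋.sec n w)) (restrict (𝕋.option.secEmb n) P) := by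
  intro q i j k h0 h1 h2 h3 hij
  refine h (q.trans (𝕋.option.secEmb n)) (𝕋.sec n i) (𝕋.sec n j) (𝕋.sec n k) ?_ ?_ ?_ ?_ hij
  · simp [h0, option]
  · simp [h1, option]
  · simp [h2, option]
  · simp [h3, option]

variable (𝕋) in
/-- The affine coordinates increase from the left to the right in `T`. -/
def Increasing (n : ℕ) (T : PlanarTree (L n)) (A : E → ℝ) : Prop :=
  (∀ C ∈ 𝕋.clus n T, ∀ z ∈ C, ∀ z' ∈ C, A z = A z') ∧
    ∀ z z', [𝕋.tr n z, 𝕋.tr n z'].Sublist T.labels → (¬ ∃ C ∈ 𝕋.clus n T, z ∈ C ∧ z' ∈ C) →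
      A z < A z'

theorem Increasing.eq_of_tr_eq {n : ℕ} {T : PlanarTree (L n)} {A : E → ℝ}
    (h : 𝕋.Increasing n T A) {z z' : E} (hz : 𝕋.tr n z = 𝕋.tr n z') : A z = A z' :=
  h.1 _ (Or.inl (𝕋.tr_mem_balls le_rfl (𝕋.tr n z))) z rfl z' hz.symm

theorem exists_clus_iff {n : ℕ} {T : PlanarTree (L n)} {z z' : E} (h : 𝕋.tr n z ≠ 𝕋.tr n z') :
    (∃ C ∈ 𝕋.clus n T, z ∈ C ∧ z' ∈ C) ↔ ∃ B ∈ T.clusters, 𝕋.tr n z ∈ B ∧ 𝕋.tr n z' ∈ B := by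
  constructor
  · rintro ⟨C, ⟨k, hk, w, rfl⟩ | ⟨B, hB, rfl⟩, h1, h2⟩
    · exact absurd (𝕋.tr_eq_of_le hk (Eq.trans h1 (Eq.symm h2))) h
    · exact ⟨B, hB, h1, h2⟩
  · rintro ⟨B, hB, h1, h2⟩
    exact ⟨_, Or.inr ⟨B, hB, rfl⟩, h1, h2⟩

theorem increasing_comp_tr {n : ℕ} {T : PlanarTree (L n)} (hT : T.IsNested) {a : L n → ℝ} :
    𝕋.Increasing n T (fun z => a (𝕋.tr n z)) ↔ ∀ i j, [i, j].Sublist T.labels → a i ≤ a j ∧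
      (a i = a j ↔ ∃ A ∈ T.clusters, i ∈ A ∧ j ∈ A) := by
  have hne : ∀ {i j}, [i, j].Sublist T.labels → i ≠ j := fun {i j} h => by
    have := hT.1.sublist h
    simpa using this
  constructor
  · intro h i j hs
    have hi := 𝕋.tr_sec n i
    have hj := 𝕋.tr_sec n j
    have hc := exists_clus_iff (𝕋 := 𝕋) (T := T) (z := 𝕋.sec n i) (z' := 𝕋.sec n j)
      (by rw [hi, hj]; exact hne hs)
    have h2 := h.2 (𝕋.sec n i) (𝕋.sec n j) (by rwa [hi, hj])
    rw [hc] at h2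
    simp only [hi, hj] at h2
    by_cases hA : ∃ A ∈ T.clusters, i ∈ A ∧ j ∈ A
    · obtain ⟨A, hA', hiA, hjA⟩ := hA
      have h1 := h.1 _ (Or.inr ⟨A, hA', rfl⟩) (𝕋.sec n i) (by rwa [mem_preimage, hi])
        (𝕋.sec n j) (by rwa [mem_preimage, hj])
      simp only [hi, hj] at h1
      exact ⟨h1.le, fun _ => ⟨A, hA', hiA, hjA⟩, fun _ => h1⟩
    · exact ⟨(h2 hA).le, fun e => absurd e (h2 hA).ne, fun e => absurd e hA⟩
  · intro h
    refine ⟨?_, fun z z' hs hC => ?_⟩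
    · rintro C (⟨k, hk, w, rfl⟩ | ⟨B, hB, rfl⟩) z hz z' hz'
      · exact congrArg a (𝕋.tr_eq_of_le hk (Eq.trans hz (Eq.symm hz')))
      · by_cases he : 𝕋.tr n z = 𝕋.tr n z'
        · exact congrArg a he
        classical
        rcases lt_or_gt_of_ne fun e => he ((List.idxOf_inj (hT.2.1 _)).1 e) with hlt | hlt
        · refine (h _ _ ((sublist_iff_idxOf hT.1 (fun x _ => hT.2.1 x)).2 ?_)).2.2
            ⟨B, hB, hz, hz'⟩
          simpa using hlt
        · refine ((h _ _ ((sublist_iff_idxOf hT.1 (fun x _ => hT.2.1 x)).2 ?_)).2.2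
            ⟨B, hB, hz', hz⟩).symm
          simpa using hlt
    · rw [exists_clus_iff (hne hs)] at hC
      exact lt_of_le_of_ne (h _ _ hs).1 fun e => hC ((h _ _ hs).2.1 e)

theorem Carries.increasing_iff {g : Equiv.Perm E} {n m : ℕ} {T : PlanarTree (L n)}
    {T' : PlanarTree (L m)} (hg : 𝕋.Carries g T T') {A : E → ℝ} :
    𝕋.Increasing m T' (fun z => A (g⁻¹ z)) ↔ 𝕋.Increasing n T A := by
  have hC : ∀ z z', (∃ C ∈ 𝕋.clus m T', g z ∈ C ∧ g z' ∈ C) ↔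
      ∃ C ∈ 𝕋.clus n T, z ∈ C ∧ z' ∈ C := by
    intro z z'
    constructor
    · rintro ⟨C, hC, h⟩
      exact ⟨g ⁻¹' C, (hg.clus_iff _).2 (by rwa [image_preimage_eq _ g.surjective]), h⟩
    · rintro ⟨C, hC, h1, h2⟩
      exact ⟨_, (hg.clus_iff C).1 hC, mem_image_of_mem g h1, mem_image_of_mem g h2⟩
  have hne : ∀ {z z'}, (¬ ∃ C ∈ 𝕋.clus n T, z ∈ C ∧ z' ∈ C) → 𝕋.tr n z ≠ 𝕋.tr n z' :=
    fun {z z'} h e => h ⟨_, Or.inl (𝕋.tr_mem_balls le_rfl (𝕋.tr n z)), rfl, e.symm⟩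
  obtain ⟨π, F, hπ, hl, hF⟩ := hg.exists_labels
  constructor
  · rintro ⟨h1, h2⟩
    refine ⟨fun C hC z hz z' hz' => ?_, fun z z' hs hCn => ?_⟩
    · simpa using h1 _ ((hg.clus_iff C).1 hC) (g z) (mem_image_of_mem g hz) (g z')
        (mem_image_of_mem g hz')
    · have hs' : [𝕋.tr m (g z), 𝕋.tr m (g z')].Sublist T'.labels := by
        rw [hl]
        refine sublist_flatMap_of_map_sublist (π := π) (fun x => (hF _ _).2 rfl) _ _ ?_
        simpa only [List.map_cons, hπ, List.map_nil] using hs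
      simpa using h2 (g z) (g z') hs' (by rwa [hC])
  · rintro ⟨h1, h2⟩
    refine ⟨fun C hC z hz z' hz' => ?_, fun z z' hs hCn => ?_⟩
    · refine h1 (g ⁻¹' C) ((hg.clus_iff _).2 (by rwa [image_preimage_eq _ g.surjective])) _ ?_ _ ?_
      · simpa using hz
      · simpa using hz'
    · obtain ⟨z, rfl⟩ := g.surjective z
      obtain ⟨z', rfl⟩ := g.surjective z'
      rw [hC] at hCn
      change A (g.symm (g z)) < A (g.symm (g z'))
      rw [g.symm_apply_apply, g.symm_apply_apply]
      refine h2 z z' ?_ hCn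
      rw [hl] at hs
      have := map_sublist_of_sublist_flatMap (fun w x hx => (hF x w).1 hx) _ _ hs
      simp only [List.map_cons, hπ, List.map_nil] at this
      exact this (by simpa using hne hCn)

/-- The action on the pairs formed by an order and a system of cross-ratios. -/
def tildeAct (g : Equiv.Perm E) (y : (E → E → Prop) × QuadSpace (Option E)) :
    (E → E → Prop) × QuadSpace (Option E) :=
  (fun z z' => y.1 (g⁻¹ z) (g⁻¹ z'), act (Equiv.optionCongr g) y.2)

theorem tildeAct_mul (g h : Equiv.Perm E) (y : (E → E → Prop) × QuadSpace (Option E)) :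
    tildeAct (g * h) y = tildeAct g (tildeAct h y) := by
  refine Prod.ext rfl ?_
  change act _ y.2 = act _ (act _ y.2)
  rw [← act_mul]
  congr 1
  ext (_ | z) <;> simp

theorem tildeAct_one (y : (E → E → Prop) × QuadSpace (Option E)) : tildeAct 1 y = y := by
  refine Prod.ext rfl ?_
  change act _ y.2 = _
  conv_rhs => rw [← act_one y.2]
  congr 1
  ext (_ | z) <;> simp

theorem tildeAct_inv_tildeAct (g : Equiv.Perm E) (y : (E → E → Prop) × QuadSpace (Option E)) :
    tildeAct g⁻¹ (tildeAct g y) = y := by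
  rw [← tildeAct_mul, inv_mul_cancel, tildeAct_one]

theorem tildeAct_tildeAct_inv (g : Equiv.Perm E) (y : (E → E → Prop) × QuadSpace (Option E)) :
    tildeAct g (tildeAct g⁻¹ y) = y := by
  rw [← tildeAct_mul, mul_inv_cancel, tildeAct_one]

/-- The action of the permutations of the labels. -/
def tildeActHom (E : Type) :
    Equiv.Perm E →* Equiv.Perm ((E → E → Prop) × QuadSpace (Option E)) where
  toFun g := ⟨tildeAct g, tildeAct g⁻¹, tildeAct_inv_tildeAct g, tildeAct_tildeAct_inv g⟩
  map_one' := Equiv.ext tildeAct_one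
  map_mul' g h := Equiv.ext (tildeAct_mul g h)

variable (𝕋) in
/-- The points of the two-sheeted cover that come from the stratum of a tree of level `n`. -/
def tildeStratum (n : ℕ) (T : PlanarTree (L n)) : Set ((E → E → Prop) × QuadSpace (Option E)) :=
  {y | ∃ A : E → ℝ, y.1 = orderRel A ∧ (∃ z z', A z ≠ A z') ∧ Compat A y.2 ∧
    𝕋.Increasing n T A ∧ y.2 ∈ 𝕋.option.endStratum n T.addRoot}

theorem Carries.tildeAct_mem {g : Equiv.Perm E} {n m : ℕ} {T : PlanarTree (L n)}
    {T' : PlanarTree (L m)} (hg : 𝕋.Carries g T T') (hT' : T'.IsNested)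
    {y : (E → E → Prop) × QuadSpace (Option E)} (hy : y ∈ 𝕋.tildeStratum n T) :
    tildeAct g y ∈ 𝕋.tildeStratum m T' := by
  obtain ⟨A, h1, ⟨z, z', h2⟩, h3, h4, h5⟩ := hy
  refine ⟨fun z => A (g⁻¹ z), ?_, ⟨g z, g z', by simpa using h2⟩, compat_act h3 g,
    hg.increasing_iff.2 h4, (hg.option.mem_endStratum_iff hT'.addRoot).2 h5⟩
  change (fun z z' => y.1 (g⁻¹ z) (g⁻¹ z')) = _
  rw [h1]
  rfl

theorem Carries.tildeAct_image {g : Equiv.Perm E} {n m : ℕ} {T : PlanarTree (L n)}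
    {T' : PlanarTree (L m)} (hg : 𝕋.Carries g T T') (hT' : T'.IsNested) :
    tildeAct g '' 𝕋.tildeStratum n T = 𝕋.tildeStratum m T' := by
  refine Subset.antisymm (image_subset_iff.2 fun y hy => hg.tildeAct_mem hT' hy) fun y hy => ?_
  refine ⟨tildeAct g⁻¹ y, ?_, tildeAct_tildeAct_inv g y⟩
  obtain ⟨A, h1, ⟨z, z', h2⟩, h3, h4, h5⟩ := hy
  have h3' := compat_act h3 g⁻¹
  rw [inv_inv] at h3'
  refine ⟨fun z => A (g z), ?_, ⟨g⁻¹ z, g⁻¹ z', by simpa using h2⟩, h3', ?_, ?_⟩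
  · change (fun z z' => y.1 (g⁻¹⁻¹ z) (g⁻¹⁻¹ z')) = _
    rw [h1]
    rfl
  · refine hg.increasing_iff.1 ?_
    simpa using h4
  · refine (hg.option.mem_endStratum_iff hT'.addRoot).1 ?_
    have := congrArg Prod.snd (tildeAct_tildeAct_inv g y)
    change act (Equiv.optionCongr g) (act (Equiv.optionCongr g⁻¹) y.2) = y.2 at this
    change act (Equiv.optionCongr g) (act (Equiv.optionCongr g⁻¹) y.2) ∈ _
    rwa [this]

/-- The preimage of a ball of level `m` lies in a ball of level `n`, so coordinates of level `n`
transported by `g` are functions of the labels of level `m`. -/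
theorem tr_inv_sec_tr {g : Equiv.Perm E} {n m : ℕ} (h : ∀ C ∈ 𝕋.balls m, g ⁻¹' C ∈ 𝕋.balls n)
    (z : E) : 𝕋.tr n (g⁻¹ (𝕋.sec m (𝕋.tr m z))) = 𝕋.tr n (g⁻¹ z) := by
  obtain ⟨k, hk, w, hw⟩ := h _ (𝕋.tr_mem_balls le_rfl (𝕋.tr m z))
  have h1 : g⁻¹ z ∈ g ⁻¹' (𝕋.tr m ⁻¹' {𝕋.tr m z}) := by simp
  have h2 : g⁻¹ (𝕋.sec m (𝕋.tr m z)) ∈ g ⁻¹' (𝕋.tr m ⁻¹' {𝕋.tr m z}) := by simp [𝕋.tr_sec]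
  rw [hw] at h1 h2
  exact 𝕋.tr_eq_of_le hk (Eq.trans h2 (Eq.symm h1))

/-! ### Finite levels of the two-sheeted cover -/

section Levels

variable [∀ n, Fintype (L n)]

variable (𝕋) in
/-- The order of the affine coordinates and the system of cross-ratios on `E`, for a point of level
`n` of the two-sheeted cover. -/
noncomputable def tildeMap (n : ℕ) (y : Mtilde (L n)) :
    (E → E → Prop) × QuadSpace (Option E) :=
  (orderRel fun z => y.1.1 (𝕋.tr n z), 𝕋.option.lift n y.1.2)

/-- The curve determines the nonconstant coordinates up to sign, and a change of sign would reverse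
their order. -/
theorem tildeMap_injective (n : ℕ) : Function.Injective (𝕋.tildeMap n) := by
  rintro ⟨⟨a, p⟩, hy⟩ ⟨⟨b, p'⟩, hy'⟩ h
  have h2 : p = p' := 𝕋.option.lift_injective n (congrArg Prod.snd h)
  subst h2
  have h1 : ∀ i j, a i ≤ a j ↔ b i ≤ b j := by
    intro i j
    have := congrFun (congrFun (congrArg Prod.fst h) (𝕋.sec n i)) (𝕋.sec n j)
    simpa [tildeMap, orderRel, 𝕋.tr_sec] using this
  have e := Mtilde.equations hy
  have e' := Mtilde.equations hy'
  rcases e.2.2.2.eq_or_neg e'.2.2.2 e.1 e.2.1 e'.1 e'.2.1 with hb | hb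
  · have hb : b = a := hb
    subst hb
    rfl
  · have hb : b = fun i => -a i := hb
    subst hb
    obtain ⟨i, j, hij⟩ := exists_ne_of_sum e.1 e.2.1
    have hij : a i ≠ a j := hij
    have h3 := h1 i j
    have h4 := h1 j i
    rw [neg_le_neg_iff] at h3 h4
    rcases le_total (a i) (a j) with hl | hl
    · exact absurd (le_antisymm hl (h3.1 hl)) hij
    · exact absurd (le_antisymm (h4.1 hl) hl) hij

/-- For surjectivity, the function `A` is constant on the balls of level `n`, so it induces
coordinates on the labels; once normalized, they satisfy the equations of `mem_Mtilde_iff`. -/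
theorem tildeMap_image_stratumTilde {n : ℕ} {T : PlanarTree (L n)} (hT : T.IsNested) :
    𝕋.tildeMap n '' T.stratumTilde = 𝕋.tildeStratum n T := by
  ext Y
  constructor
  · rintro ⟨y, ⟨hy1, hy2⟩, rfl⟩
    obtain ⟨e0, e1, e2, e3⟩ := Mtilde.equations y.2
    obtain ⟨i, j, hij⟩ := exists_ne_of_sum e0 e1
    exact ⟨_, rfl, ⟨𝕋.sec n i, 𝕋.sec n j, by simpa only [𝕋.tr_sec] using hij⟩, compat_lift e3 e2,
      (increasing_comp_tr hT).2 hy1, (mem_quadCell_iff (𝕋 := 𝕋.option) hT.addRoot e2).1 hy2⟩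
  · rintro ⟨A, h1, ⟨z, z', h2⟩, h3, h4, h5⟩
    have hc := 𝕋.option.endStratum_subset n _ h5
    have hm := 𝕋.option.restrict_mem_Mbar_of_mem_curves hc n
    have hl := 𝕋.option.lift_restrict hc
    have hA : ∀ z, A (𝕋.sec n (𝕋.tr n z)) = A z := fun z => h4.eq_of_tr_eq (𝕋.tr_sec n _)
    have hne : ∃ i j, A (𝕋.sec n i) ≠ A (𝕋.sec n j) :=
      ⟨𝕋.tr n z, 𝕋.tr n z', by rwa [hA, hA]⟩
    have : Nonempty (L n) := ⟨𝕋.tr n z⟩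
    have hle := @sphereNormalize_le_iff _ _ _ hne
    have heq : ∀ {i j}, sphereNormalize (fun w => A (𝕋.sec n w)) i =
        sphereNormalize (fun w => A (𝕋.sec n w)) j ↔ A (𝕋.sec n i) = A (𝕋.sec n j) := by
      intro i j
      rw [le_antisymm_iff, le_antisymm_iff, hle, hle]
    refine ⟨⟨(sphereNormalize fun w => A (𝕋.sec n w), restrict (𝕋.option.secEmb n) Y.2),
      mem_Mtilde_iff.2 ⟨sum_sphereNormalize _, sum_sq_sphereNormalize hne, hm,
        (compat_restrict h3 n).sphereNormalize hne⟩⟩, ⟨?_, ?_⟩, ?_⟩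
    · have h6 : 𝕋.Increasing n T fun z => (fun w => A (𝕋.sec n w)) (𝕋.tr n z) := by
        simpa only [hA] using h4
      intro i j hs
      have h7 := (increasing_comp_tr (𝕋 := 𝕋) (a := fun w => A (𝕋.sec n w)) hT).1 h6 i j hs
      dsimp only
      rw [hle, heq]
      exact h7
    · refine (mem_quadCell_iff (𝕋 := 𝕋.option) hT.addRoot hm).2 ?_
      rwa [hl]
    · refine Prod.ext ?_ hl
      rw [h1]
      funext z z'
      change (_ ≤ _) = (_ ≤ _)
      rw [hle, hA, hA]

/-- The leaves of the target tree may have different depths, so the transported coordinates are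
repeated with unequal multiplicities. Both their mean and their norm change, and they are normalized
again, which does not affect their order. -/
theorem exists_tildeLevelAct {g : Equiv.Perm E} {n m : ℕ}
    (h : ∀ C ∈ 𝕋.balls m, g ⁻¹' C ∈ 𝕋.balls n) : ∃ k : Mtilde (L n) → Mtilde (L m),
      Continuous k ∧ ∀ y, 𝕋.tildeMap m (k y) = tildeAct g (𝕋.tildeMap n y) := by
  have hne : ∀ y : Mtilde (L n), ∃ i j,
      y.1.1 (𝕋.tr n (g⁻¹ (𝕋.sec m i))) ≠ y.1.1 (𝕋.tr n (g⁻¹ (𝕋.sec m j))) := by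
    intro y
    obtain ⟨e0, e1, -, -⟩ := Mtilde.equations y.2
    obtain ⟨i, j, hij⟩ := exists_ne_of_sum e0 e1
    refine ⟨𝕋.tr m (g (𝕋.sec n i)), 𝕋.tr m (g (𝕋.sec n j)), ?_⟩
    have hg : ∀ z, g⁻¹ (g z) = z := g.symm_apply_apply
    rw [tr_inv_sec_tr h, tr_inv_sec_tr h, hg, hg, 𝕋.tr_sec, 𝕋.tr_sec]
    exact hij
  have hmem : ∀ y : Mtilde (L n),
      ((sphereNormalize fun w => y.1.1 (𝕋.tr n (g⁻¹ (𝕋.sec m w))),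
        𝕋.option.levelAct (Equiv.optionCongr g) n m y.1.2) :
          (L m → ℝ) × QuadSpace (Option (L m))) ∈ Mtilde (L m) := by
    intro y
    obtain ⟨-, -, e2, e3⟩ := Mtilde.equations y.2
    have : Nonempty (L m) := ⟨(hne y).choose⟩
    exact mem_Mtilde_iff.2 ⟨sum_sphereNormalize _, sum_sq_sphereNormalize (hne y),
      levelAct_mem (fun _ => preimage_balls_option h) e2,
      (compat_restrict (compat_act (compat_lift e3 e2) g) m).sphereNormalize (hne y)⟩
  refine ⟨fun y => ⟨_, hmem y⟩, Continuous.subtype_mk (Continuous.prodMk ?_ ?_) _, fun y => ?_⟩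
  · refine continuous_sphereNormalize (continuous_pi fun w => ?_) hne
    exact (continuous_apply _).comp (continuous_fst.comp continuous_subtype_val)
  · exact (continuous_levelAct _ n m).comp (continuous_snd.comp continuous_subtype_val)
  · refine Prod.ext ?_ (lift_levelAct (fun _ => preimage_balls_option h) (Mtilde.equations y.2).2.2.1)
    funext z z'
    change (_ ≤ _) = (_ ≤ _)
    rw [sphereNormalize_le_iff (hne y), tr_inv_sec_tr h, tr_inv_sec_tr h]

end Levels

end SplitTower

/-! ### The tower of the two-sheeted covers -/

theorem tildeMap_exp (n : ℕ) (y : Mtilde (Label Unit n)) :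
    (endTower Unit).tildeMap (n + 1) (expTilde Unit n y) = (endTower Unit).tildeMap n y := by
  refine Prod.ext ?_ ((endTower Unit).option.lift_stabilize n y.1.2)
  funext z z'
  exact propext (div_le_div_iff_of_pos_right (by positivity : (0 : ℝ) < √2))

theorem desc_image_towerTildeStratum {n : ℕ} {T : PlanarTree (Label Unit n)} (hT : T.IsNested) :
    SeqColimit.desc (endTower Unit).tildeMap tildeMap_exp '' towerTildeStratum n T =
      (endTower Unit).tildeStratum n T := by
  rw [← tildeMap_image_stratumTilde hT, towerTildeStratum, image_image]
  rfl

theorem ActsTilde.act_image {g : Equiv.Perm (End Unit)} {s s' : Set TowerTilde}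
    (h : ActsTilde g s s') :
    tildeAct g '' (SeqColimit.desc (endTower Unit).tildeMap tildeMap_exp '' s) =
      SeqColimit.desc (endTower Unit).tildeMap tildeMap_exp '' s' := by
  obtain ⟨σ, n, m, T, T', hσ, hT, rfl, hc, hT', rfl⟩ := h
  rw [desc_image_towerTildeStratum hT.1, desc_image_towerTildeStratum hT'.1,
    (hσ.carries hc).tildeAct_image hT'.1]

theorem towerTildeStratum_expand {n m : ℕ} (h : n ≤ m) {T : PlanarTree (Label Unit n)}
    (hT : T.IsRooted) : ∃ T' : PlanarTree (Label Unit m), T'.IsRooted ∧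
      T'.dimRooted = T.dimRooted ∧ towerTildeStratum m T' = towerTildeStratum n T := by
  obtain ⟨s, hs, hsn, hst⟩ := exists_symbol_one Unit n
  obtain ⟨T', hc, hT', hd⟩ := TreeSymbol.exists_composeExpand_rooted hsn
    (fun f hf => (hst f hf).trans_le h) hT
  refine ⟨T', hT', hd, ?_⟩
  have := ActsTilde.act_image ⟨s, n, m, T, T', hs, hT, rfl, hc, hT', rfl⟩
  rw [show (tildeAct 1 : _ × QuadSpace (Option (End Unit)) → _) = id from funext tildeAct_one,
    image_id] at this
  exact (SeqColimit.desc_injective tildeMap_injective).image_injective this.symm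

theorem exists_actsTilde {g : Equiv.Perm (End Unit)} (hg : g ∈ NeretinN) {d : ℕ}
    {s : Set TowerTilde} (hs : s ∈ stratTilde d) : ∃ s' ∈ stratTilde d, ActsTilde g s s' := by
  obtain ⟨n, T, hT, hd, rfl⟩ := hs
  obtain ⟨N, hN⟩ := exists_symbol_of_mem hg
  obtain ⟨T₁, hT₁, hd₁, he⟩ := towerTildeStratum_expand (le_max_left n N) hT
  obtain ⟨σ, hσ, hσn⟩ := hN (max n N) (le_max_right _ _)
  obtain ⟨m, hm⟩ := σ.exists_bound
  obtain ⟨T', hc, hT', hd'⟩ := TreeSymbol.exists_composeExpand_rooted hσn hm hT₁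
  exact ⟨_, ⟨m, T', hT', by rw [hd', hd₁, hd], rfl⟩, σ, _, m, T₁, T', hσ, hT₁, he.symm, hc, hT', rfl⟩

theorem nontrivial_label {n : ℕ} (hn : 1 ≤ n) : Nontrivial (Label Unit n) :=
  ⟨((), fun _ => true), ((), fun _ => false), fun h => by
    have := congrFun (congrArg Prod.snd h) (⟨0, hn⟩ : Fin n)
    exact Bool.noConfusion this⟩

theorem tilde_faithful {g : Equiv.Perm (End Unit)}
    (h : ∀ n y, tildeAct g ((endTower Unit).tildeMap n y) = (endTower Unit).tildeMap n y) :
    g = 1 := by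
  by_contra hg
  obtain ⟨z, hz⟩ : ∃ z, g z ≠ z := by
    by_contra hcon
    push Not at hcon
    exact hg (Equiv.ext hcon)
  obtain ⟨b, c, -, hbc, -, -, hb, hc, -⟩ := exists_points z (g z)
  -- The base point is fixed by every `g` and serves as one of the three auxiliary entries.
  have hQ : Function.Injective ![none, some z, some b, some c] := by
    intro i j hij
    fin_cases i <;> fin_cases j <;> simp_all
  have hgQ : ∀ k, (Equiv.optionCongr g)⁻¹ ((⟨_, hQ⟩ : Fin 4 ↪ _) k) ≠ (⟨_, hQ⟩ : Fin 4 ↪ _) 1 := by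
    intro k hk
    have hk : ![none, some z, some b, some c] k = some (g z) := by
      rw [Equiv.Perm.inv_eq_iff_eq] at hk
      exact hk
    fin_cases k
    · simp at hk
    · exact hz (Option.some_injective _ hk).symm
    · exact hb.2 (Option.some_injective _ hk)
    · exact hc.2 (Option.some_injective _ hk)
  -- At level `0` there is a single label and the cover is empty; from level `1` on, injective
  -- coordinates can be normalized.
  obtain ⟨n, hn, hn1⟩ := (((endTower Unit).option.eventually_act_ne hgQ).and
    (eventually_ge_atTop 1)).exists
  have := nontrivial_label hn1
  obtain ⟨a, a', ha, ha', hne, hi⟩ := exists_move (trunc n z)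
  rcases hn (affineConfig a) (affineConfig a') (isConfig_affineConfig ha)
    (isConfig_affineConfig ha') (by
      rintro (_ | w) hw
      · rfl
      · have hw : w ≠ trunc n z := fun e => hw (congrArg some e)
        simp [affineConfig, hne w hw]) (by
      change a (trunc n z) * 1 - 1 * a' (trunc n z) ≠ 0
      rw [mul_one, one_mul]
      exact sub_ne_zero.2 hi) with h' | h'
  · exact h' (congrArg Prod.snd (h n ⟨_, sphereNormalize_mem_Mtilde ha⟩))
  · exact h' (congrArg Prod.snd (h n ⟨_, sphereNormalize_mem_Mtilde ha'⟩))

theorem tilde_cellular_action :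
    (∀ g : NeretinN, ∀ s ∈ ⋃ d, stratTilde d, ∃! s', ActsTilde g s s') ∧
      ∃ γ : NeretinN →* HomeoCell stratTilde, Function.Injective γ ∧
        ∀ (g : NeretinN) (s s' : Set TowerTilde), ActsTilde g s s' →
          (γ g : TowerTilde ≃ₜ TowerTilde) '' s = s' := by
  refine SeqColimit.exists_cellular_action (hΦ := tildeMap_exp)
    ((tildeActHom (End Unit)).comp NeretinN.subtype) tildeMap_injective (fun g n => ?_)
    (fun g h => ?_) (Acts := fun g s s' => ActsTilde g s s') (fun g s s' h => h.act_image)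
    (fun g d s hs => exists_actsTilde g.2 hs)
  · obtain ⟨m, hm⟩ := exists_preimage_balls g.2 n
    exact ⟨m, exists_tildeLevelAct hm⟩
  · exact Subtype.ext (tilde_faithful fun n y => h (SeqColimit.ι n y))

end ModularTower

open ModularTower in
theorem theorem1 :
    ((∀ g ∈ NeretinN, ∀ s ∈ ⋃ d, stratTilde d, ∃! s', ActsTilde g s s') ∧
      ∃ γ : NeretinN →* HomeoCell stratTilde, Function.Injective γ ∧
        (∀ (g : NeretinN) (s s' : Set TowerTilde), ActsTilde g s s' →
          (γ g : TowerTilde ≃ₜ TowerTilde) '' s = s') ∧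
        ∃ γV : ThompsonV →* HomeoCell stratTilde, Function.Injective γV ∧
          ∀ g : ThompsonV, γV g = γ (Subgroup.inclusion (thompsonGroup_le Unit) g)) ∧
    ((∀ g ∈ CyclicN, ∀ s ∈ ⋃ d, stratBar d, ∃! s', ActsBar g s s') ∧
      ∃ γ : CyclicN →* HomeoCell stratBar, Function.Injective γ ∧
        (∀ (g : CyclicN) (s s' : Set TowerBar), ActsBar g s s' →
          (γ g : TowerBar ≃ₜ TowerBar) '' s = s') ∧
        ∃ γV : CyclicV →* HomeoCell stratBar, Function.Injective γV ∧
          ∀ g : CyclicV, γV g = γ (Subgroup.inclusion (thompsonGroup_le (Fin 3)) g)) := by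
  obtain ⟨h1, γ, hγ, hγs⟩ := tilde_cellular_action
  obtain ⟨h1', γ', hγ', hγs'⟩ := bar_cellular_action
  exact ⟨⟨fun g hg => h1 ⟨g, hg⟩, γ, hγ, hγs, γ.comp (Subgroup.inclusion (thompsonGroup_le Unit)),
      hγ.comp (Subgroup.inclusion_injective _), fun _ => rfl⟩,
    fun g hg => h1' ⟨g, hg⟩, γ', hγ', hγs', γ'.comp (Subgroup.inclusion (thompsonGroup_le (Fin 3))),
    hγ'.comp (Subgroup.inclusion_injective _), fun _ => rfl⟩
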